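/- **Setting.** Let $\mathbb{K}$ be the function field of a smooth projective geometrically connected curve over a finite field $\mathbb{F}_q$ of characteristic $p$, let $\infty$ be a closed point, $A\subset\mathbb{K}$ the ring of functions regular outside $\infty$, $\mathbb{K}_\infty$ the completion of $\mathbb{K}$ at $\infty$ with normalized absolute value $|x|=q^{\deg x}$, and $\mathbf{C}_\infty$ the completion of an algebraic closure of $\mathbb{K}_\infty$. Let $\mathbb{A}_f$ be the ring of finite adeles of $\mathbb{K}$ (restricted product over the primes of $A$) and $R=\prod_v A_v$. *Lattices.* A ($1$-dimensional) $\mathbb{K}$-rational lattice is a pair $L=(\Lambda,\phi)$ of a fractional ideal $\Lambda\subset\mathbb{K}$ of $A$ and an $A$-linear map $\phi:\mathbb{K}/A=\mathbb{A}_f/R\to\mathbb{A}_f/\Lambda R=\mathbb{K}/\Lambda$, i.e. multiplication by a unique element of $\Lambda R\subset\mathbb{A}_f$, again denoted $\phi$. For adelic data $(s,\rho)\in\mathbb{A}_f^*\times R$ this is $\Lambda R=s^{-1}R$, $\phi=\rho s^{-1}$. $L=(\Lambda,\phi)$ and $L'=(\Lambda',\phi')$ are commensurable, $L\sim L'$,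 if $\phi=\phi'$ in $\mathbb{A}_f$. $\mathbb{K}^*$ acts by isomorphisms $r(\Lambda,\phi)=(r\Lambda,r\phi)$. Fractional ideals carry the discrete topology and $\phi$ the adelic topology. *Algebra.* $\mathcal{A}=\mathcal{A}(\mathbb{A}_f/\mathbb{K}^*)$ is the algebra of continuous $\mathbf{C}_\infty$-valued functions $f(L,L')$ of pairs $L\sim L'$ with $f(rL,rL')=f(L,L')$ for $r\in\mathbb{K}^*$ and with compact support modulo $\mathbb{K}^*$, with product $(f_1*f_2)(L,L')=\sum_{L''\sim L}f_1(L,L'')f_2(L'',L')$. Its norm $\|\cdot\|$ is the supremum over all $L$ of the operator norms of the representations $(\pi_L(f)\xi)(L')=\sum_{L''\sim L}f(L',L'')\xi(L'')$ on finitely supported $\mathbf{C}_\infty$-valued functions $\xi$ on $\{L':L'\sim L\}$ with the supremum norm. *Time evolution.* Fix a uniformizer $\pi$ of $\mathbb{K}_\infty$. An element $\lambda\in\mathbb{K}_\infty^*$ is positive if $\langle\lambda\rangle:=\lambda\pi^{-v_\infty(\lambda)}$ is a one-unit. Let $I\mapsto\langle I\rangle$ be the unique homomorphism from fractional ideals of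 $A$ to one-units of $\mathbf{C}_\infty$ with $\langle (a)\rangle=\langle a\rangle$ for $a\in\mathbb{K}^*$ positive. For $s=(x,y)\in S_\infty=\mathbf{C}_\infty^*\times\mathbb{Z}_p$ put $I^s=x^{\deg I}\langle I\rangle^y$, and $\lambda^s=x^{\deg\lambda}\langle\lambda\rangle^y$ for $\lambda$ positive, where $w^y=\sum_{j\ge0}\binom{y}{j}(w-1)^j$. Then $(\sigma_sf)(L,L')=(I/J)^sf(L,L')$, where $I,J$ are the fractional ideals of $L,L'$. A KMS$_x$ state ($x\in\mathbf{C}_\infty^*$) is a bounded $\mathbf{C}_\infty$-linear functional $\varphi:\mathcal{A}\to\mathbf{C}_\infty$ with $\varphi(1)=1$ and $\varphi(f_1\sigma_{(x,0)}(f_2))=\varphi(f_2f_1)$ for all $f_1,f_2\in\mathcal{A}$. *The maps $\theta_u$.* Let $u\in R\cap\mathbb{A}_f^*$ and $J=uR\cap\mathbb{K}$. $L=(\Lambda,\phi)$ is divisible by $J$ if $\phi\in u\Lambda R$; then $L_u:=(\Lambda,u^{-1}\phi)$. Put $$\theta_u(f)(L,L')=\begin{cases}f(L_u,L'_u)&L,L'\text{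 divisible by }J,\\0&\text{otherwise.}\end{cases}$$ **Theorem.** The algebra $\mathcal{A}$ is unital, and: 1. $u\mapsto\theta_u$ is a non-trivial action of the semigroup $R\cap\mathbb{A}_f^*$ by (not necessarily unital) algebra endomorphisms of $\mathcal{A}$: $\theta_1=\mathrm{id}$, $\theta_{uv}=\theta_u\theta_v$, and $\theta_u\ne\mathrm{id}$ for some $u$. Moreover $\|\theta_u(f)\|\le\|f\|$ and $\theta_u\sigma_s=\sigma_s\theta_u$ for all $s\in S_\infty$. 2. Every $u\in A\smallsetminus\{0\}$, with $J=(u)$, acts by an inner endomorphism. The functions $$\mu_J(L,L')=\begin{cases}1&L\text{ divisible by }J\text{ and }L'=uL_u,\\0&\text{otherwise,}\end{cases}\qquad\tilde\mu_J(L,L')=\mu_J(L',L)$$ on pairs $L\sim L'$ belong to $\mathcal{A}$, $\tilde\mu_J*\mu_J=1$, $\theta_u(f)=\mu_J*f*\tilde\mu_J$ for all $f\in\mathcal{A}$, and there is a positive $\lambda\in\mathbb{K}_\infty^*$ with $\sigma_s(\mu_J)=\lambda^s\mu_J$ for all $s\in S_\infty$. 3. For every $x\in\mathbf{C}_\infty^*$,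 every KMS$_x$ state $\varphi$ and every $u\in R\cap\mathbb{A}_f^*$ one has $\varphi(\theta_u(1))\neq0$, and there is a unique action of the group $\mathbb{A}_f^*/\mathbb{K}^*$ on the set of KMS$_x$ states in which the class of each $u\in R\cap\mathbb{A}_f^*$ acts by $\varphi\mapsto\varphi(\theta_u(1))^{-1}\,\varphi\circ\theta_u$. -/

import Mathlib

open scoped nonZeroDivisors WithZero NNReal ENNReal
open IsDedekindDomain
open scoped IsDedekindDomain.FiniteAdeleRing

noncomputable section

namespace KRational

/-! ### The place at infinity, the completion and the field `C∞` -/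

/-- A place of `K` (for `K` a function field over a finite field: a closed point of the curve),
given by its normalized discrete valuation, written multiplicatively: the usual additive valuation
`v` is related to it by `val x = exp (-v x)`. The residue field of a closed point is finite. -/
structure Place (K : Type*) [Field K] where
  val : Valuation K ℤᵐ⁰
  surj : Function.Surjective val
  finite_residue : Finite (IsLocalRing.ResidueField val.valuationSubring)

namespace Place

variable {K : Type*} [Field K] (P : Place K)

/-- The cardinality `q ^ d` of the residue field of the place. -/
def resCard : ℕ := Nat.card (IsLocalRing.ResidueField P.val.valuationSubring)

lemma one_lt_resCard : 1 < P.resCard := by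
  have := P.finite_residue
  exact Finite.one_lt_card

lemma resCard_ne_zero : (P.resCard : ℝ≥0) ≠ 0 := by
  have := P.one_lt_resCard
  exact_mod_cast (by omega : P.resCard ≠ 0)

lemma one_lt_resCard' : 1 < (P.resCard : ℝ≥0) := by exact_mod_cast P.one_lt_resCard

/-- The normalized absolute value `|x| = q ^ (-d v(x))` of the place. -/
def absVal : AbsoluteValue K ℝ where
  toFun x := (WithZeroMulInt.toNNReal P.resCard_ne_zero (P.val x) : ℝ)
  map_mul' x y := by simp
  nonneg' x := NNReal.coe_nonneg _
  eq_zero' x := by simp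
  add_le' x y := by
    have h := (WithZeroMulInt.toNNReal_strictMono P.one_lt_resCard').monotone (P.val.map_add x y)
    rw [(WithZeroMulInt.toNNReal_strictMono P.one_lt_resCard').monotone.map_max] at h
    have h2 := h.trans (max_le_add_of_nonneg zero_le zero_le)
    exact_mod_cast h2

lemma isNonarchimedean_absVal : IsNonarchimedean P.absVal := by
  intro x y
  have h := (WithZeroMulInt.toNNReal_strictMono P.one_lt_resCard').monotone (P.val.map_add x y)
  rw [(WithZeroMulInt.toNNReal_strictMono P.one_lt_resCard').monotone.map_max] at h
  exact_mod_cast h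

/-- The completion `K∞` of `K` at the place. -/
abbrev KInf := P.absVal.Completion

instance : IsUltrametricDist (WithAbs P.absVal) :=
  IsUltrametricDist.isUltrametricDist_of_forall_norm_add_le_max_norm fun x y =>
    P.isNonarchimedean_absVal x.ofAbs y.ofAbs

instance : IsUltrametricDist P.KInf :=
  IsUltrametricDist.isUltrametricDist_of_forall_norm_add_le_max_norm fun x y => by
    induction x, y using UniformSpace.Completion.induction_on₂ with
    | hp => exact isClosed_le (by fun_prop) (by fun_prop)
    | ih a b =>
      rw [← UniformSpace.Completion.coe_add]
      simp only [UniformSpace.Completion.norm_coe]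
      exact IsUltrametricDist.norm_add_le_max a b

instance : NontriviallyNormedField P.KInf where
  non_trivial := by
    obtain ⟨x, hx⟩ := P.surj (WithZero.exp 1)
    refine ⟨((WithAbs.toAbs P.absVal x : WithAbs P.absVal) : P.KInf), ?_⟩
    rw [UniformSpace.Completion.norm_coe]
    change 1 < P.absVal x
    have h1 : (1 : ℤᵐ⁰) < P.val x := by
      rw [hx, ← WithZero.exp_zero, WithZero.exp_lt_exp]
      exact one_pos
    have h := WithZeroMulInt.toNNReal_strictMono P.one_lt_resCard' h1
    rw [map_one] at h
    exact_mod_cast h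

/-- The algebraic closure of `K∞` carries the unique extension of the absolute value. -/
instance : NormedField (AlgebraicClosure P.KInf) :=
  spectralNorm.normedField P.KInf (AlgebraicClosure P.KInf)

/-- The field `C∞`: the completion of an algebraic closure of `K∞`. -/
abbrev CInf := UniformSpace.Completion (AlgebraicClosure P.KInf)

/-- The embedding of `K∞` in `C∞`. -/
def embed : P.KInf →+* P.CInf :=
  (UniformSpace.Completion.coeRingHom (α := AlgebraicClosure P.KInf)).comp
    (algebraMap P.KInf (AlgebraicClosure P.KInf))

end Place

/-! ### Rank one rational lattices and commensurability -/

section Lattices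

variable (A K : Type*) [CommRing A] [IsDedekindDomain A] [Field K] [Algebra A K]
  [IsFractionRing A K]

/-- The ring `R = ∏ A_v` of finite integral adeles. -/
def integralAdeles : Subring 𝔸ᶠ[A, K] where
  carrier := {a | ∀ v, a v ∈ v.adicCompletionIntegers K}
  mul_mem' ha hb v := mul_mem (ha v) (hb v)
  one_mem' _ := one_mem _
  add_mem' ha hb v := add_mem (ha v) (hb v)
  zero_mem' _ := zero_mem _
  neg_mem' ha v := neg_mem (ha v)

/-- The semigroup `R ∩ 𝔸ˣ` of ideles that are integral adeles. -/
def integralIdeles : Submonoid 𝔸ᶠ[A, K]ˣ :=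
  (integralAdeles A K).toSubmonoid.comap (Units.coeHom 𝔸ᶠ[A, K])

variable {A K}

/-- The lattice `Λ R ⊆ 𝔸` generated by a fractional ideal `Λ ⊆ K`. -/
def adelicSpan (I : (FractionalIdeal A⁰ K)ˣ) : Submodule (integralAdeles A K) 𝔸ᶠ[A, K] :=
  Submodule.span (integralAdeles A K)
    (algebraMap K 𝔸ᶠ[A, K] '' {x | x ∈ (I : FractionalIdeal A⁰ K)})

variable (A K) in
/-- A one-dimensional `K`-rational lattice `(Λ, φ)`: a fractional ideal `Λ ⊆ K` and an `A`-linear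
map `φ : K / A → K / Λ`. Since `K / A = 𝔸 / R` and `K / Λ = 𝔸 / Λ R`, the map `φ` is multiplication
by a unique finite adele, again denoted `phi`, which lies in `Λ R`. In terms of the adelic data
`(s, ρ)`, with `s` an idele and `ρ ∈ R`, one has `Λ R = s⁻¹ R` and `phi = ρ s⁻¹`. -/
@[ext]
structure KLattice where
  lat : (FractionalIdeal A⁰ K)ˣ
  phi : 𝔸ᶠ[A, K]
  mem : phi ∈ adelicSpan lat

/-- The fractional ideals form a discrete set and `phi` has the adelic topology. -/
instance : TopologicalSpace (KLattice A K) :=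
  .induced KLattice.lat ⊥ ⊓ .induced KLattice.phi inferInstance

lemma smul_mem_adelicSpan (r : Kˣ) {I : (FractionalIdeal A⁰ K)ˣ} {z : 𝔸ᶠ[A, K]}
    (hz : z ∈ adelicSpan I) :
    algebraMap K 𝔸ᶠ[A, K] r * z ∈ adelicSpan (toPrincipalIdeal A K r * I) := by
  induction hz using Submodule.span_induction with
  | mem x hx =>
    obtain ⟨y, hy, rfl⟩ := hx
    refine Submodule.subset_span ⟨r * y, ?_, map_mul _ _ _⟩
    simp only [Set.mem_ofPred_eq, Units.val_mul, coe_toPrincipalIdeal]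
    exact FractionalIdeal.mul_mem_mul (FractionalIdeal.mem_spanSingleton_self _ _) hy
  | zero => simp
  | add x y _ _ hx hy => rw [mul_add]; exact add_mem hx hy
  | smul a x _ hx => rw [mul_smul_comm]; exact Submodule.smul_mem _ a hx

/-- The isomorphic lattice `(r Λ, r φ)`, for `r ∈ Kˣ`. -/
instance : SMul Kˣ (KLattice A K) where
  smul r L := ⟨toPrincipalIdeal A K r * L.lat, algebraMap K 𝔸ᶠ[A, K] r * L.phi,
    smul_mem_adelicSpan r L.mem⟩

instance : MulAction Kˣ (KLattice A K) where
  one_smul L := by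
    ext1
    · change toPrincipalIdeal A K 1 * L.lat = L.lat
      simp
    · change algebraMap K 𝔸ᶠ[A, K] ((1 : Kˣ) : K) * L.phi = L.phi
      simp
  mul_smul r s L := by
    ext1
    · change toPrincipalIdeal A K (r * s) * L.lat = _ * (_ * L.lat)
      rw [map_mul, mul_assoc]
    · change algebraMap K 𝔸ᶠ[A, K] ((r * s : Kˣ) : K) * L.phi = _ * (_ * L.phi)
      rw [Units.val_mul, map_mul, mul_assoc]

variable (A K) in
/-- A pair of commensurable lattices: `φ` and `φ'` agree modulo `Λ + Λ'`, that is, are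
multiplication by the same finite adele `ρ s⁻¹ = ρ' s'⁻¹`. -/
@[ext]
structure CommPair where
  fst : KLattice A K
  snd : KLattice A K
  comm : fst.phi = snd.phi

instance : TopologicalSpace (CommPair A K) :=
  .induced CommPair.fst inferInstance ⊓ .induced CommPair.snd inferInstance

/-- Simultaneous isomorphism of the two lattices of a commensurable pair. -/
instance : SMul Kˣ (CommPair A K) where
  smul r P := ⟨r • P.fst, r • P.snd, congrArg (algebraMap K 𝔸ᶠ[A, K] r * ·) P.comm⟩

/-- `L` is divisible by (the ideal `u R ∩ K` of) `u` and `M = L_u`: the lattices have the adelic data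
`(s, ρ_u u)` and `(s, ρ_u)`, that is, `L = (Λ, φ)` and `M = (Λ, u⁻¹ φ)`. -/
def IsQuotientBy (u : 𝔸ᶠ[A, K]ˣ) (L M : KLattice A K) : Prop :=
  M.lat = L.lat ∧ L.phi = u * M.phi

/-! ### The convolution algebra of the commensurability relation -/

variable {C : Type*} [NormedField C]

/-- The convolution product `(f₁ * f₂)(L, L') = ∑ f₁(L, L'') f₂(L'', L')`, the sum being over all
`L''` commensurable with `L`. -/
def conv (f g : CommPair A K → C) (P : CommPair A K) : C :=
  ∑ᶠ L : {L : KLattice A K // L.phi = P.fst.phi},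
    f ⟨P.fst, L, L.2.symm⟩ * g ⟨L, P.snd, L.2.trans P.comm⟩

/-- Supports are compact modulo simultaneous isomorphism. -/
def HasCompactSupportMod (f : CommPair A K → C) : Prop :=
  ∃ S : Set (CommPair A K), IsCompact S ∧ ∀ P, f P ≠ 0 → ∃ r : Kˣ, r • P ∈ S

variable (A K C) in
/-- The convolution algebra `𝒜(𝔸 / Kˣ)` with coefficients in `C`: continuous functions `f(L, L')`
of pairs of commensurable lattices, which depend only on the isomorphism class of the pair and
are compactly supported as functions of this class. -/
def ConvAlg : Submodule C (CommPair A K → C) where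
  carrier := {f | Continuous f ∧ (∀ (r : Kˣ) P, f (r • P) = f P) ∧ HasCompactSupportMod f}
  zero_mem' := ⟨continuous_zero, fun _ _ => rfl, ∅, isCompact_empty, fun _ h => (h rfl).elim⟩
  add_mem' := by
    rintro f g ⟨hf, hf', S, hS, hS'⟩ ⟨hg, hg', T, hT, hT'⟩
    refine ⟨hf.add hg, fun r P => by simp [hf', hg'], S ∪ T, hS.union hT, fun P h => ?_⟩
    by_cases h0 : f P = 0
    · obtain ⟨r, hr⟩ := hT' P fun h1 => h (by simp [h0, h1])
      exact ⟨r, Or.inr hr⟩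
    · obtain ⟨r, hr⟩ := hS' P h0
      exact ⟨r, Or.inl hr⟩
  smul_mem' := by
    rintro c f ⟨hf, hf', S, hS, hS'⟩
    refine ⟨hf.const_smul c, fun r P => by simp [hf'], S, hS, fun P h => hS' P fun h1 => h ?_⟩
    simp [h1]

/-! The rest of this section shows that `ConvAlg` is an algebra for the convolution product. -/

lemma isOpen_adelicSpan (I : (FractionalIdeal A⁰ K)ˣ) :
    IsOpen (adelicSpan I : Set 𝔸ᶠ[A, K]) := by
  have hR : IsOpen (integralAdeles A K : Set 𝔸ᶠ[A, K]) :=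
    RestrictedProduct.isOpen_forall_mem
      (fun v : HeightOneSpectrum A => Valued.isOpen_valuationSubring (v.adicCompletion K))
  obtain ⟨x, hx, hx0⟩ : ∃ x ∈ (I : FractionalIdeal A⁰ K), x ≠ 0 := by
    by_contra! h
    exact I.ne_zero (FractionalIdeal.eq_zero_iff.2 h)
  let u := FiniteAdeleRing.unitEmbedding A K (Units.mk0 x hx0)
  have hu : (u : 𝔸ᶠ[A, K]) = algebraMap K 𝔸ᶠ[A, K] x := rfl
  refine AddSubgroup.isOpen_of_mem_nhds (adelicSpan I).toAddSubgroup (g := 0) ?_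
  have hc : Continuous fun z : 𝔸ᶠ[A, K] => (u⁻¹ : 𝔸ᶠ[A, K]ˣ) * z := by fun_prop
  refine Filter.mem_of_superset ((hR.preimage hc).mem_nhds (by simp)) fun z hz => ?_
  have h1 : z = (⟨_, hz⟩ : integralAdeles A K) • algebraMap K 𝔸ᶠ[A, K] x := by
    rw [← hu]
    change z = (((u⁻¹ : 𝔸ᶠ[A, K]ˣ) : 𝔸ᶠ[A, K]) * z) * u
    rw [mul_right_comm, Units.inv_mul, one_mul]
  have h2 : z ∈ adelicSpan I := by
    rw [h1]
    exact Submodule.smul_mem _ _ (Submodule.subset_span ⟨x, hx, rfl⟩)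
  exact h2

lemma isClosed_adelicSpan (I : (FractionalIdeal A⁰ K)ˣ) :
    IsClosed (adelicSpan I : Set 𝔸ᶠ[A, K]) :=
  AddSubgroup.isClosed_of_isOpen (adelicSpan I).toAddSubgroup (isOpen_adelicSpan I)

namespace CommPair

lemma continuous_phi : Continuous fun P : CommPair A K => P.fst.phi :=
  (continuous_iff_le_induced.2 inf_le_right : Continuous (KLattice.phi (A := A) (K := K))).comp
    (continuous_iff_le_induced.2 inf_le_left)

lemma isOpen_lat (p : (FractionalIdeal A⁰ K)ˣ → (FractionalIdeal A⁰ K)ˣ → Prop) :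
    IsOpen {P : CommPair A K | p P.fst.lat P.snd.lat} := by
  let : TopologicalSpace (FractionalIdeal A⁰ K)ˣ := ⊥
  have : DiscreteTopology (FractionalIdeal A⁰ K)ˣ := ⟨rfl⟩
  have h : Continuous (KLattice.lat (A := A) (K := K)) :=
    continuous_iff_le_induced.2 inf_le_left
  have h1 : Continuous fun P : CommPair A K => P.fst.lat :=
    h.comp (continuous_iff_le_induced.2 inf_le_left)
  have h2 : Continuous fun P : CommPair A K => P.snd.lat :=
    h.comp (continuous_iff_le_induced.2 inf_le_right)
  exact (isOpen_discrete {q : (FractionalIdeal A⁰ K)ˣ × (FractionalIdeal A⁰ K)ˣ | p q.1 q.2}).preimage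
    (h1.prodMk h2)

/-- The commensurable pair with given ideals and given adele. -/
def mk' (I J : (FractionalIdeal A⁰ K)ˣ) (z : 𝔸ᶠ[A, K]) (h : z ∈ adelicSpan I ∧ z ∈ adelicSpan J) :
    CommPair A K := ⟨⟨I, z, h.1⟩, ⟨J, z, h.2⟩, rfl⟩

lemma continuous_mk' (I J : (FractionalIdeal A⁰ K)ˣ) :
    Continuous fun z : {z : 𝔸ᶠ[A, K] // z ∈ adelicSpan I ∧ z ∈ adelicSpan J} =>
      mk' I J z.1 z.2 := by
  have key : ∀ (f : {z : 𝔸ᶠ[A, K] // z ∈ adelicSpan I ∧ z ∈ adelicSpan J} → KLattice A K)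
      (T : (FractionalIdeal A⁰ K)ˣ), (∀ z, (f z).lat = T) → (∀ z, (f z).phi = z.1) →
      Continuous f := by
    intro f T h1 h2
    refine continuous_inf_rng.2 ⟨continuous_induced_rng.2 ?_, continuous_induced_rng.2 ?_⟩
    · let : TopologicalSpace (FractionalIdeal A⁰ K)ˣ := ⊥
      exact (continuous_const (y := T)).congr fun z => (h1 z).symm
    · exact continuous_subtype_val.congr fun z => (h2 z).symm
  exact continuous_inf_rng.2 ⟨continuous_induced_rng.2 (key _ I (fun _ => rfl) fun _ => rfl),
    continuous_induced_rng.2 (key _ J (fun _ => rfl) fun _ => rfl)⟩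

lemma mk'_eq (P : CommPair A K) : mk' P.fst.lat P.snd.lat P.fst.phi
    ⟨P.fst.mem, P.comm ▸ P.snd.mem⟩ = P := by
  exact CommPair.ext (KLattice.ext rfl rfl) (KLattice.ext rfl P.comm)

end CommPair

open Classical in
/-- Extension by zero of a function of commensurable pairs. -/
def extZero (f : CommPair A K → C) (I J : (FractionalIdeal A⁰ K)ˣ) (z : 𝔸ᶠ[A, K]) : C :=
  if h : z ∈ adelicSpan I ∧ z ∈ adelicSpan J then f (CommPair.mk' I J z h) else 0

lemma extZero_self (f : CommPair A K → C) (P : CommPair A K) :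
    extZero f P.fst.lat P.snd.lat P.fst.phi = f P := by
  rw [extZero, dif_pos ⟨P.fst.mem, P.comm ▸ P.snd.mem⟩, CommPair.mk'_eq]

lemma mem_of_extZero {f : CommPair A K → C} {I J : (FractionalIdeal A⁰ K)ˣ} {z : 𝔸ᶠ[A, K]}
    (h : extZero f I J z ≠ 0) : z ∈ adelicSpan I ∧ z ∈ adelicSpan J := by
  by_contra h0
  exact h (dif_neg h0)

lemma continuous_extZero {f : CommPair A K → C} (hf : Continuous f)
    (I J : (FractionalIdeal A⁰ K)ˣ) : Continuous (extZero f I J) := by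
  rw [continuous_iff_continuousAt]
  intro z
  have hU : IsOpen {z : 𝔸ᶠ[A, K] | z ∈ adelicSpan I ∧ z ∈ adelicSpan J} :=
    (isOpen_adelicSpan I).inter (isOpen_adelicSpan J)
  have hU' : IsClosed {z : 𝔸ᶠ[A, K] | z ∈ adelicSpan I ∧ z ∈ adelicSpan J} :=
    (isClosed_adelicSpan I).inter (isClosed_adelicSpan J)
  by_cases hz : z ∈ adelicSpan I ∧ z ∈ adelicSpan J
  · refine ContinuousOn.continuousAt (s := {z | z ∈ adelicSpan I ∧ z ∈ adelicSpan J}) ?_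
      (hU.mem_nhds hz)
    rw [continuousOn_iff_continuous_domRestrict]
    refine (hf.comp (CommPair.continuous_mk' I J)).congr fun w => ?_
    have hw : w.1 ∈ adelicSpan I ∧ w.1 ∈ adelicSpan J := w.2
    exact (dif_pos hw : extZero f I J w.1 = _).symm
  · refine (continuousAt_const (y := (0 : C))).congr ?_
    filter_upwards [hU'.isOpen_compl.mem_nhds hz] with w hw
    exact (dif_neg hw : extZero f I J w = 0).symm

lemma conv_eq (f g : CommPair A K → C) (P : CommPair A K) :
    conv f g P = ∑ᶠ T, extZero f P.fst.lat T P.fst.phi * extZero g T P.snd.lat P.fst.phi := by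
  let i : {L : KLattice A K // L.phi = P.fst.phi} → (FractionalIdeal A⁰ K)ˣ := fun L => L.1.lat
  have hi : Function.Injective i := fun L M h => Subtype.ext (KLattice.ext h (L.2.trans M.2.symm))
  have h1 : ∀ L : {L : KLattice A K // L.phi = P.fst.phi},
      f ⟨P.fst, L, L.2.symm⟩ * g ⟨L, P.snd, L.2.trans P.comm⟩ =
        extZero f P.fst.lat (i L) P.fst.phi * extZero g (i L) P.snd.lat P.fst.phi := by
    intro L
    have e1 := extZero_self f ⟨P.fst, L, L.2.symm⟩
    have e2 := extZero_self g ⟨L, P.snd, L.2.trans P.comm⟩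
    rw [← e1, ← e2]
    simp only [L.2]
    rfl
  rw [conv, finsum_congr h1,
    ← finsum_mem_range (f := fun T => extZero f P.fst.lat T P.fst.phi *
      extZero g T P.snd.lat P.fst.phi) hi, ← finsum_mem_univ (fun T =>
      extZero f P.fst.lat T P.fst.phi * extZero g T P.snd.lat P.fst.phi)]
  refine finsum_mem_inter_support_eq' _ _ _ fun T hT => ?_
  refine iff_of_true ⟨⟨⟨T, P.fst.phi, ?_⟩, rfl⟩, rfl⟩ trivial
  exact (mem_of_extZero (left_ne_zero_of_mul hT)).2

lemma extZero_conv (f g : CommPair A K → C) (I J : (FractionalIdeal A⁰ K)ˣ) (z : 𝔸ᶠ[A, K]) :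
    extZero (conv f g) I J z = ∑ᶠ T, extZero f I T z * extZero g T J z := by
  by_cases h : z ∈ adelicSpan I ∧ z ∈ adelicSpan J
  · rw [extZero, dif_pos h, conv_eq]
    rfl
  · rw [extZero, dif_neg h]
    symm
    refine finsum_eq_zero_of_forall_eq_zero fun T => ?_
    by_contra h0
    exact h ⟨(mem_of_extZero (left_ne_zero_of_mul h0)).1, (mem_of_extZero (right_ne_zero_of_mul h0)).2⟩

lemma ext_extZero {f g : CommPair A K → C} (h : ∀ I J z, extZero f I J z = extZero g I J z) :
    f = g :=
  funext fun P => by rw [← extZero_self f, ← extZero_self g, h]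

lemma extZero_add (f g : CommPair A K → C) (I J : (FractionalIdeal A⁰ K)ˣ) (z : 𝔸ᶠ[A, K]) :
    extZero (f + g) I J z = extZero f I J z + extZero g I J z := by
  unfold extZero; split_ifs <;> simp

lemma extZero_smul (c : C) (f : CommPair A K → C) (I J : (FractionalIdeal A⁰ K)ˣ) (z : 𝔸ᶠ[A, K]) :
    extZero (c • f) I J z = c * extZero f I J z := by
  unfold extZero; split_ifs <;> simp

namespace ConvAlg

lemma finite_lat {S : Set (CommPair A K)} (hS : IsCompact S) :
    ((fun P : CommPair A K => (P.fst.lat, P.snd.lat)) '' S).Finite := by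
  let : TopologicalSpace ((FractionalIdeal A⁰ K)ˣ × (FractionalIdeal A⁰ K)ˣ) := ⊥
  have : DiscreteTopology ((FractionalIdeal A⁰ K)ˣ × (FractionalIdeal A⁰ K)ˣ) := ⟨rfl⟩
  refine (hS.image (continuous_def.2 fun U _ => ?_)).finite_of_discrete
  exact CommPair.isOpen_lat fun I J => (I, J) ∈ U

lemma exists_finset (f : ConvAlg A K C) : ∃ D : Finset (FractionalIdeal A⁰ K)ˣ,
    ∀ I J z, extZero f.1 I J z ≠ 0 → J * I⁻¹ ∈ D := by
  obtain ⟨-, -, S, hS, hS'⟩ := f.2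
  refine ⟨((finite_lat hS).image fun q => q.2 * q.1⁻¹).toFinset, fun I J z h => ?_⟩
  obtain ⟨r, hr⟩ := hS' (CommPair.mk' I J z (mem_of_extZero h)) (by
    rwa [extZero, dif_pos (mem_of_extZero h)] at h)
  rw [Set.Finite.mem_toFinset]
  refine ⟨_, ⟨_, hr, rfl⟩, ?_⟩
  change (toPrincipalIdeal A K r * J) * (toPrincipalIdeal A K r * I)⁻¹ = _
  rw [mul_inv]
  exact mul_mul_mul_comm _ _ _ _ |>.trans (by rw [mul_inv_cancel, one_mul])

lemma exists_finset' (f : ConvAlg A K C) (I : (FractionalIdeal A⁰ K)ˣ) :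
    ∃ D : Finset (FractionalIdeal A⁰ K)ˣ, ∀ J z, extZero f.1 I J z ≠ 0 → J ∈ D := by
  classical
  obtain ⟨D, hD⟩ := exists_finset f
  refine ⟨D.image (· * I), fun J z h => Finset.mem_image.2 ⟨_, hD I J z h, ?_⟩⟩
  rw [inv_mul_cancel_right]

lemma finsum_eq {D : Finset (FractionalIdeal A⁰ K)ˣ} {f g : CommPair A K → C}
    {I : (FractionalIdeal A⁰ K)ˣ} (hD : ∀ J z, extZero f I J z ≠ 0 → J ∈ D)
    (J : (FractionalIdeal A⁰ K)ˣ) (z : 𝔸ᶠ[A, K]) :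
    ∑ᶠ T, extZero f I T z * extZero g T J z = ∑ T ∈ D, extZero f I T z * extZero g T J z :=
  finsum_eq_sum_of_support_subset _ fun T hT => hD T z (left_ne_zero_of_mul hT)

lemma extZero_inv (f : ConvAlg A K C) (r : Kˣ) (I J : (FractionalIdeal A⁰ K)ˣ) (z : 𝔸ᶠ[A, K]) :
    extZero f.1 (toPrincipalIdeal A K r * I) (toPrincipalIdeal A K r * J)
      (algebraMap K 𝔸ᶠ[A, K] r * z) = extZero f.1 I J z := by
  by_cases h : z ∈ adelicSpan I ∧ z ∈ adelicSpan J
  · rw [extZero, extZero, dif_pos h,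
      dif_pos ⟨smul_mem_adelicSpan r h.1, smul_mem_adelicSpan r h.2⟩]
    exact f.2.2.1 r (CommPair.mk' I J z h)
  · rw [extZero, extZero, dif_neg h, dif_neg]
    rintro ⟨h1, h2⟩
    have key : ∀ {I : (FractionalIdeal A⁰ K)ˣ}, algebraMap K 𝔸ᶠ[A, K] r * z ∈
        adelicSpan (toPrincipalIdeal A K r * I) → z ∈ adelicSpan I := by
      intro I h
      have h3 := smul_mem_adelicSpan r⁻¹ h
      rwa [← mul_assoc, ← mul_assoc, ← map_mul, ← map_mul, inv_mul_cancel, map_one, one_mul,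
        Units.inv_mul, map_one, one_mul] at h3
    exact h ⟨key h1, key h2⟩

lemma conv_mem (f g : ConvAlg A K C) : conv f.1 g.1 ∈ ConvAlg A K C := by
  refine ⟨?_, ?_, ?_⟩
  · rw [continuous_iff_continuousAt]
    intro P
    obtain ⟨D, hD⟩ := exists_finset' f P.fst.lat
    have hc : Continuous fun Q : CommPair A K =>
        ∑ T ∈ D, extZero f.1 P.fst.lat T Q.fst.phi * extZero g.1 T P.snd.lat Q.fst.phi :=
      continuous_finsetSum _ fun T _ =>
        ((continuous_extZero f.2.1 _ _).comp CommPair.continuous_phi).mul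
          ((continuous_extZero g.2.1 _ _).comp CommPair.continuous_phi)
    refine hc.continuousAt.congr ?_
    filter_upwards [(CommPair.isOpen_lat fun I J => I = P.fst.lat ∧ J = P.snd.lat).mem_nhds
      ⟨rfl, rfl⟩] with Q hQ
    rw [conv_eq, hQ.1, hQ.2, finsum_eq hD]
  · intro r P
    rw [conv_eq, conv_eq]
    refine (finsum_comp_equiv (Equiv.mulLeft (toPrincipalIdeal A K r))).symm.trans
      (finsum_congr fun T => ?_)
    exact congrArg₂ _ (extZero_inv f r P.fst.lat T P.fst.phi) (extZero_inv g r T P.snd.lat P.fst.phi)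
  · obtain ⟨E, hE⟩ := exists_finset g
    obtain ⟨-, -, S, hS, hS'⟩ := f.2
    let F := (fun P : CommPair A K => (P.fst.lat, P.snd.lat)) '' S
    have hF : F.Finite := finite_lat hS
    let Z : Set 𝔸ᶠ[A, K] := (fun P : CommPair A K => P.fst.phi) '' S
    have hZ : IsCompact Z := hS.image CommPair.continuous_phi
    let W : Set (CommPair A K) := ⋃ q ∈ F, ⋃ e ∈ E, (fun z : {z : 𝔸ᶠ[A, K] // z ∈ adelicSpan q.1 ∧
      z ∈ adelicSpan (e * q.2)} => CommPair.mk' q.1 (e * q.2) z.1 z.2) '' (Subtype.val ⁻¹' Z)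
    refine ⟨W, ?_, fun P hP => ?_⟩
    · refine hF.isCompact_biUnion fun q _ => E.finite_toSet.isCompact_biUnion fun e _ => ?_
      refine IsCompact.image ?_ (CommPair.continuous_mk' _ _)
      exact (((isClosed_adelicSpan q.1).inter
        (isClosed_adelicSpan (e * q.2))).isClosedEmbedding_subtypeVal).isCompact_preimage hZ
    · rw [conv_eq] at hP
      obtain ⟨T, hT⟩ : ∃ T, extZero f.1 P.fst.lat T P.fst.phi *
          extZero g.1 T P.snd.lat P.fst.phi ≠ 0 := by
        by_contra! h
        exact hP (finsum_eq_zero_of_forall_eq_zero h)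
      have h1 := left_ne_zero_of_mul hT
      have h2 := hE _ _ _ (right_ne_zero_of_mul hT)
      obtain ⟨r, hr⟩ := hS' (CommPair.mk' _ T _ (mem_of_extZero h1)) (by
        rwa [extZero, dif_pos (mem_of_extZero h1)] at h1)
      refine ⟨r, ?_⟩
      simp only [W, Set.mem_iUnion]
      refine ⟨_, ⟨_, hr, rfl⟩, _, h2, ⟨(r • P).fst.phi, (r • P).fst.mem, ?_⟩, ⟨_, hr, rfl⟩, ?_⟩
      · have h3 : P.snd.lat * T⁻¹ * (toPrincipalIdeal A K r * T) = (r • P).snd.lat := by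
          change _ = toPrincipalIdeal A K r * P.snd.lat
          rw [mul_left_comm, inv_mul_cancel_right]
        change _ ∈ adelicSpan (P.snd.lat * T⁻¹ * (toPrincipalIdeal A K r * T))
        rw [h3, (r • P).comm]
        exact (r • P).snd.mem
      · have h3 : P.snd.lat * T⁻¹ * (toPrincipalIdeal A K r * T) = (r • P).snd.lat := by
          change _ = toPrincipalIdeal A K r * P.snd.lat
          rw [mul_left_comm, inv_mul_cancel_right]
        refine CommPair.ext (KLattice.ext rfl rfl) (KLattice.ext h3 ?_)
        exact (r • P).comm

/-- Convolution as the multiplication of the algebra. -/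
instance : Mul (ConvAlg A K C) where
  mul f g := ⟨conv f.1 g.1, conv_mem f g⟩

lemma extZero_mul {D : Finset (FractionalIdeal A⁰ K)ˣ} {f : ConvAlg A K C}
    {I : (FractionalIdeal A⁰ K)ˣ} (hD : ∀ J z, extZero f.1 I J z ≠ 0 → J ∈ D) (g : ConvAlg A K C)
    (J : (FractionalIdeal A⁰ K)ˣ) (z : 𝔸ᶠ[A, K]) :
    extZero (f * g).1 I J z = ∑ T ∈ D, extZero f.1 I T z * extZero g.1 T J z :=
  (extZero_conv _ _ _ _ _).trans (finsum_eq hD J z)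

lemma exists_of_extZero_mul {f g : ConvAlg A K C} {I J : (FractionalIdeal A⁰ K)ˣ} {z : 𝔸ᶠ[A, K]}
    (h : extZero (f * g).1 I J z ≠ 0) : ∃ T, extZero f.1 I T z ≠ 0 ∧ extZero g.1 T J z ≠ 0 := by
  obtain ⟨D, hD⟩ := exists_finset' f I
  rw [extZero_mul hD] at h
  obtain ⟨T, -, hT⟩ := Finset.exists_ne_zero_of_sum_ne_zero h
  exact ⟨T, left_ne_zero_of_mul hT, right_ne_zero_of_mul hT⟩

lemma ext_of {f g : ConvAlg A K C} (h : ∀ I J z, extZero f.1 I J z = extZero g.1 I J z) : f = g :=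
  Subtype.ext (ext_extZero h)

lemma extZero_add' (f g : ConvAlg A K C) (I J : (FractionalIdeal A⁰ K)ˣ) (z : 𝔸ᶠ[A, K]) :
    extZero (f + g).1 I J z = extZero f.1 I J z + extZero g.1 I J z :=
  extZero_add _ _ _ _ _

lemma extZero_smul' (c : C) (f : ConvAlg A K C) (I J : (FractionalIdeal A⁰ K)ˣ) (z : 𝔸ᶠ[A, K]) :
    extZero (c • f).1 I J z = c * extZero f.1 I J z :=
  extZero_smul _ _ _ _ _

lemma extZero_zero (I J : (FractionalIdeal A⁰ K)ˣ) (z : 𝔸ᶠ[A, K]) :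
    extZero (0 : ConvAlg A K C).1 I J z = 0 := by
  unfold extZero; split_ifs <;> rfl

instance : NonUnitalRing (ConvAlg A K C) where
  left_distrib f g h := ext_of fun I J z => by
    obtain ⟨D, hD⟩ := exists_finset' f I
    rw [extZero_add', extZero_mul hD, extZero_mul hD, extZero_mul hD, ← Finset.sum_add_distrib]
    simp only [extZero_add', mul_add]
  right_distrib f g h := ext_of fun I J z => by
    classical
    obtain ⟨D, hD⟩ := exists_finset' f I
    obtain ⟨E, hE⟩ := exists_finset' g I
    have hD' : ∀ J z, extZero f.1 I J z ≠ 0 → J ∈ D ∪ E := fun J z h =>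
      Finset.mem_union_left _ (hD J z h)
    have hE' : ∀ J z, extZero g.1 I J z ≠ 0 → J ∈ D ∪ E := fun J z h =>
      Finset.mem_union_right _ (hE J z h)
    have hS : ∀ J z, extZero (f + g).1 I J z ≠ 0 → J ∈ D ∪ E := fun J z h => by
      rw [extZero_add'] at h
      by_cases h0 : extZero f.1 I J z = 0
      · exact hE' J z fun h1 => h (by rw [h0, h1, add_zero])
      · exact hD' J z h0
    rw [extZero_add', extZero_mul hD', extZero_mul hE', extZero_mul hS, ← Finset.sum_add_distrib]
    simp only [extZero_add', add_mul]
  zero_mul f := ext_of fun I J z => by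
    by_contra h
    rw [extZero_zero] at h
    obtain ⟨T, h1, -⟩ := exists_of_extZero_mul h
    exact h1 (extZero_zero _ _ _)
  mul_zero f := ext_of fun I J z => by
    by_contra h
    rw [extZero_zero] at h
    obtain ⟨T, -, h1⟩ := exists_of_extZero_mul h
    exact h1 (extZero_zero _ _ _)
  mul_assoc f g h := ext_of fun I J z => by
    classical
    obtain ⟨D, hD⟩ := exists_finset' f I
    choose E hE using exists_finset' g
    have hS : ∀ J z, extZero (f * g).1 I J z ≠ 0 → J ∈ D.biUnion E := fun J z h => by
      obtain ⟨T, h1, h2⟩ := exists_of_extZero_mul h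
      exact Finset.mem_biUnion.2 ⟨T, hD _ _ h1, hE _ _ _ h2⟩
    have h1 : ∀ T ∈ D, extZero f.1 I T z * extZero (g * h).1 T J z =
        ∑ U ∈ D.biUnion E, extZero f.1 I T z * (extZero g.1 T U z * extZero h.1 U J z) :=
      fun T hT => by
        rw [extZero_mul fun U w hU => Finset.mem_biUnion.2 ⟨T, hT, hE _ _ _ hU⟩, Finset.mul_sum]
    rw [extZero_mul hS, extZero_mul hD, Finset.sum_congr rfl h1, Finset.sum_comm]
    refine Finset.sum_congr rfl fun U _ => ?_
    rw [extZero_mul hD, Finset.sum_mul]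
    simp only [mul_assoc]

instance : IsScalarTower C (ConvAlg A K C) (ConvAlg A K C) where
  smul_assoc c f g := ext_of fun I J z => by
    obtain ⟨D, hD⟩ := exists_finset' f I
    have hD' : ∀ J z, extZero (c • f).1 I J z ≠ 0 → J ∈ D := fun J z h => by
      rw [extZero_smul'] at h
      exact hD J z (right_ne_zero_of_mul h)
    rw [smul_eq_mul, smul_eq_mul, extZero_mul hD', extZero_smul', extZero_mul hD, Finset.mul_sum]
    simp only [extZero_smul', mul_assoc]

instance : SMulCommClass C (ConvAlg A K C) (ConvAlg A K C) where
  smul_comm c f g := ext_of fun I J z => by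
    obtain ⟨D, hD⟩ := exists_finset' f I
    rw [smul_eq_mul, smul_eq_mul, extZero_smul', extZero_mul hD, extZero_mul hD, Finset.mul_sum]
    simp only [extZero_smul', mul_left_comm]

end ConvAlg

lemma isOpen_twist (c : (FractionalIdeal A⁰ K)ˣ → C) :
    Continuous fun P : CommPair A K => c (P.fst.lat * P.snd.lat⁻¹) :=
  continuous_def.2 fun U _ => CommPair.isOpen_lat fun I J => c (I * J⁻¹) ∈ U

/-- The linear map `f ↦ ((L, L') ↦ c(I / J) f(L, L'))`, with `I`, `J` the fractional ideals
of `L`, `L'`. -/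
def twist (c : (FractionalIdeal A⁰ K)ˣ → C) : ConvAlg A K C →ₗ[C] ConvAlg A K C where
  toFun f := ⟨fun P => c (P.fst.lat * P.snd.lat⁻¹) * f.1 P, (isOpen_twist c).mul f.2.1,
    fun r P => by
      have h : (r • P).fst.lat * (r • P).snd.lat⁻¹ = P.fst.lat * P.snd.lat⁻¹ := by
        change (toPrincipalIdeal A K r * P.fst.lat) * (toPrincipalIdeal A K r * P.snd.lat)⁻¹ = _
        rw [mul_inv, mul_mul_mul_comm, mul_inv_cancel, one_mul]
      simp only [h, f.2.2.1 r P], by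
      obtain ⟨S, hS, hS'⟩ := f.2.2.2
      exact ⟨S, hS, fun P hP => hS' P (right_ne_zero_of_mul hP)⟩⟩
  map_add' f g := Subtype.ext <| funext fun P => mul_add _ _ _
  map_smul' a f := Subtype.ext <| funext fun P => mul_left_comm _ _ _

/-- The representation `π_L(f)(ξ)(L') = ∑ f(L', L'') ξ(L'')` on finitely supported functions on the
commensurability class of `L`. -/
def rep (f : CommPair A K → C) (L : KLattice A K) (ξ : {M : KLattice A K // M.phi = L.phi} →₀ C)
    (M : {M : KLattice A K // M.phi = L.phi}) : C :=
  ξ.sum fun N c => f ⟨M, N, M.2.trans N.2.symm⟩ * c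

/-- The supremum over all `L` of the operator norms of `π_L(f)`, where the space of functions on the
commensurability class of `L` carries the supremum norm. -/
def opNorm (f : CommPair A K → C) : ℝ≥0∞ :=
  ⨆ (L : KLattice A K) (ξ : {M : KLattice A K // M.phi = L.phi} →₀ C) (_ : ξ ≠ 0),
    (⨆ M, ‖rep f L ξ M‖ₑ) / ⨆ M, ‖ξ M‖ₑ

end Lattices

/-! ### The time evolution and KMS functionals -/

section TimeEvolution

/-- `w ^ y = ∑ (y choose j) (w - 1) ^ j` for a one-unit `w` in a field of characteristic `p` and
`y ∈ ℤ_p`. -/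
def onePow (p : ℕ) [Fact p.Prime] {C : Type*} [NormedField C] (w : C) (y : ℤ_[p]) : C :=
  ∑' j : ℕ, ((PadicInt.toZMod (Ring.choose y j)).val : C) * (w - 1) ^ j

namespace Place

variable {K : Type*} [Field K] (P : Place K)

/-- The embedding of `K` in `K∞`. -/
def toKInf (a : K) : P.KInf := (WithAbs.toAbs P.absVal a : WithAbs P.absVal)

/-- The normalized valuation `v∞` on `K∞`: one has `|x| = (q ^ d) ^ (-v∞(x))` for `x ≠ 0`. -/
def ord (x : P.KInf) : ℤ := -Int.log P.resCard ‖x‖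

/-- The degree on `K∞`: one has `|x| = q ^ deg x` for `x ≠ 0`, where `q` is the cardinality of the
constant field `F`. -/
def deg (F : Type*) (x : P.KInf) : ℤ := Int.log (Nat.card F) ‖x‖

/-- A uniformizer of `K∞`. -/
def IsUniformizer (π : P.KInf) : Prop := ‖π‖ = (P.resCard : ℝ)⁻¹

/-- `x / π ^ v∞(x)`. Any `x ≠ 0` in `K∞` is uniquely `x = sign(x) π ^ v∞(x) ⟨x⟩` with `sign(x)` a
root of unity of order prime to the characteristic and `⟨x⟩` a one-unit; this is `⟨x⟩` if
`sign(x) = 1`. -/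
def angle (π x : P.KInf) : P.KInf := x * π ^ (-P.ord x)

/-- `x` is positive, `sign(x) = 1`, for the sign function of the uniformizer `π`:
`x / π ^ v∞(x)` is a one-unit. -/
def IsPositive (π x : P.KInf) : Prop := ‖P.angle π x - 1‖ < 1

/-- `x ^ s = t ^ deg(x) ⟨x⟩ ^ y` for `x ∈ K∞` positive and `s = (t, y)` in `C∞ˣ × ℤ_p`. -/
def posPow (F : Type*) (p : ℕ) [Fact p.Prime] (π x : P.KInf) (s : P.CInfˣ × ℤ_[p]) : P.CInf :=
  ((s.1 ^ P.deg F x : P.CInfˣ) : P.CInf) * onePow p (P.embed (P.angle π x)) s.2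

variable {A : Type*} [CommRing A] [IsDedekindDomain A] [Algebra A K] [IsFractionRing A K]

/-- The homomorphism `I ↦ ⟨I⟩`: the unique extension of `(a) ↦ ⟨a⟩`, for `a ∈ K` positive, to a
homomorphism from the group of fractional ideals to the group of one-units of `C∞`. (The latter is
uniquely divisible, and the ideals `(a)` form a subgroup of finite index.) -/
def angleIdeal (A : Type*) [CommRing A] [IsDedekindDomain A] [Algebra A K] [IsFractionRing A K]
    (π : P.KInf) : (FractionalIdeal A⁰ K)ˣ →* P.CInfˣ :=
  Classical.epsilon fun h => (∀ I, ‖(h I : P.CInf) - 1‖ < 1) ∧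
    ∀ a : Kˣ, P.IsPositive π (P.toKInf a) →
      (h (toPrincipalIdeal A K a) : P.CInf) = P.embed (P.angle π (P.toKInf a))

end Place

variable (F : Type*) [Field F] (p : ℕ) [Fact p.Prime]
  {A K : Type*} [CommRing A] [IsDedekindDomain A] [Field K] [Algebra A K] [IsFractionRing A K]
  [Algebra F A] (P : Place K) (π : P.KInf)

/-- The degree of a fractional ideal of the `F`-algebra `A`. -/
def degIdeal (I : (FractionalIdeal A⁰ K)ˣ) : ℤ :=
  ∑ᶠ v : HeightOneSpectrum A,
    FractionalIdeal.count K v (I : FractionalIdeal A⁰ K) * Module.finrank F (A ⧸ v.asIdeal)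

/-- `I ^ s = t ^ deg(I) ⟨I⟩ ^ y` for `s = (t, y)` in `C∞ˣ × ℤ_p`. -/
def idealPow (s : P.CInfˣ × ℤ_[p]) (I : (FractionalIdeal A⁰ K)ˣ) : P.CInf :=
  ((s.1 ^ degIdeal F I : P.CInfˣ) : P.CInf) * onePow p (P.angleIdeal A π I : P.CInf) s.2

/-- The time evolution `σ_s(f)(L, L') = (I / J) ^ s f(L, L')`, where `I` and `J` are the fractional
ideals of `L` and `L'`. -/
def timeEvolution (s : P.CInfˣ × ℤ_[p]) : ConvAlg A K P.CInf →ₗ[P.CInf] ConvAlg A K P.CInf :=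
  twist (idealPow F p P π s)

/-- `e` is the identity of the algebra. -/
def IsIdentity {A K C : Type*} [CommRing A] [IsDedekindDomain A] [Field K] [Algebra A K]
    [IsFractionRing A K] [NormedField C] (e : ConvAlg A K C) : Prop :=
  ∀ f, e * f = f ∧ f * e = f

/-- KMS functionals at inverse temperature `x`: continuous linear functionals `φ` such that
`φ(f σ_x(g)) = φ(g f)`, with `σ_x = σ_s` for `s = (x, 0)`, and `φ(1) = 1`. -/
structure IsKMS (x : P.CInfˣ) (φ : ConvAlg A K P.CInf →ₗ[P.CInf] P.CInf) : Prop where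
  bounded : ∃ B : ℝ≥0, ∀ f, ‖φ f‖ₑ ≤ B * opNorm f.1
  kms : ∀ f g, φ (f * timeEvolution F p P π (x, 0) g) = φ (g * f)
  normalized : ∃ e, IsIdentity e ∧ φ e = 1

end TimeEvolution

/-! ### The curve -/

/-- `K` is the function field of a geometrically connected smooth projective curve over the finite
field `F` (a finitely generated extension of transcendence degree one with full constant field
`F`), and `A` is the ring of functions that are regular outside the point `P`. -/
structure IsRegularOutside (F A : Type*) {K : Type*} [Field F] [CommRing A] [Field K] [Algebra A K]
    [Algebra F K] (P : Place K) : Prop where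
  fg : (⊤ : IntermediateField F K).FG
  trdeg : Algebra.trdeg F K = 1
  constants : ∀ x : K, IsAlgebraic F x → x ∈ Set.range (algebraMap F K)
  regular : ∀ x : K, x ∈ Set.range (algebraMap A K) ↔
    ∀ Q : Place K, Q.val ≠ P.val → Q.val x ≤ 1

end KRational

end

open KRational

/-! ### Valuations with finite residue field, and poles of transcendental elements -/

namespace KRational

/-! Everything rests on two families of operations on $\mathcal A$. For a fractional ideal $B$,
`shift B` is the characteristic function of the pairs $((\Lambda,\phi),(B\Lambda,\phi))$. For an
idele $u$, `translate u` is the automorphism $f\mapsto f(u^{-1}L,u^{-1}L')$, where $u$ multiplies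
both the ideal and the adele of a lattice. If $B$ is integral, then `shift B⁻¹ * shift B = 1`, so
conjugation by `shift B` is a not necessarily unital endomorphism. With $J=uR\cap\mathbb K$,
$\theta_u$ is translation by $u$ followed by conjugation by `shift J`: the first divides the ideals
by $J$, the second restores them, and only $\phi$ remains divided by $u$ (`extZero_divEndo`). The
action laws, the norm bound and the commutation with $\sigma_s$ follow from this formula. The norm
bound also uses that, by the ultrametric inequality, the operator norm is the supremum norm.

Elements of $\mathcal A$ are $\mathbb K^*$-invariant, so translation by a principal idele is trivial
and $\theta_u$ is inner for $u\in A$, with $\mu_J$ equal to `shift J`. Since `shift J` is an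
eigenvector of the time evolution with eigenvalue $(J^{-1})^s$, the KMS condition turns
$\varphi\circ\theta_u$ into a nonzero multiple of $\varphi$ composed with translation by $u$
(`IsKMS.apply_divEndo`). The normalized action on KMS states is therefore translation. It is trivial
on $\mathbb K^*$, and it is determined by the integral ideles because they meet every class
(`existsUnique_action`).

Two arithmetic inputs remain. The functions `shift B`, in particular the unit, have compact support
modulo $\mathbb K^*$ because the class group is finite and $R$ is compact. Both facts come from
counting elements of $A$ by pole order at infinity, an elementary substitute for Riemann–Roch that
also gives the product formula (`card_quotient_span`, `absVal_eq_pow_degIdeal`). The count starts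
from the fact that a nonconstant element of $A$ has a pole at infinity (`exists_place_one_lt`).

Secondly, $I\mapsto\langle I\rangle$ must exist, and $(b)^s$ must be of the form $\lambda^s$.
Existence holds because one-units of an algebraically closed field form a divisible group
(`exists_angleIdeal`). The element $\lambda$ is obtained from $b$ by removing the Teichmüller part
of its sign (`exists_isPositive_posPow_eq`). -/

lemma isUnit_valuationSubring_iff {K Γ : Type*} [Field K] [LinearOrderedCommGroupWithZero Γ]
    (v : Valuation K Γ) {a : v.valuationSubring} : IsUnit a ↔ v a = 1 := by
  constructor
  · intro h
    obtain ⟨b, hb⟩ := isUnit_iff_exists_inv.1 h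
    have h1 : v a * v b = 1 := by
      rw [← map_mul]
      exact (congrArg (fun c : v.valuationSubring => v (c : K)) hb).trans v.map_one
    exact le_antisymm a.2 (h1 ▸ mul_le_of_le_one_right' b.2)
  · intro h
    have h0 : (a : K) ≠ 0 := by
      intro h0
      rw [h0, map_zero] at h
      exact zero_ne_one h
    refine isUnit_iff_exists_inv.2 ⟨⟨(a : K)⁻¹, ?_⟩, Subtype.ext (mul_inv_cancel₀ h0)⟩
    rw [Valuation.mem_valuationSubring_iff, map_inv₀, h, inv_one]

/-- A nontrivial valuation with values in `ℤᵐ⁰` and finite residue field becomes a place after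
rescaling its value group. -/
lemma exists_place_valuationSubring_eq {K : Type*} [Field K] (w : Valuation K ℤᵐ⁰)
    (hfin : Finite (IsLocalRing.ResidueField w.valuationSubring)) {x : K} (hx : 1 < w x) :
    ∃ Q : Place K, Q.val.valuationSubring = w.valuationSubring := by
  classical
  -- The exponents that occur as values form a subgroup `gℤ`. Dividing all exponents by `g` makes
  -- the valuation surjective and leaves its valuation ring unchanged.
  let H : AddSubgroup ℤ :=
    { carrier := {n | ∃ y, w y = WithZero.exp n}
      add_mem' := by
        rintro a b ⟨y, hy⟩ ⟨z, hz⟩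
        exact ⟨y * z, by rw [map_mul, hy, hz, WithZero.exp_add]⟩
      zero_mem' := ⟨1, by simp⟩
      neg_mem' := by
        rintro a ⟨y, hy⟩
        exact ⟨y⁻¹, by rw [map_inv₀, hy, WithZero.exp_neg]⟩ }
  have hw : ∀ {y : K}, y ≠ 0 → w y = WithZero.exp (WithZero.log (w y)) := fun hy =>
    (WithZero.exp_log ((map_ne_zero w).2 hy)).symm
  obtain ⟨g, hg0, hg⟩ : ∃ g : ℤ, 0 < g ∧ ∀ n, n ∈ H ↔ g ∣ n := by
    obtain ⟨g, hg⟩ := Int.subgroup_cyclic H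
    have hg' : ∀ n, n ∈ H ↔ g ∣ n := fun n => by
      rw [hg, AddSubgroup.mem_closure_singleton]
      constructor
      · rintro ⟨k, rfl⟩; exact ⟨k, by simp [mul_comm]⟩
      · rintro ⟨k, rfl⟩; exact ⟨k, by simp [mul_comm]⟩
    have hx0 : x ≠ 0 := by rintro rfl; simp at hx
    refine ⟨|g|, abs_pos.2 ?_, fun n => (hg' n).trans (abs_dvd g n).symm⟩
    rintro rfl
    have h1 : WithZero.log (w x) ∈ H := ⟨x, hw hx0⟩
    rw [hg', zero_dvd_iff] at h1
    rw [hw hx0, h1, WithZero.exp_zero] at hx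
    exact lt_irrefl _ hx
  have hdvd : ∀ {y : K}, y ≠ 0 → g ∣ WithZero.log (w y) := fun hy => (hg _).1 ⟨_, hw hy⟩
  let f : K → ℤᵐ⁰ := fun y => if y = 0 then 0 else WithZero.exp (WithZero.log (w y) / g)
  have f0 : f 0 = 0 := if_pos rfl
  have f1 : ∀ {y}, y ≠ 0 → f y = WithZero.exp (WithZero.log (w y) / g) := fun hy => if_neg hy
  have hle : ∀ {y z : K}, w y ≤ w z → f y ≤ f z := by
    intro y z h
    by_cases hy : y = 0
    · rw [hy, f0]; exact zero_le
    have hz : z ≠ 0 := by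
      rintro rfl
      rw [map_zero, le_zero_iff, map_eq_zero] at h
      exact hy h
    rw [f1 hy, f1 hz, WithZero.exp_le_exp]
    refine Int.ediv_le_ediv hg0 ?_
    rwa [hw hy, hw hz, WithZero.exp_le_exp] at h
  let v : Valuation K ℤᵐ⁰ :=
    { toFun := f
      map_zero' := f0
      map_one' := by rw [f1 one_ne_zero]; simp
      map_mul' := by
        intro y z
        by_cases hy : y = 0
        · simp [hy, f0]
        by_cases hz : z = 0
        · simp [hz, f0]
        rw [f1 hy, f1 hz, f1 (mul_ne_zero hy hz), ← WithZero.exp_add, map_mul,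
          WithZero.log_mul ((map_ne_zero w).2 hy) ((map_ne_zero w).2 hz),
          Int.add_ediv_of_dvd_left (hdvd hy)]
      map_add_le_max' := by
        intro y z
        rcases le_total (w y) (w z) with h | h
        · exact le_max_of_le_right (hle ((w.map_add y z).trans (max_le h le_rfl)))
        · exact le_max_of_le_left (hle ((w.map_add y z).trans (max_le le_rfl h))) }
  have hv : v.valuationSubring = w.valuationSubring := by
    ext y
    rw [Valuation.mem_valuationSubring_iff, Valuation.mem_valuationSubring_iff]
    change f y ≤ 1 ↔ _
    by_cases hy : y = 0
    · simp [hy, f0]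
    rw [f1 hy, hw hy, ← WithZero.exp_zero, WithZero.exp_le_exp, WithZero.exp_le_exp,
      WithZero.log_exp]
    obtain ⟨k, hk⟩ := hdvd hy
    rw [hk, Int.mul_ediv_cancel_left _ hg0.ne']
    constructor
    · intro h; nlinarith
    · intro h; nlinarith
  refine ⟨⟨v, fun c => ?_, hv ▸ hfin⟩, hv⟩
  by_cases hc : c = 0
  · exact ⟨0, by rw [hc, map_zero]⟩
  obtain ⟨y, hy⟩ := (hg (g * WithZero.log c)).2 ⟨_, rfl⟩
  have hy0 : y ≠ 0 := by
    rintro rfl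
    rw [map_zero] at hy
    exact WithZero.exp_ne_zero hy.symm
  refine ⟨y, ?_⟩
  change f y = c
  rw [f1 hy0, hy, WithZero.log_exp, Int.mul_ediv_cancel_left _ hg0.ne', WithZero.exp_log hc]

/-- A local homomorphism of valuation rings embeds the residue fields. This is applied below to an
iterated Frobenius. -/
lemma finite_residueField_comap {K L Γ : Type*} [Field K] [Field L]
    [LinearOrderedCommGroupWithZero Γ] (v : Valuation L Γ)
    [Finite (IsLocalRing.ResidueField v.valuationSubring)] (f : K →+* L) :
    Finite (IsLocalRing.ResidueField (v.comap f).valuationSubring) := by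
  let φ : (v.comap f).valuationSubring →+* v.valuationSubring :=
    (f.comp (v.comap f).valuationSubring.subtype).codRestrict v.valuationSubring.toSubring
      fun y => y.2
  have : IsLocalHom φ := by
    refine ⟨fun a ha => ?_⟩
    have h1 : v (f a) = 1 := (isUnit_valuationSubring_iff v).1 ha
    exact (isUnit_valuationSubring_iff _).2 h1
  exact Finite.of_injective (IsLocalRing.ResidueField.map φ) (RingHom.injective _)

/-- Every `v`-integral element of `K` is congruent to an element of `R` modulo the maximal ideal, so
`R ⧸ v` surjects onto the residue field. -/
lemma finite_residueField_valuation {R K : Type*} [CommRing R] [IsDedekindDomain R] [Field K]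
    [Algebra R K] [IsFractionRing R K] (v : HeightOneSpectrum R) [Finite (R ⧸ v.asIdeal)] :
    Finite (IsLocalRing.ResidueField (v.valuation K).valuationSubring) := by
  let φ : R →+* (v.valuation K).valuationSubring :=
    (algebraMap R K).codRestrict (v.valuation K).valuationSubring.toSubring
      fun y => v.valuation_le_one y
  let ψ := (IsLocalRing.residue _).comp φ
  have hψ : ∀ a ∈ v.asIdeal, ψ a = 0 := by
    intro a ha
    refine (IsLocalRing.residue_eq_zero_iff _).2 ?_
    rw [IsLocalRing.mem_maximalIdeal, mem_nonunits_iff, isUnit_valuationSubring_iff]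
    exact ((v.valuation_lt_one_iff_mem (K := K) a).2 ha).ne
  refine Finite.of_surjective (Ideal.Quotient.lift v.asIdeal ψ hψ) fun z => ?_
  obtain ⟨z, rfl⟩ := IsLocalRing.residue_surjective z
  obtain ⟨a, ha⟩ := v.exists_valuation_sub_lt_of_integer (K := K) z.2 (γ := 1)
  refine ⟨Ideal.Quotient.mk _ a, ?_⟩
  rw [Ideal.Quotient.lift_mk]
  refine (Ideal.Quotient.mk_eq_mk_iff_sub_mem _ _).2 ?_
  rw [IsLocalRing.mem_maximalIdeal, mem_nonunits_iff, isUnit_valuationSubring_iff]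
  exact ne_of_lt ha

/-- Raising to a power of the exponential characteristic is additive, so the largest exponent needed
on a finite spanning set suffices everywhere. -/
lemma hasExponent_of_finiteDimensional (L K : Type*) [Field L] [Field K] [Algebra L K]
    [FiniteDimensional L K] [IsPurelyInseparable L K] : IsPurelyInseparable.HasExponent L K := by
  classical
  let p := ringExpChar L
  have : ExpChar K p := expChar_of_injective_algebraMap (algebraMap L K).injective p
  obtain ⟨s, hs⟩ := (Module.finite_def (R := L) (M := K)).1 inferInstance
  choose e he using fun a : K => IsPurelyInseparable.pow_mem L p a
  refine ⟨s.sup e, fun a => ?_⟩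
  have ha : a ∈ Submodule.span L (s : Set K) := hs ▸ Submodule.mem_top
  change a ^ p ^ s.sup e ∈ (algebraMap L K).range
  induction ha using Submodule.span_induction with
  | mem x hx =>
    obtain ⟨d, hd⟩ := Nat.exists_eq_add_of_le (Finset.le_sup (f := e) hx)
    rw [hd, pow_add, pow_mul]
    exact pow_mem (he x) _
  | zero => rw [zero_pow (expChar_pow_pos L p _).ne']; exact zero_mem _
  | add x y _ _ hx hy => rw [add_pow_expChar_pow]; exact add_mem hx hy
  | smul c x _ hx => rw [Algebra.smul_def, mul_pow, ← map_pow]; exact mul_mem ⟨_, rfl⟩ hx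

lemma finite_quotient_of_liesOver {R S : Type*} [CommRing R] [CommRing S] [Algebra R S]
    [Module.Finite R S] (p : Ideal R) (P : Ideal S) [P.LiesOver p] [Finite (R ⧸ p)] :
    Finite (S ⧸ P) := by
  have : Module.Finite (R ⧸ p) (S ⧸ P) := inferInstance
  exact Module.finite_of_finite (R ⧸ p)

set_option maxHeartbeats 1000000 in
open scoped IntermediateField.algebraAdjoinAdjoin in
/-- A transcendental element of a function field has a pole. -/
theorem exists_place_one_lt {F K : Type*} [Field F] [Finite F] [Field K] [Algebra F K]
    (fg : (⊤ : IntermediateField F K).FG) (trdeg : Algebra.trdeg F K = 1) {x : K}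
    (hx : Transcendental F x) : ∃ Q : Place K, 1 < Q.val x := by
  classical
  have hx0 : x ≠ 0 := by
    rintro rfl
    exact hx isAlgebraic_zero
  -- A pole of `x` is a zero of `y`; it is found as a prime above `y` in an integral closure of
  -- `F[y]`.
  set y := x⁻¹ with hy
  have hty : Transcendental F y := by
    intro h
    exact hx (by simpa [hy] using h.inv)
  let S := Algebra.adjoin F {y}
  let E := IntermediateField.adjoin F {y}
  have halg : Algebra.IsAlgebraic E K := by
    have hbasis : IsTranscendenceBasis F (fun _ : Unit => y) :=
      AlgebraicIndependent.isTranscendenceBasis_of_lift_trdeg_le_of_finite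
        (algebraicIndependent_unique_type_iff.2 hty) (by simp [trdeg])
    have h1 := hbasis.isAlgebraic_field
    rwa [Set.range_const] at h1
  have hfd : FiniteDimensional E K := by
    have := IntermediateField.fg_top_iff.1 fg
    have : Algebra.EssFiniteType E K := Algebra.EssFiniteType.of_comp F E K
    exact Algebra.finite_of_essFiniteType_of_isAlgebraic
  let e := Polynomial.algEquivOfTranscendental F y hty
  have hpid : IsPrincipalIdealRing S :=
    IsPrincipalIdealRing.of_surjective e.toRingEquiv.toRingHom e.surjective
  -- `K` may be inseparable over `E = F(y)`. The integral closure of `F[y]` is therefore taken in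
  -- the separable part `L`, where it is a finite module, and the resulting valuation is carried to
  -- `K` by an iterated Frobenius `K → L`.
  let L := separableClosure E K
  have : FiniteDimensional L K := inferInstance
  have hins : IsPurelyInseparable L K := separableClosure.isPurelyInseparable E K
  have hexp := hasExponent_of_finiteDimensional L K
  let B := integralClosure S L
  have hded : IsDedekindDomain B := integralClosure.isDedekindDomain S E L
  have hfr : IsFractionRing B L := integralClosure.isFractionRing_of_finite_extension E L
  have hBfin : Module.Finite S B := IsIntegralClosure.finite S E L B
  let yS : S := ⟨y, Algebra.self_mem_adjoin_singleton F y⟩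
  have hyS0 : yS ≠ 0 := fun h => hx0 (by simpa [hy, yS] using congrArg Subtype.val h)
  have hyS : ¬ IsUnit yS := by
    intro h
    have h1 := h.map e.symm.toRingEquiv.toRingHom
    have h2 : e.symm yS = Polynomial.X := by
      rw [AlgEquiv.symm_apply_eq]
      refine Subtype.ext ?_
      simp [e, yS]
    change IsUnit (e.symm yS) at h1
    rw [h2] at h1
    exact Polynomial.not_isUnit_X h1
  have hinj : Function.Injective (algebraMap S B) := fun a b h =>
    Subtype.ext (congrArg (fun z : B => ((z : L) : K)) h)
  have : FaithfulSMul S B := (faithfulSMul_iff_algebraMap_injective S B).2 hinj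
  have : Algebra.IsIntegral S B := inferInstance
  obtain ⟨m, hm, hym⟩ := exists_max_ideal_of_mem_nonunits hyS
  obtain ⟨M, hM, hMm⟩ := Ideal.exists_maximal_ideal_liesOver_of_isIntegral (S := B) m
  have hyM : algebraMap S B yS ∈ M := by
    have h1 : yS ∈ M.under S := hMm.over ▸ hym
    exact h1
  have hM0 : M ≠ ⊥ := by
    rintro rfl
    rw [Ideal.mem_bot] at hyM
    exact hyS0 (hinj (by rw [hyM, map_zero]))
  let v : HeightOneSpectrum B := ⟨M, hM.isPrime, hM0⟩
  -- Since `m` contains `y`, each polynomial in `y` is congruent to its constant coefficient, so the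
  -- finite field `F` surjects onto `S ⧸ m`.
  have hSfin : Finite (S ⧸ m) := by
    refine Finite.of_surjective (fun c : F => Ideal.Quotient.mk m (algebraMap F S c)) fun z => ?_
    obtain ⟨z, rfl⟩ := Ideal.Quotient.mk_surjective z
    obtain ⟨f, rfl⟩ := e.surjective z
    refine ⟨f.coeff 0, (Ideal.Quotient.mk_eq_mk_iff_sub_mem _ _).2 ?_⟩
    obtain ⟨g, hg⟩ : Polynomial.X ∣ Polynomial.C (f.coeff 0) - f := by
      rw [Polynomial.X_dvd_iff]; simp
    have h1 : algebraMap F S (f.coeff 0) - e f = yS * e g := by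
      have h2 : e Polynomial.X = yS := Subtype.ext (by simp [e, yS])
      rw [← h2, ← map_mul, ← hg, map_sub]
      congr 1
      exact (e.commutes _).symm
    rw [h1]
    exact Ideal.mul_mem_right _ _ hym
  have hfinM : Finite (B ⧸ v.asIdeal) := by
    exact finite_quotient_of_liesOver m M
  have := finite_residueField_valuation (K := L) v
  have := finite_residueField_comap (v.valuation L)
    (IsPurelyInseparable.iterateFrobenius L K (ringExpChar L) le_rfl)
  set w := (v.valuation L).comap
    (IsPurelyInseparable.iterateFrobenius L K (ringExpChar L) le_rfl) with hw
  have hwy : w y < 1 := by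
    have h1 : w y = v.valuation L (algebraMap B L (algebraMap S B yS)) ^
        ringExpChar L ^ IsPurelyInseparable.exponent L K := by
      rw [← map_pow]
      exact congrArg (v.valuation L)
        (IsPurelyInseparable.iterateFrobenius_algebraMap (K := L) (L := K) (ringExpChar L) le_rfl
          (algebraMap B L (algebraMap S B yS)))
    rw [h1]
    exact pow_lt_one₀ zero_le ((v.valuation_lt_one_iff_mem _).2 hyM)
      (expChar_pow_pos L _ _).ne'
  have hwx : 1 < w x := by
    have h1 : w y = (w x)⁻¹ := map_inv₀ w x
    rw [h1] at hwy
    exact (inv_lt_one₀ (zero_lt_iff.2 ((map_ne_zero w).2 hx0))).1 hwy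
  obtain ⟨Q, hQ⟩ := exists_place_valuationSubring_eq w this hwx
  refine ⟨Q, ?_⟩
  by_contra! h
  have h1 : x ∈ Q.val.valuationSubring := h
  rw [hQ] at h1
  exact absurd h1 hwx.not_ge

/-! ### Elements of `A` counted by pole order at infinity -/

namespace Place

variable {K : Type*} [Field K] (P : Place K)

lemma val_algebraMap_eq_one {F : Type*} [Field F] [Finite F] [Algebra F K] {c : F} (hc : c ≠ 0) :
    P.val (algebraMap F K c) = 1 := by
  have h1 : c ^ (Nat.card Fˣ) = 1 := by
    have := congrArg Units.val (pow_card_eq_one' (x := Units.mk0 c hc))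
    rwa [Units.val_pow_eq_pow_val] at this
  have h2 : P.val (algebraMap F K c) ^ Nat.card Fˣ = 1 := by
    rw [← map_pow, ← map_pow, h1, map_one, map_one]
  exact (pow_eq_one_iff_of_nonneg zero_le Nat.card_pos.ne').1 h2

end Place

namespace IsRegularOutside

variable {F A K : Type*} [Field F] [CommRing A] [Field K] [Algebra A K]
  [Algebra F K] {P : Place K}

section basic

variable (hA : IsRegularOutside F A P)
include hA

lemma val_le_one (a : A) {Q : Place K} (hQ : Q.val ≠ P.val) : Q.val (algebraMap A K a) ≤ 1 :=
  (hA.regular _).1 ⟨a, rfl⟩ Q hQ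

variable [Finite F]

/-- An element of `A` without a pole at the place at infinity is a constant. -/
lemma mem_constants {a : A} (ha : P.val (algebraMap A K a) ≤ 1) :
    algebraMap A K a ∈ Set.range (algebraMap F K) := by
  refine hA.constants _ ?_
  by_contra h
  obtain ⟨Q, hQ⟩ := exists_place_one_lt hA.fg hA.trdeg h
  by_cases hQP : Q.val = P.val
  · exact absurd ha (hQP ▸ hQ).not_ge
  · exact absurd (hA.val_le_one a hQP) hQ.not_ge

lemma one_le_val [FaithfulSMul A K] {a : A} (ha : a ≠ 0) : 1 ≤ P.val (algebraMap A K a) := by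
  by_contra! h
  obtain ⟨c, hc⟩ := hA.mem_constants h.le
  have hc0 : c ≠ 0 := by
    rintro rfl
    rw [map_zero] at hc
    exact ha ((FaithfulSMul.algebraMap_injective A K) (by rw [← hc, map_zero]))
  rw [← hc, P.val_algebraMap_eq_one hc0] at h
  exact lt_irrefl _ h

lemma exists_val_eq_exp [FaithfulSMul A K] {a : A} (ha : a ≠ 0) :
    ∃ m : ℕ, P.val (algebraMap A K a) = WithZero.exp (m : ℤ) := by
  have h := hA.one_le_val ha
  have h0 : P.val (algebraMap A K a) ≠ 0 := fun h0 => by simp [h0] at h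
  rw [← WithZero.exp_log h0, ← WithZero.exp_zero, WithZero.exp_le_exp] at h
  obtain ⟨m, hm⟩ := Int.eq_ofNat_of_zero_le h
  exact ⟨m, by rw [← WithZero.exp_log h0, hm]⟩

/-- The units of `A` are constants. -/
lemma unit_mem_constants (a : Aˣ) : algebraMap A K a ∈ Set.range (algebraMap F K) := by
  rcases le_total (P.val (algebraMap A K a)) 1 with h | h
  · exact hA.mem_constants h
  · have hu : algebraMap A K a * algebraMap A K (a⁻¹ : Aˣ) = 1 := by rw [← map_mul]; simp
    have h1 : P.val (algebraMap A K a) * P.val (algebraMap A K (a⁻¹ : Aˣ)) = 1 := by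
      rw [← map_mul, hu, map_one]
    have h2 : P.val (algebraMap A K (a⁻¹ : Aˣ)) ≤ 1 := by
      rw [← h1]
      exact le_mul_of_one_le_left' h
    obtain ⟨c, hc⟩ := hA.mem_constants h2
    refine ⟨c⁻¹, ?_⟩
    rw [map_inv₀, hc]
    exact (eq_inv_of_mul_eq_one_left hu).symm

end basic

variable (A P) in
/-- The elements of `A` with a pole of order at most `n` at the place at infinity. -/
def poleBound (n : ℕ) : AddSubgroup A where
  carrier := {a | P.val (algebraMap A K a) ≤ WithZero.exp (n : ℤ)}
  add_mem' ha hb := by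
    simp only [Set.mem_ofPred_eq, map_add] at *
    exact P.val.map_add_le ha hb
  zero_mem' := by simp
  neg_mem' ha := by simpa using ha

lemma mem_poleBound {n : ℕ} {a : A} :
    a ∈ poleBound A P n ↔ P.val (algebraMap A K a) ≤ WithZero.exp (n : ℤ) := Iff.rfl

lemma poleBound_mono : Monotone (poleBound A P) := fun m n h a ha =>
  le_trans (mem_poleBound.1 ha) (WithZero.exp_le_exp.2 (by exact_mod_cast h))

variable (A P) in
/-- Every principal part of order `n` at infinity is that of an element of `A`. -/
def IsFullAt (n : ℕ) : Prop :=
  ∀ x : K, P.val x ≤ WithZero.exp (n : ℤ) →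
    ∃ a : A, P.val (x - algebraMap A K a) < WithZero.exp (n : ℤ)

/-- The principal part of order `n + 1`, as an element of the residue field. -/
lemma exists_principalPart (n : ℕ) : ∃ ψ : poleBound A P (n + 1) →+
      IsLocalRing.ResidueField P.val.valuationSubring,
    (∀ a, ψ a = 0 ↔ (a : A) ∈ poleBound A P n) ∧
    (IsFullAt A P (n + 1) → Function.Surjective ψ) := by
  -- Multiplication by `t`, which vanishes to order `n + 1` at infinity, turns the leading
  -- coefficient of a pole of order `n + 1` into a residue class.
  obtain ⟨t, ht⟩ := P.surj (WithZero.exp (-((n + 1 : ℕ) : ℤ)))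
  have ht0 : t ≠ 0 := by
    rintro rfl
    rw [map_zero] at ht
    exact WithZero.exp_ne_zero ht.symm
  have hmem : ∀ x : K, P.val (t * x) ≤ 1 ↔ P.val x ≤ WithZero.exp ((n + 1 : ℕ) : ℤ) := by
    intro x
    rw [map_mul, ht, WithZero.exp_neg, inv_mul_le_iff₀ (by simp), mul_one]
  have hlt : ∀ x : K, P.val (t * x) < 1 ↔ P.val x < WithZero.exp ((n + 1 : ℕ) : ℤ) := by
    intro x
    rw [map_mul, ht, WithZero.exp_neg, inv_mul_lt_iff₀ (by simp), mul_one]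
  let ψ₀ : poleBound A P (n + 1) →+ P.val.valuationSubring :=
    { toFun := fun a => ⟨t * algebraMap A K a, (hmem _).2 a.2⟩
      map_zero' := Subtype.ext (by simp)
      map_add' := fun a b => Subtype.ext (by simp [mul_add]) }
  have hres : ∀ z : P.val.valuationSubring, IsLocalRing.residue _ z = 0 ↔ P.val z < 1 := by
    intro z
    rw [IsLocalRing.residue_eq_zero_iff, IsLocalRing.mem_maximalIdeal, mem_nonunits_iff,
      isUnit_valuationSubring_iff]
    exact ⟨fun h => lt_of_le_of_ne z.2 h, ne_of_lt⟩
  refine ⟨(IsLocalRing.residue _).toAddMonoidHom.comp ψ₀, fun a => ?_, fun hfull z => ?_⟩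
  · refine (hres (ψ₀ a)).trans ((hlt _).trans ?_)
    rw [mem_poleBound]
    by_cases h0 : P.val (algebraMap A K a) = 0
    · simp [h0]
    · rw [← WithZero.exp_log h0, WithZero.exp_lt_exp, WithZero.exp_le_exp]
      push_cast
      omega
  · obtain ⟨z, rfl⟩ := IsLocalRing.residue_surjective z
    obtain ⟨a, ha⟩ := hfull (t⁻¹ * z) ((hmem _).1 (by rw [mul_inv_cancel_left₀ ht0]; exact z.2))
    have ha' : a ∈ poleBound A P (n + 1) := by
      rw [mem_poleBound]
      have h1 : algebraMap A K a = t⁻¹ * z - (t⁻¹ * z - algebraMap A K a) := by ring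
      rw [h1]
      exact P.val.map_sub_le ((hmem _).1 (by rw [mul_inv_cancel_left₀ ht0]; exact z.2)) ha.le
    refine ⟨⟨a, ha'⟩, ?_⟩
    refine eq_of_sub_eq_zero ((map_sub (IsLocalRing.residue _) _ _).symm.trans ?_)
    rw [hres]
    have h2 : t * algebraMap A K a - z = -(t * (t⁻¹ * z - algebraMap A K a)) := by
      rw [mul_sub, mul_inv_cancel_left₀ ht0]; ring
    change P.val (t * algebraMap A K a - z) < 1
    rw [h2, Valuation.map_neg]
    exact (hlt _).2 ha

/-- The principal part map on `poleBound A P (n + 1)` has kernel `poleBound A P n` and values in the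
residue field, and it is onto when every principal part of order `n + 1` is realized. -/
lemma card_poleBound_succ (n : ℕ) [Finite (poleBound A P n)] :
    Finite (poleBound A P (n + 1)) ∧
      Nat.card (poleBound A P (n + 1)) ≤ Nat.card (poleBound A P n) * P.resCard ∧
      (IsFullAt A P (n + 1) →
        Nat.card (poleBound A P (n + 1)) = Nat.card (poleBound A P n) * P.resCard) := by
  have := P.finite_residue
  obtain ⟨ψ, hψ, hs⟩ := exists_principalPart (A := A) (P := P) n
  let e : ψ.ker ≃ poleBound A P n :=
    { toFun := fun a => ⟨a, (hψ _).1 a.2⟩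
      invFun := fun a => ⟨⟨a, poleBound_mono n.le_succ a.2⟩, (hψ _).2 a.2⟩
      left_inv := fun _ => rfl
      right_inv := fun _ => rfl }
  have hker : Finite ψ.ker := Finite.of_equiv _ e.symm
  have hfin : Finite (poleBound A P (n + 1)) := by
    have : Finite (poleBound A P (n + 1) ⧸ ψ.ker) :=
      Finite.of_equiv _ (QuotientAddGroup.quotientKerEquivRange ψ).toEquiv.symm
    exact Finite.of_equiv _ (AddSubgroup.addGroupEquivQuotientProdAddSubgroup (s := ψ.ker)).symm
  have hcard : Nat.card (poleBound A P (n + 1)) =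
      Nat.card (poleBound A P n) * Nat.card ψ.range := by
    rw [← AddSubgroup.index_ker, ← Nat.card_congr e, AddSubgroup.card_mul_index]
  refine ⟨hfin, ?_, fun h => ?_⟩
  · rw [hcard]
    exact Nat.mul_le_mul_left _ (Nat.card_le_card_of_injective _ Subtype.val_injective)
  · rw [hcard, AddMonoidHom.range_eq_top.2 (hs h)]
    congr 1
    exact Nat.card_congr (Equiv.Set.univ _)

end IsRegularOutside

namespace IsRegularOutside

variable {F A K : Type*} [Field F] [CommRing A] [Field K] [Algebra A K] [Algebra F K]
  {P : Place K}

/-- Multiplication by `b` raises pole orders by `k` and is invertible on principal parts. -/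
lemma IsFullAt.add_val {n k : ℕ} (h : IsFullAt A P n) {b : A}
    (hb : P.val (algebraMap A K b) = WithZero.exp (k : ℤ)) : IsFullAt A P (n + k) := by
  have hb0 : algebraMap A K b ≠ 0 := by
    intro h0
    rw [h0, map_zero] at hb
    exact WithZero.exp_ne_zero hb.symm
  intro x hx
  obtain ⟨a, ha⟩ := h (x / algebraMap A K b) (by
    rw [map_div₀, hb, div_le_iff₀ (by simp), ← WithZero.exp_add]
    exact_mod_cast hx)
  refine ⟨a * b, ?_⟩
  have h1 : x - algebraMap A K (a * b) =
      (x / algebraMap A K b - algebraMap A K a) * algebraMap A K b := by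
    rw [sub_mul, div_mul_cancel₀ _ hb0, map_mul]
  rw [h1, map_mul, hb, Nat.cast_add, WithZero.exp_add]
  exact mul_lt_mul_of_pos_right ha (by simp)

variable [IsDomain A] [IsFractionRing A K] [Finite F] (hA : IsRegularOutside F A P)
include hA

/-- Lift the finitely many residue classes to `K` and let `c` be a common denominator. The products
of `c` with the lifts lie in `A` and realize every principal part whose order is the pole order of
`c`. -/
lemma exists_isFullAt : ∃ n, IsFullAt A P n := by
  classical
  have := P.finite_residue
  have := Fintype.ofFinite (IsLocalRing.ResidueField P.val.valuationSubring)
  choose l hl using IsLocalRing.residue_surjective (R := P.val.valuationSubring)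
  obtain ⟨c, hc⟩ := IsLocalization.exist_integer_multiples_of_finset A⁰
    (Finset.univ.image fun z => (l z : K))
  have hc0 : (c : A) ≠ 0 := nonZeroDivisors.coe_ne_zero c
  obtain ⟨n, hn⟩ := hA.exists_val_eq_exp hc0
  have hcK : algebraMap A K c ≠ 0 := by simp
  refine ⟨n, fun x hx => ?_⟩
  let y : P.val.valuationSubring := ⟨x / algebraMap A K c, by
    rw [Valuation.mem_valuationSubring_iff, map_div₀, hn, div_le_iff₀ (by simp), one_mul]
    exact hx⟩
  obtain ⟨a, ha⟩ := hc (l (IsLocalRing.residue _ y)) (by simp)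
  refine ⟨a, ?_⟩
  have h1 : x - algebraMap A K a =
      algebraMap A K c * ((y : K) - l (IsLocalRing.residue _ y)) := by
    rw [ha, mul_sub, Algebra.smul_def, mul_div_cancel₀ _ hcK]
  have h2 : P.val ((y : K) - l (IsLocalRing.residue _ y)) < 1 := by
    have h3 : IsLocalRing.residue _ (y - l (IsLocalRing.residue _ y)) = 0 := by
      rw [map_sub, hl, sub_self]
    rw [IsLocalRing.residue_eq_zero_iff, IsLocalRing.mem_maximalIdeal, mem_nonunits_iff,
      isUnit_valuationSubring_iff] at h3
    exact lt_of_le_of_ne (y - l (IsLocalRing.residue _ y)).2 h3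
  rw [h1, map_mul, hn]
  exact mul_lt_of_lt_one_right (by simp) h2

lemma exists_forall_val_eq_exp : ∃ n₀ : ℕ, ∀ n, n₀ ≤ n →
    ∃ a : A, P.val (algebraMap A K a) = WithZero.exp (n : ℤ) := by
  obtain ⟨z, hz⟩ := P.surj (WithZero.exp 1)
  obtain ⟨a, b, hb, rfl⟩ := IsFractionRing.div_surjective (A := A) z
  have hb0 : b ≠ 0 := nonZeroDivisors.ne_zero hb
  obtain ⟨k, hk⟩ := hA.exists_val_eq_exp hb0
  have ha : P.val (algebraMap A K a) = WithZero.exp ((k + 1 : ℕ) : ℤ) := by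
    rw [map_div₀, hk, div_eq_iff (by simp), ← WithZero.exp_add] at hz
    rw [hz, add_comm]
    norm_cast
  -- The pole orders `k` and `k + 1` both occur. For `n = k s + t` with `t ≤ s` one has `n = (s - t)
  -- k + t (k + 1)`, and division by `k` gives such `s`, `t` as soon as `n ≥ k²`.
  refine ⟨k * k, fun n hn => ?_⟩
  obtain ⟨s, t, hst, hts⟩ : ∃ s t : ℕ, n = k * s + t ∧ t ≤ s := by
    rcases Nat.eq_zero_or_pos k with rfl | hk0
    · exact ⟨n, n, by simp, le_rfl⟩
    · exact ⟨n / k, n % k, (Nat.div_add_mod n k).symm,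
        (Nat.mod_lt _ hk0).le.trans ((Nat.le_div_iff_mul_le hk0).2 hn)⟩
  refine ⟨b ^ (s - t) * a ^ t, ?_⟩
  rw [map_mul, map_mul, map_pow, map_pow, map_pow, map_pow, ha, hk, ← WithZero.exp_nsmul,
    ← WithZero.exp_nsmul, ← WithZero.exp_add, hst]
  congr 1
  obtain ⟨d, rfl⟩ := Nat.exists_eq_add_of_le hts
  simp only [Nat.add_sub_cancel_left, nsmul_eq_mul]
  push_cast
  ring

lemma exists_forall_isFullAt : ∃ n₀ : ℕ, ∀ n, n₀ ≤ n → IsFullAt A P n := by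
  obtain ⟨n₁, h₁⟩ := hA.exists_isFullAt
  obtain ⟨n₂, h₂⟩ := hA.exists_forall_val_eq_exp
  refine ⟨n₁ + n₂, fun n hn => ?_⟩
  obtain ⟨b, hb⟩ := h₂ (n - n₁) (by omega)
  have := h₁.add_val hb
  rwa [Nat.add_sub_cancel' (by omega)] at this

omit [IsDomain A] in
lemma finite_poleBound (n : ℕ) : Finite (poleBound A P n) := by
  induction n with
  | zero =>
    have h : ∀ a : poleBound A P 0, ∃ c : F, algebraMap F K c = algebraMap A K a := fun a =>
      hA.mem_constants (a := a) (by
        have h := mem_poleBound.1 a.2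
        rwa [Nat.cast_zero, WithZero.exp_zero] at h)
    choose c hc using h
    refine Finite.of_injective c fun a b hab => Subtype.ext ?_
    exact FaithfulSMul.algebraMap_injective A K (by rw [← hc, ← hc, hab])
  | succ n ih => exact (card_poleBound_succ n).1

/-- The part of Riemann–Roch that is needed: from some order on, each further pole order multiplies
the count by exactly `resCard`. -/
lemma exists_card_poleBound : ∃ n₀ : ℕ, ∀ n k, n₀ ≤ n →
    Nat.card (poleBound A P (n + k)) = Nat.card (poleBound A P n) * P.resCard ^ k := by
  obtain ⟨n₀, h⟩ := hA.exists_forall_isFullAt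
  refine ⟨n₀, fun n k hn => ?_⟩
  induction k with
  | zero => simp
  | succ k ih =>
    have := hA.finite_poleBound (n + k)
    rw [← add_assoc, (card_poleBound_succ (n + k)).2.2 (h _ (by omega)), ih, pow_succ, mul_assoc]

/-- The norm of a principal ideal is the absolute value at infinity of a generator. -/
lemma card_quotient_span {a : A} (ha : a ≠ 0) {m : ℕ}
    (hm : P.val (algebraMap A K a) = WithZero.exp (m : ℤ)) :
    Nat.card (A ⧸ Ideal.span {a}) = P.resCard ^ m := by
  obtain ⟨n₀, h₀⟩ := hA.exists_card_poleBound
  let π : A →+ A ⧸ Ideal.span {a} := (Ideal.Quotient.mk (Ideal.span {a})).toAddMonoidHom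
  let f : ∀ n, poleBound A P n →+ A ⧸ Ideal.span {a} := fun n => π.comp (poleBound A P n).subtype
  -- Multiplication by `a` identifies `poleBound A P n` with the multiples of `a` in `poleBound A P
  -- (n + m)`. Comparing the two counts gives an image of size `resCard ^ m` in `A ⧸ (a)` for all
  -- large `n`.
  have hker : ∀ n, Nat.card (f (n + m)).ker = Nat.card (poleBound A P n) := by
    intro n
    have hmul : ∀ b : A, a * b ∈ poleBound A P (n + m) ↔ b ∈ poleBound A P n := by
      intro b
      rw [mem_poleBound, mem_poleBound, map_mul, map_mul, hm, Nat.cast_add, add_comm (n : ℤ),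
        WithZero.exp_add, mul_le_mul_iff_right₀ (by simp)]
    refine (Nat.card_congr (Equiv.ofBijective (fun b : poleBound A P n =>
      (⟨⟨a * b, (hmul b).2 b.2⟩, ?_⟩ : (f (n + m)).ker)) ⟨fun b c h => ?_, fun z => ?_⟩)).symm
    · exact (Ideal.Quotient.eq_zero_iff_mem).2
        (Ideal.mul_mem_right _ _ (Ideal.mem_span_singleton_self a))
    · have h1 := congrArg (fun z : (f (n + m)).ker => (z : A)) h
      exact Subtype.ext (mul_left_cancel₀ ha h1)
    · have hz : ((z : poleBound A P (n + m)) : A) ∈ Ideal.span {a} :=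
        Ideal.Quotient.eq_zero_iff_mem.1 z.2
      obtain ⟨b, hb⟩ := Ideal.mem_span_singleton'.1 hz
      rw [mul_comm] at hb
      refine ⟨⟨b, (hmul b).1 (hb ▸ z.1.2)⟩, Subtype.ext (Subtype.ext hb)⟩
  have hrange : ∀ n, n₀ ≤ n → Nat.card (f (n + m)).range = P.resCard ^ m := by
    intro n hn
    have := hA.finite_poleBound n
    have h1 := (f (n + m)).ker.card_mul_index
    rw [AddSubgroup.index_ker, hker, h₀ n m hn] at h1
    exact Nat.eq_of_mul_eq_mul_left Nat.card_pos h1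
  have hmono : ∀ {i j}, i ≤ j → (f i).range ≤ (f j).range := by
    rintro i j hij - ⟨b, rfl⟩
    exact ⟨⟨b, poleBound_mono hij b.2⟩, rfl⟩
  -- The images increase with `n` and have the same finite size, so they are constant; together they
  -- exhaust `A ⧸ (a)`.
  have hconst : ∀ n, n₀ ≤ n → (f (n + m)).range = (f (n₀ + m)).range := by
    intro n hn
    have := hA.finite_poleBound (n + m)
    have hfin : Finite (f (n + m)).range :=
      Finite.of_surjective _ (f (n + m)).rangeRestrict_surjective
    refine (SetLike.coe_injective (Set.eq_of_subset_of_ncard_le (hmono (by omega)) ?_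
      (Set.toFinite _))).symm
    rw [← Nat.card_coe_set_eq, ← Nat.card_coe_set_eq]
    exact ((hrange n hn).trans (hrange n₀ le_rfl).symm).le
  have htop : (f (n₀ + m)).range = ⊤ := by
    rw [eq_top_iff]
    rintro z -
    obtain ⟨b, rfl⟩ := Ideal.Quotient.mk_surjective z
    by_cases hb : b = 0
    · rw [hb, map_zero]; exact zero_mem _
    obtain ⟨k, hk⟩ := hA.exists_val_eq_exp hb
    rw [← hconst (n₀ + k) (by omega)]
    exact ⟨⟨b, poleBound_mono (show k ≤ n₀ + k + m by omega) hk.le⟩, rfl⟩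
  rw [← hrange n₀ le_rfl, htop]
  exact (Nat.card_congr (Equiv.Set.univ _)).symm

lemma finite_quotient {I : Ideal A} (hI : I ≠ ⊥) : Finite (A ⧸ I) := by
  obtain ⟨a, haI, ha⟩ := Submodule.exists_mem_ne_zero_of_ne_bot hI
  obtain ⟨m, hm⟩ := hA.exists_val_eq_exp ha
  have h := hA.card_quotient_span ha hm
  have : Finite (A ⧸ Ideal.span {a}) := by
    refine Nat.finite_of_card_ne_zero ?_
    rw [h]
    exact pow_ne_zero _ (by have := P.one_lt_resCard; omega)
  exact Finite.of_surjective _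
    (Ideal.Quotient.factor_surjective ((Ideal.span_singleton_le_iff_mem I).2 haI))

end IsRegularOutside

/-! ### Norms and degrees of ideals, and the product formula -/

section CardQuotient

variable {A : Type*} [CommRing A] [IsDedekindDomain A]

/-- In a Dedekind domain `I = IJ + (a)` for some `a`. Multiplication by `a` then induces an
isomorphism from `A ⧸ J` to `I / IJ`. -/
lemma card_quotient_mul {I J : Ideal A} (hI : I ≠ ⊥) (hJ : J ≠ ⊥) :
    Nat.card (A ⧸ (I * J)) = Nat.card (A ⧸ I) * Nat.card (A ⧸ J) := by
  obtain ⟨a, ha⟩ := IsDedekindDomain.exists_sup_span_eq (I := I * J) (J := I) Ideal.mul_le_left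
    (mul_ne_zero hI hJ)
  have haI : a ∈ I := by
    rw [← ha]
    exact Ideal.mem_sup_right (Ideal.mem_span_singleton_self a)
  let f : A →ₗ[A] A ⧸ (I * J) := (I * J).mkQ.comp (LinearMap.mulLeft A a)
  have hf : ∀ x, x ∈ LinearMap.ker f ↔ a * x ∈ I * J := fun x => by
    rw [LinearMap.mem_ker]
    exact Submodule.Quotient.mk_eq_zero _
  have hker : LinearMap.ker f = J := by
    refine le_antisymm (fun x hx => ?_) fun x hx => (hf x).2 (Ideal.mul_mem_mul haI hx)
    have h1 : I * Ideal.span {x} ≤ I * J := by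
      conv_lhs => rw [← ha]
      rw [Ideal.sup_mul, Ideal.span_singleton_mul_span_singleton]
      exact sup_le Ideal.mul_le_left ((Ideal.span_singleton_le_iff_mem _).2 ((hf x).1 hx))
    have h2 : Ideal.span {x} ≤ J := by
      rw [← Ideal.dvd_iff_le] at h1 ⊢
      exact (mul_dvd_mul_iff_left hI).1 h1
    exact (Ideal.span_singleton_le_iff_mem _).1 h2
  have hrange : LinearMap.range f = Submodule.map (I * J).mkQ I := by
    apply le_antisymm
    · rintro - ⟨x, rfl⟩
      exact ⟨a * x, Ideal.mul_mem_right _ _ haI, rfl⟩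
    · rintro - ⟨y, hy, rfl⟩
      rw [← ha] at hy
      obtain ⟨z, hz, w, hw, rfl⟩ := Submodule.mem_sup.1 hy
      obtain ⟨x, rfl⟩ := Ideal.mem_span_singleton'.1 hw
      refine ⟨x, (Submodule.Quotient.eq _).2 ?_⟩
      have h3 : a * x - (z + x * a) = -z := by ring
      change a * x - (z + x * a) ∈ I * J
      rw [h3]
      exact neg_mem hz
  rw [Submodule.card_eq_card_quotient_mul_card (LinearMap.range f),
    ← Nat.card_congr f.quotKerEquivRange.toEquiv, hker, hrange,
    Nat.card_congr (Submodule.quotientQuotientEquivQuotient (I * J) I Ideal.mul_le_left).toEquiv,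
    mul_comm]

end CardQuotient

section DegIdeal

variable (F : Type*) [Field F] {A K : Type*} [CommRing A] [IsDedekindDomain A] [Field K]
  [Algebra A K] [IsFractionRing A K] [Algebra F A]

lemma degIdeal_mul (I J : (FractionalIdeal A⁰ K)ˣ) :
    degIdeal F (I * J) = degIdeal F I + degIdeal F J := by
  have hfin : ∀ I : (FractionalIdeal A⁰ K)ˣ, (Function.support fun v : HeightOneSpectrum A =>
      FractionalIdeal.count K v (I : FractionalIdeal A⁰ K) *
        (Module.finrank F (A ⧸ v.asIdeal) : ℤ)).Finite := fun I =>
    Set.Finite.subset (FractionalIdeal.finite_factors (I : FractionalIdeal A⁰ K))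
      fun v hv => left_ne_zero_of_mul hv
  rw [degIdeal, degIdeal, degIdeal, ← finsum_add_distrib (hfin I) (hfin J)]
  refine finsum_congr fun v => ?_
  rw [Units.val_mul, FractionalIdeal.count_mul K v I.ne_zero J.ne_zero, add_mul]

lemma degIdeal_one : degIdeal F (1 : (FractionalIdeal A⁰ K)ˣ) = 0 := by
  have := degIdeal_mul F (1 : (FractionalIdeal A⁰ K)ˣ) 1
  rw [mul_one] at this
  omega

lemma degIdeal_asIdeal (v : HeightOneSpectrum A) {I : (FractionalIdeal A⁰ K)ˣ}
    (hI : (I : FractionalIdeal A⁰ K) = v.asIdeal) :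
    degIdeal F I = Module.finrank F (A ⧸ v.asIdeal) := by
  classical
  rw [degIdeal, finsum_eq_single _ v fun w hw => ?_, hI, FractionalIdeal.count_self, one_mul]
  rw [hI, FractionalIdeal.count_maximal_coprime K w hw.symm, zero_mul]

/-- The degree of an integral ideal is the dimension of its residue ring. -/
lemma card_pow_degIdeal [Finite F] (hfin : ∀ v : HeightOneSpectrum A, Finite (A ⧸ v.asIdeal))
    {I : Ideal A} (hI : I ≠ ⊥) {U : (FractionalIdeal A⁰ K)ˣ}
    (hU : (U : FractionalIdeal A⁰ K) = I) :
    (Nat.card F : ℝ) ^ degIdeal F U = Nat.card (A ⧸ I) := by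
  have hq : (Nat.card F : ℝ) ≠ 0 := Nat.cast_ne_zero.2 Nat.card_pos.ne'
  induction I using UniqueFactorizationMonoid.induction_on_prime generalizing U with
  | h₁ => exact (hI rfl).elim
  | h₂ I hu =>
    rw [Ideal.isUnit_iff] at hu
    subst hu
    have h1 : U = 1 := Units.ext (by rw [hU]; simp)
    have : Subsingleton (A ⧸ (⊤ : Ideal A)) := Ideal.Quotient.subsingleton_iff.2 rfl
    rw [h1, degIdeal_one, zpow_zero, Nat.card_of_subsingleton (0 : A ⧸ (⊤ : Ideal A)), Nat.cast_one]
  | h₃ I p hI0 hp ih =>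
    let v : HeightOneSpectrum A := ⟨p, Ideal.isPrime_of_prime hp, hp.ne_zero⟩
    have hUI : (I : FractionalIdeal A⁰ K) ≠ 0 := FractionalIdeal.coeIdeal_ne_zero.2 hI0
    have hUp : (p : FractionalIdeal A⁰ K) ≠ 0 := FractionalIdeal.coeIdeal_ne_zero.2 hp.ne_zero
    have h1 : U = Units.mk0 _ hUp * Units.mk0 _ hUI := Units.ext (by
      rw [hU, Units.val_mul, Units.val_mk0, Units.val_mk0, FractionalIdeal.coeIdeal_mul])
    have hfv : Finite (A ⧸ v.asIdeal) := hfin v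
    rw [h1, degIdeal_mul, zpow_add₀ hq, ih hI0 (U := Units.mk0 _ hUI) rfl,
      card_quotient_mul hp.ne_zero hI0,
      degIdeal_asIdeal F v rfl, zpow_natCast, Nat.cast_mul]
    congr 1
    have h2 := Module.natCard_eq_pow_finrank (K := F) (V := A ⧸ v.asIdeal)
    exact_mod_cast h2.symm

end DegIdeal

namespace Place

variable {K : Type*} [Field K] (P : Place K)

lemma absVal_eq_zpow {x : K} {n : ℤ} (h : P.val x = WithZero.exp n) :
    P.absVal x = (P.resCard : ℝ) ^ n := by
  change ((WithZeroMulInt.toNNReal P.resCard_ne_zero (P.val x) : ℝ≥0) : ℝ) = _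
  rw [h, WithZeroMulInt.toNNReal_neg_apply _ WithZero.exp_ne_zero]
  simp [WithZero.exp]

end Place

namespace IsRegularOutside

variable {F A K : Type*} [Field F] [CommRing A] [IsDedekindDomain A] [Field K] [Algebra A K]
  [IsFractionRing A K] [Algebra F A] [Algebra F K] [Finite F] {P : Place K}
  (hA : IsRegularOutside F A P)
include hA

/-- The product formula. -/
theorem absVal_eq_pow_degIdeal (b : Kˣ) :
    P.absVal b = (Nat.card F : ℝ) ^ degIdeal F (toPrincipalIdeal A K b) := by
  have hq : (Nat.card F : ℝ) ≠ 0 := Nat.cast_ne_zero.2 Nat.card_pos.ne'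
  -- For an element `a` of `A` both sides are the cardinality of `A ⧸ (a)`; fractions follow by
  -- multiplicativity.
  have key : ∀ (a : A) (b : Kˣ), (b : K) = algebraMap A K a →
      P.absVal b = (Nat.card F : ℝ) ^ degIdeal F (toPrincipalIdeal A K b) := by
    intro a b hb
    have ha : a ≠ 0 := by
      rintro rfl
      exact b.ne_zero (by rw [hb, map_zero])
    obtain ⟨m, hm⟩ := hA.exists_val_eq_exp ha
    rw [card_pow_degIdeal F (fun v => hA.finite_quotient v.ne_bot)
      (I := Ideal.span {a}) (by simpa using ha)
      (by rw [coe_toPrincipalIdeal, hb, FractionalIdeal.coeIdeal_span_singleton]),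
      hA.card_quotient_span ha hm, hb, P.absVal_eq_zpow hm]
    simp
  obtain ⟨a, c, hc, hac⟩ := IsFractionRing.div_surjective (A := A) (b : K)
  have hc0 : algebraMap A K c ≠ 0 := by simpa using nonZeroDivisors.ne_zero hc
  have h1 := key c (Units.mk0 _ hc0) rfl
  have h2 := key a (b * Units.mk0 _ hc0) (by
    rw [Units.val_mul, Units.val_mk0, ← hac, div_mul_cancel₀ _ hc0])
  rw [map_mul, degIdeal_mul, zpow_add₀ hq, Units.val_mul, map_mul, h1] at h2
  exact mul_right_cancel₀ (zpow_ne_zero _ hq) h2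

end IsRegularOutside

/-! ### Finiteness of the ideal class group -/

namespace IsRegularOutside

variable {F A K : Type*} [Field F] [CommRing A] [IsDedekindDomain A] [Field K] [Algebra A K]
  [IsFractionRing A K] [Algebra F K] [Finite F] {P : Place K} (hA : IsRegularOutside F A P)
include hA

/-- Pigeonhole principle. -/
lemma exists_mem_poleBound {I : Ideal A} (hI : I ≠ ⊥) {n : ℕ}
    (h : Nat.card (A ⧸ I) < Nat.card (poleBound A P n)) :
    ∃ a ∈ I, a ≠ 0 ∧ a ∈ poleBound A P n := by
  have := hA.finite_quotient hI
  have := hA.finite_poleBound n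
  have hinj : ¬ Function.Injective fun a : poleBound A P n => Ideal.Quotient.mk I (a : A) :=
    fun hinj => h.not_ge (Nat.card_le_card_of_injective _ hinj)
  simp only [Function.Injective, not_forall] at hinj
  obtain ⟨a, b, hab, hne⟩ := hinj
  refine ⟨a - b, (Ideal.Quotient.mk_eq_mk_iff_sub_mem _ _).1 hab, fun h => hne ?_,
    sub_mem a.2 b.2⟩
  exact Subtype.ext (sub_eq_zero.1 h)

lemma exists_lt_card_poleBound (B : ℕ) : ∃ n, B < Nat.card (poleBound A P n) := by
  obtain ⟨n₀, h⟩ := hA.exists_card_poleBound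
  have := hA.finite_poleBound n₀
  refine ⟨n₀ + B, ?_⟩
  rw [h n₀ B le_rfl]
  exact (Nat.lt_pow_self P.one_lt_resCard).trans_le (Nat.le_mul_of_pos_left _ Nat.card_pos)

/-- By the pigeonhole principle every such ideal contains a nonzero element of one fixed finite set
`poleBound A P n`. A nonzero `a` lies in finitely many ideals only, since `A ⧸ (a)` is finite. -/
lemma finite_setOf_card_le (B : ℕ) : {J : Ideal A | J ≠ ⊥ ∧ Nat.card (A ⧸ J) ≤ B}.Finite := by
  obtain ⟨n, hn⟩ := hA.exists_lt_card_poleBound B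
  have := hA.finite_poleBound n
  have hfin : (⋃ a ∈ {a : A | a ≠ 0 ∧ a ∈ poleBound A P n},
      {J : Ideal A | Ideal.span {a} ≤ J}).Finite := by
    refine Set.Finite.biUnion (Set.Finite.subset (Set.toFinite (poleBound A P n : Set A))
      fun a ha => ha.2) fun a ha => ?_
    have h0 : Ideal.span {a} ≠ ⊥ := by simpa using ha.1
    have := hA.finite_quotient h0
    have h1 : Finite (Ideal (A ⧸ Ideal.span {a})) :=
      Finite.of_injective (fun I : Ideal (A ⧸ Ideal.span {a}) => (I : Set (A ⧸ Ideal.span {a})))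
        SetLike.coe_injective
    refine Set.Finite.of_injOn (f := Ideal.map (Ideal.Quotient.mk (Ideal.span {a})))
      (t := Set.univ) (fun _ _ => Set.mem_univ _) (fun I hI J hJ hIJ => ?_) Set.finite_univ
    have h2 := congrArg (Ideal.comap (Ideal.Quotient.mk (Ideal.span {a}))) hIJ
    rwa [Ideal.comap_map_of_surjective' _ Ideal.Quotient.mk_surjective,
      Ideal.comap_map_of_surjective' _ Ideal.Quotient.mk_surjective, Ideal.mk_ker,
      sup_eq_left.2 hI, sup_eq_left.2 hJ] at h2
  refine hfin.subset fun J hJ => ?_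
  obtain ⟨a, haJ, ha0, ha⟩ := hA.exists_mem_poleBound hJ.1 (hJ.2.trans_lt hn)
  exact Set.mem_biUnion (show a ∈ {a : A | a ≠ 0 ∧ a ∈ poleBound A P n} from ⟨ha0, ha⟩)
    ((Ideal.span_singleton_le_iff_mem _).2 haJ)

/-- Every ideal has a multiple in the class of the principal ideals by an ideal of bounded norm. -/
lemma exists_mul_eq_span : ∃ B : ℕ, ∀ I : Ideal A, I ≠ ⊥ →
    ∃ (a : A) (J : Ideal A), a ≠ 0 ∧ I * J = Ideal.span {a} ∧ Nat.card (A ⧸ J) ≤ B := by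
  classical
  obtain ⟨n₀, h₀⟩ := hA.exists_card_poleBound
  have hfin := hA.finite_poleBound
  have hr := P.one_lt_resCard
  have hgrow : ∀ n, P.resCard ^ n ≤ P.resCard ^ n₀ * Nat.card (poleBound A P n) := by
    intro n
    rcases le_total n n₀ with h | h
    · exact (Nat.pow_le_pow_right (by omega) h).trans (Nat.le_mul_of_pos_right _ Nat.card_pos)
    · obtain ⟨k, rfl⟩ := Nat.exists_eq_add_of_le h
      rw [h₀ n₀ k le_rfl, pow_add]
      exact Nat.mul_le_mul_left _ (Nat.le_mul_of_pos_left _ Nat.card_pos)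
  let C := max (Nat.card (poleBound A P 0)) P.resCard
  refine ⟨P.resCard ^ n₀ * C, fun I hI => ?_⟩
  have := hA.finite_quotient hI
  have hN : 0 < Nat.card (A ⧸ I) := Nat.card_pos
  have hex := hA.exists_lt_card_poleBound (Nat.card (A ⧸ I))
  -- Minimality of `n` bounds the size of `poleBound A P n` by `C` times the norm of `I`. The norm
  -- of an element of `I` with pole order at most `n` then exceeds that of `I` by a bounded factor,
  -- and this factor is the norm of the cofactor `J`.
  let n := Nat.find hex
  have hn : Nat.card (A ⧸ I) < Nat.card (poleBound A P n) := Nat.find_spec hex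
  have hle : Nat.card (poleBound A P n) ≤ C * Nat.card (A ⧸ I) := by
    rcases Nat.eq_zero_or_pos n with h | h
    · rw [h]
      exact (le_max_left _ _).trans (Nat.le_mul_of_pos_right _ hN)
    · obtain ⟨k, hk⟩ := Nat.exists_eq_succ_of_ne_zero h.ne'
      have h1 : Nat.card (poleBound A P k) ≤ Nat.card (A ⧸ I) :=
        not_lt.1 (Nat.find_min hex (show k < n by omega))
      rw [hk]
      refine ((card_poleBound_succ k).2.1).trans ?_
      rw [mul_comm]
      exact Nat.mul_le_mul (le_max_right _ _) h1
  obtain ⟨a, haI, ha0, ha⟩ := hA.exists_mem_poleBound hI hn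
  obtain ⟨J, hJ⟩ := Ideal.dvd_iff_le.2 ((Ideal.span_singleton_le_iff_mem I).2 haI)
  have hJ0 : J ≠ ⊥ := by
    rintro rfl
    rw [Ideal.mul_bot, Ideal.span_singleton_eq_bot] at hJ
    exact ha0 hJ
  refine ⟨a, J, ha0, hJ.symm, ?_⟩
  obtain ⟨m, hm⟩ := hA.exists_val_eq_exp ha0
  have hmn : m ≤ n := by
    rw [mem_poleBound, hm, WithZero.exp_le_exp] at ha
    exact_mod_cast ha
  have h2 : Nat.card (A ⧸ I) * Nat.card (A ⧸ J) = P.resCard ^ m := by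
    rw [← card_quotient_mul hI hJ0, ← hJ, hA.card_quotient_span ha0 hm]
  refine Nat.le_of_mul_le_mul_left ?_ hN
  rw [h2]
  calc P.resCard ^ m ≤ P.resCard ^ n := Nat.pow_le_pow_right (by omega) hmn
    _ ≤ P.resCard ^ n₀ * Nat.card (poleBound A P n) := hgrow n
    _ ≤ P.resCard ^ n₀ * (C * Nat.card (A ⧸ I)) := Nat.mul_le_mul_left _ hle
    _ = _ := by ring

/-- The ideal class group of `A` is finite. -/
theorem exists_finite_representatives : ∃ T : Set (FractionalIdeal A⁰ K)ˣ, T.Finite ∧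
    ∀ I, ∃ r : Kˣ, toPrincipalIdeal A K r * I ∈ T := by
  classical
  obtain ⟨B, hB⟩ := hA.exists_mul_eq_span
  let S := {J : Ideal A | J ≠ ⊥ ∧ Nat.card (A ⧸ J) ≤ B}
  have hS : S.Finite := hA.finite_setOf_card_le B
  let g : Ideal A → (FractionalIdeal A⁰ K)ˣ := fun J =>
    if h : (J : FractionalIdeal A⁰ K) = 0 then 1 else (Units.mk0 (J : FractionalIdeal A⁰ K) h)⁻¹
  refine ⟨g '' S, hS.image g, fun I => ?_⟩
  obtain ⟨c, I₀, hc, hI⟩ := FractionalIdeal.exists_eq_spanSingleton_mul (I : FractionalIdeal A⁰ K)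
  have hcK : algebraMap A K c ≠ 0 := by simpa using hc
  have hI₀ : I₀ ≠ ⊥ := by
    rintro rfl
    refine I.ne_zero ?_
    rw [hI]
    simp
  obtain ⟨a, J, ha, hIJ, hJ⟩ := hB I₀ hI₀
  have haK : algebraMap A K a ≠ 0 := by simpa using ha
  have hJ0 : J ≠ ⊥ := by
    rintro rfl
    rw [Ideal.mul_bot] at hIJ
    exact ha (Ideal.span_singleton_eq_bot.1 hIJ.symm)
  have hJK : (J : FractionalIdeal A⁰ K) ≠ 0 := FractionalIdeal.coeIdeal_ne_zero.2 hJ0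
  -- From `I = c⁻¹ I₀` and `I₀ J = (a)` one gets `(c / a) I = J⁻¹`, which explains the inverse in
  -- `g`.
  refine ⟨Units.mk0 _ hcK * (Units.mk0 _ haK)⁻¹, J, ⟨hJ0, hJ⟩, ?_⟩
  have h1 : g J = (Units.mk0 (J : FractionalIdeal A⁰ K) hJK)⁻¹ := dif_neg hJK
  have h2 : toPrincipalIdeal A K (Units.mk0 _ haK) =
      toPrincipalIdeal A K (Units.mk0 _ hcK) * I * Units.mk0 (J : FractionalIdeal A⁰ K) hJK := by
    refine Units.ext ?_
    rw [Units.val_mul, Units.val_mul, coe_toPrincipalIdeal, coe_toPrincipalIdeal, Units.val_mk0,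
      Units.val_mk0, Units.val_mk0, hI, ← mul_assoc,
      FractionalIdeal.spanSingleton_mul_spanSingleton, mul_inv_cancel₀ hcK,
      FractionalIdeal.spanSingleton_one, one_mul, ← FractionalIdeal.coeIdeal_mul, hIJ,
      FractionalIdeal.coeIdeal_span_singleton]
  rw [h1, map_mul, map_inv, h2]
  rw [mul_right_comm, mul_inv (_ * I), mul_inv_cancel_left]

end IsRegularOutside

/-! ### Compactness of the integral adeles -/

variable {A K : Type*} [CommRing A] [IsDedekindDomain A] [Field K] [Algebra A K]
  [IsFractionRing A K]

lemma exists_ball_subset {v : HeightOneSpectrum A} {s : Set (v.adicCompletion K)}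
    (hs : s ∈ nhds (0 : v.adicCompletion K)) :
    ∃ n : ℕ, {x | Valued.v x ≤ WithZero.exp (-(n : ℤ))} ⊆ s := by
  obtain ⟨γ, hγ⟩ := Valued.mem_nhds_zero.1 hs
  set δ : ℤᵐ⁰ := MonoidWithZeroHom.ValueGroup₀.embedding γ.1 with hδ
  have hδ0 : δ ≠ 0 := by
    intro h
    exact γ.ne_zero (MonoidWithZeroHom.ValueGroup₀.embedding_strictMono.injective
      (by rw [← hδ, h, map_zero]))
  -- The summand `1` makes `-n < log δ` strict, as the basic neighbourhoods are open balls.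
  refine ⟨(1 - WithZero.log δ).toNat, fun x hx => hγ ?_⟩
  rw [Set.mem_ofPred_eq] at hx ⊢
  rw [← MonoidWithZeroHom.ValueGroup₀.embedding_strictMono.lt_iff_lt, Valuation.embedding_restrict]
  refine lt_of_le_of_lt hx ?_
  rw [← hδ]
  conv_rhs => rw [← WithZero.exp_log hδ0]
  rw [WithZero.exp_lt_exp]
  omega

lemma valued_algebraMap (v : HeightOneSpectrum A) (k : K) :
    Valued.v (algebraMap K (v.adicCompletion K) k) = v.valuation K k :=
  HeightOneSpectrum.valuedAdicCompletion_eq_valuation' v k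

lemma closedBall_mem_nhds {v : HeightOneSpectrum A} (x : v.adicCompletion K) (n : ℤ) :
    {y : v.adicCompletion K | Valued.v (x - y) ≤ WithZero.exp n} ∈ nhds x := by
  obtain ⟨t, ht⟩ := HeightOneSpectrum.valuedAdicCompletion_surjective K v (WithZero.exp (-n))
  have hc : Continuous fun y : v.adicCompletion K => t * (x - y) := by fun_prop
  refine Filter.mem_of_superset
    (((Valued.isOpen_valuationSubring (v.adicCompletion K)).preimage hc).mem_nhds ?_) fun y hy => ?_
  · simp
  · have h1 : Valued.v (t * (x - y)) ≤ 1 := hy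
    rw [map_mul, ht, WithZero.exp_neg, inv_mul_le_iff₀ (by simp), mul_one] at h1
    exact h1

/-- `K` is dense in the completion, and an approximation in `K` that is integral at `v` can itself
be approximated by `A`. -/
lemma exists_valued_sub_le {v : HeightOneSpectrum A} {x : v.adicCompletion K}
    (hx : x ∈ v.adicCompletionIntegers K) (n : ℕ) :
    ∃ a : A, Valued.v (x - algebraMap K (v.adicCompletion K) (algebraMap A K a)) ≤
      WithZero.exp (-(n : ℤ)) := by
  obtain ⟨k, hk⟩ := (HeightOneSpectrum.denseRange_algebraMap K v).exists_mem_open isOpen_interior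
    ⟨x, mem_interior_iff_mem_nhds.2 (closedBall_mem_nhds x (-(n : ℤ)))⟩
  replace hk : Valued.v (x - algebraMap K (v.adicCompletion K) k) ≤ WithZero.exp (-(n : ℤ)) :=
    interior_subset (s := {y | Valued.v (x - y) ≤ WithZero.exp (-(n : ℤ))}) hk
  have hn : WithZero.exp (-(n : ℤ)) ≤ (1 : ℤᵐ⁰) := by
    rw [← WithZero.exp_zero, WithZero.exp_le_exp]
    omega
  have h1 : v.valuation K k ≤ 1 := by
    rw [← valued_algebraMap, ← sub_sub_cancel x (algebraMap K (v.adicCompletion K) k)]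
    exact Valuation.map_sub_le _ hx (hk.trans hn)
  obtain ⟨a, ha⟩ := v.exists_valuation_sub_lt_of_integer h1
    (Units.mk0 (WithZero.exp (-(n : ℤ))) WithZero.exp_ne_zero)
  refine ⟨a, ?_⟩
  rw [← sub_add_sub_cancel x (algebraMap K (v.adicCompletion K) k), ← map_sub]
  refine Valuation.map_add_le _ hk ?_
  rw [valued_algebraMap, Valuation.map_sub_swap]
  exact ha.le

/-- The ring of integers is closed in a complete field, and it is totally bounded because
representatives of `A ⧸ v ^ n` are dense up to a ball of radius `exp (-n)`. -/
lemma isCompact_adicCompletionIntegers (v : HeightOneSpectrum A)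
    (hfin : ∀ n : ℕ, Finite (A ⧸ v.asIdeal ^ n)) :
    IsCompact (v.adicCompletionIntegers K : Set (v.adicCompletion K)) := by
  rw [isCompact_iff_totallyBounded_isComplete]
  refine ⟨?_, (Valued.isClosed_valuationSubring _).isComplete⟩
  rw [totallyBounded_iff_subset_finite_iUnion_nhds_zero]
  intro U hU
  obtain ⟨n, hn⟩ := exists_ball_subset hU
  have := hfin n
  choose r hr using Ideal.Quotient.mk_surjective (I := v.asIdeal ^ n)
  refine ⟨Set.range fun c => algebraMap K (v.adicCompletion K) (algebraMap A K (r c)),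
    Set.finite_range _, fun x hx => ?_⟩
  obtain ⟨a, ha⟩ := exists_valued_sub_le hx n
  set b := r (Ideal.Quotient.mk _ a) with hb
  rw [Set.biUnion_range, Set.mem_iUnion]
  refine ⟨Ideal.Quotient.mk _ a, Set.mem_vadd_set.2
    ⟨x - algebraMap K (v.adicCompletion K) (algebraMap A K b), hn ?_, ?_⟩⟩
  · have h1 : a - b ∈ v.asIdeal ^ n := (Ideal.Quotient.mk_eq_mk_iff_sub_mem _ _).1 (hr _).symm
    rw [← v.intValuation_le_pow_iff_mem] at h1
    replace h1 : v.valuation K (algebraMap A K (a - b)) ≤ WithZero.exp (-(n : ℤ)) :=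
      (v.valuation_of_algebraMap _).trans_le h1
    rw [← valued_algebraMap, map_sub, map_sub] at h1
    rw [Set.mem_ofPred_eq,
      ← sub_add_sub_cancel x (algebraMap K (v.adicCompletion K) (algebraMap A K a))]
    exact Valuation.map_add_le _ ha h1
  · rw [vadd_eq_add, add_sub_cancel]

/-- The ring `R` of integral adeles is compact if the residue rings of `A` are finite. -/
lemma isCompact_integralAdeles (hfin : ∀ I : Ideal A, I ≠ ⊥ → Finite (A ⧸ I)) :
    IsCompact (integralAdeles A K : Set 𝔸ᶠ[A, K]) := by
  have h1 : ∀ v : HeightOneSpectrum A, CompactSpace (v.adicCompletionIntegers K) := fun v =>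
    isCompact_iff_compactSpace.1 (isCompact_adicCompletionIntegers v
      fun n => hfin _ (pow_ne_zero n v.ne_bot))
  have h2 := isCompact_range (RestrictedProduct.isEmbedding_structureMap
    (R := fun v : HeightOneSpectrum A => v.adicCompletion K)
    (A := fun v => (v.adicCompletionIntegers K : Set (v.adicCompletion K)))
    (𝓕 := Filter.cofinite)).continuous
  rw [RestrictedProduct.range_structureMap] at h2
  exact h2

/-! ### Adelic lattices and the ideal of an idele, described place by place -/

section LocalDescription

variable {A K : Type*} [CommRing A] [IsDedekindDomain A] [Field K] [Algebra A K]
  [IsFractionRing A K]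

lemma valuation_eq_exp_neg_count (v : HeightOneSpectrum A) {x : K} (hx : x ≠ 0) :
    v.valuation K x =
      WithZero.exp (-FractionalIdeal.count K v (FractionalIdeal.spanSingleton A⁰ x)) := by
  classical
  have key : ∀ a : A, a ≠ 0 → v.valuation K (algebraMap A K a) =
      WithZero.exp (-FractionalIdeal.count K v
        (FractionalIdeal.spanSingleton A⁰ (algebraMap A K a))) := by
    intro a ha
    have h0 : Ideal.span {a} ≠ 0 := by simpa using ha
    refine (v.valuation_of_algebraMap a).trans ?_
    rw [v.intValuation_if_neg ha, ← FractionalIdeal.coeIdeal_span_singleton,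
      FractionalIdeal.count_coe K v h0]
  obtain ⟨a, b, hb, rfl⟩ := IsFractionRing.div_surjective (A := A) x
  have hb0 : b ≠ 0 := nonZeroDivisors.ne_zero hb
  have hbK : algebraMap A K b ≠ 0 := by simpa using hb0
  have ha0 : a ≠ 0 := by
    rintro rfl
    simp at hx
  have h1 : FractionalIdeal.spanSingleton A⁰ (algebraMap A K a) =
      FractionalIdeal.spanSingleton A⁰ (algebraMap A K a / algebraMap A K b) *
        FractionalIdeal.spanSingleton A⁰ (algebraMap A K b) := by
    rw [FractionalIdeal.spanSingleton_mul_spanSingleton, div_mul_cancel₀ _ hbK]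
  have h2 := key a ha0
  rw [h1, FractionalIdeal.count_mul K v
    (FractionalIdeal.spanSingleton_ne_zero_iff.2 hx) (FractionalIdeal.spanSingleton_ne_zero_iff.2 hbK),
    neg_add,
    WithZero.exp_add, ← key b hb0] at h2
  rw [map_div₀, h2, mul_div_cancel_right₀ _ ((map_ne_zero _).2 hbK)]

lemma valuation_le_of_mem (v : HeightOneSpectrum A) {I : FractionalIdeal A⁰ K} {x : K}
    (hx : x ∈ I) : v.valuation K x ≤ WithZero.exp (-FractionalIdeal.count K v I) := by
  by_cases h0 : x = 0
  · rw [h0, map_zero]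
    exact zero_le
  · rw [valuation_eq_exp_neg_count v h0, WithZero.exp_le_exp, neg_le_neg_iff]
    refine FractionalIdeal.count_mono K v (FractionalIdeal.spanSingleton_ne_zero_iff.2 h0) ?_
    rwa [FractionalIdeal.spanSingleton_le_iff_mem]

/-- A fractional ideal is determined by its valuations. -/
lemma fractionalIdeal_ext {I J : (FractionalIdeal A⁰ K)ˣ}
    (h : ∀ v : HeightOneSpectrum A, FractionalIdeal.count K v (I : FractionalIdeal A⁰ K) =
      FractionalIdeal.count K v (J : FractionalIdeal A⁰ K)) : I = J := by
  refine Units.ext ?_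
  rw [← FractionalIdeal.finprod_heightOneSpectrum_factorization' K I.ne_zero,
    ← FractionalIdeal.finprod_heightOneSpectrum_factorization' K J.ne_zero]
  simp only [h]

lemma adele_mul_apply (x y : 𝔸ᶠ[A, K]) (v : HeightOneSpectrum A) : (x * y) v = x v * y v := rfl

lemma adele_one_apply (v : HeightOneSpectrum A) : (1 : 𝔸ᶠ[A, K]) v = 1 := rfl

lemma valued_algebraMap_adele (x : K) (v : HeightOneSpectrum A) :
    Valued.v (algebraMap K 𝔸ᶠ[A, K] x v) = v.valuation K x :=
  HeightOneSpectrum.valuedAdicCompletion_eq_valuation' v x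

/-- The local description of the lattice generated by a fractional ideal. -/
lemma mem_adelicSpan_iff {I : (FractionalIdeal A⁰ K)ˣ} {z : 𝔸ᶠ[A, K]} :
    z ∈ adelicSpan I ↔ ∀ v : HeightOneSpectrum A, Valued.v (z v) ≤
      WithZero.exp (-FractionalIdeal.count K v (I : FractionalIdeal A⁰ K)) := by
  constructor
  · intro hz v
    induction hz using Submodule.span_induction with
    | mem z hz =>
      obtain ⟨x, hx, rfl⟩ := hz
      rw [valued_algebraMap_adele]
      exact valuation_le_of_mem v hx
    | zero => exact (map_zero Valued.v).trans_le zero_le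
    | add x y _ _ hx hy => exact Valuation.map_add_le _ hx hy
    | smul a x _ hx =>
      change Valued.v ((a : 𝔸ᶠ[A, K]) v * x v) ≤ _
      rw [map_mul]
      exact (mul_le_of_le_one_left' (a.2 v)).trans hx
  · intro hz
    -- Writing `1` as a sum of products `x y` with `x ∈ I` and `y ∈ I⁻¹` gives `z` as the sum of the
    -- `(y z) x`. The local bounds say that each `y z` is an integral adele.
    have key : ∀ w ∈ (I : FractionalIdeal A⁰ K) * ((I⁻¹ : (FractionalIdeal A⁰ K)ˣ) :
        FractionalIdeal A⁰ K), algebraMap K 𝔸ᶠ[A, K] w * z ∈ adelicSpan I := by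
      intro w hw
      refine FractionalIdeal.mul_induction_on hw (fun x hx y hy => ?_) fun x y hx hy => ?_
      · have h1 : algebraMap K 𝔸ᶠ[A, K] y * z ∈ integralAdeles A K := by
          intro v
          rw [HeightOneSpectrum.mem_adicCompletionIntegers, adele_mul_apply, map_mul,
            valued_algebraMap_adele]
          have h2 := mul_le_mul' (valuation_le_of_mem v hy) (hz v)
          rwa [Units.val_inv_eq_inv_val, FractionalIdeal.count_inv, ← WithZero.exp_add,
            neg_add_cancel, WithZero.exp_zero] at h2
        have h3 := Submodule.smul_mem (adelicSpan I) (⟨_, h1⟩ : integralAdeles A K)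
          (Submodule.subset_span ⟨x, hx, rfl⟩)
        have h4 : algebraMap K 𝔸ᶠ[A, K] (x * y) * z =
            (⟨_, h1⟩ : integralAdeles A K) • algebraMap K 𝔸ᶠ[A, K] x := by
          change _ = (algebraMap K 𝔸ᶠ[A, K] y * z) * algebraMap K 𝔸ᶠ[A, K] x
          rw [map_mul]
          ring
        rwa [h4]
      · rw [map_add, add_mul]
        exact add_mem hx hy
    have h1 := key 1 (by rw [← Units.val_mul, mul_inv_cancel]; exact FractionalIdeal.one_mem_one _)
    rwa [map_one, one_mul] at h1

lemma adelicSpan_mono {I J : (FractionalIdeal A⁰ K)ˣ}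
    (h : (I : FractionalIdeal A⁰ K) ≤ (J : FractionalIdeal A⁰ K)) {z : 𝔸ᶠ[A, K]}
    (hz : z ∈ adelicSpan I) : z ∈ adelicSpan J :=
  Submodule.span_mono (Set.image_mono fun _ hx => h hx) hz

lemma mem_adelicSpan_one {z : 𝔸ᶠ[A, K]} :
    z ∈ adelicSpan (1 : (FractionalIdeal A⁰ K)ˣ) ↔ z ∈ integralAdeles A K := by
  rw [mem_adelicSpan_iff]
  simp only [Units.val_one, FractionalIdeal.count_one, neg_zero, WithZero.exp_zero]
  rfl

lemma valued_idele_ne_zero (u : 𝔸ᶠ[A, K]ˣ) (v : HeightOneSpectrum A) :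
    Valued.v ((u : 𝔸ᶠ[A, K]) v) ≠ 0 :=
  (map_ne_zero _).2 ((FiniteAdeleRing.isUnit_iff.1 u.isUnit).1 v)

lemma eventually_log_valued_eq_zero (u : 𝔸ᶠ[A, K]ˣ) :
    ∀ᶠ v : HeightOneSpectrum A in Filter.cofinite,
      -WithZero.log (Valued.v ((u : 𝔸ᶠ[A, K]) v)) = 0 := by
  filter_upwards [(FiniteAdeleRing.isUnit_iff.1 u.isUnit).2] with v hv
  rw [hv, WithZero.log_one, neg_zero]

lemma exists_ideleIdeal (u : 𝔸ᶠ[A, K]ˣ) : ∃ I : (FractionalIdeal A⁰ K)ˣ,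
    ∀ v : HeightOneSpectrum A, FractionalIdeal.count K v (I : FractionalIdeal A⁰ K) =
      -WithZero.log (Valued.v ((u : 𝔸ᶠ[A, K]) v)) := by
  refine ⟨Units.mk0 _ (finprod_induction (p := fun I : FractionalIdeal A⁰ K => I ≠ 0) one_ne_zero
    (fun _ _ => mul_ne_zero) fun v => zpow_ne_zero _ (FractionalIdeal.coeIdeal_ne_zero.2 v.ne_bot)),
    fun v => FractionalIdeal.count_finprod K v
      (fun v => -WithZero.log (Valued.v ((u : 𝔸ᶠ[A, K]) v))) (eventually_log_valued_eq_zero u)⟩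

/-- The fractional ideal `u R ∩ K` of an idele `u`. -/
noncomputable def ideleIdeal : 𝔸ᶠ[A, K]ˣ →* (FractionalIdeal A⁰ K)ˣ where
  toFun u := (exists_ideleIdeal u).choose
  map_one' := fractionalIdeal_ext fun v => by
    rw [(exists_ideleIdeal 1).choose_spec, Units.val_one, Units.val_one, FractionalIdeal.count_one,
      adele_one_apply, map_one, WithZero.log_one, neg_zero]
  map_mul' u w := fractionalIdeal_ext fun v => by
    rw [(exists_ideleIdeal (u * w)).choose_spec, Units.val_mul, Units.val_mul,
      FractionalIdeal.count_mul K v (Units.ne_zero _) (Units.ne_zero _),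
      (exists_ideleIdeal u).choose_spec, (exists_ideleIdeal w).choose_spec, adele_mul_apply,
      map_mul, WithZero.log_mul (valued_idele_ne_zero u v) (valued_idele_ne_zero w v), neg_add]

lemma valued_idele (u : 𝔸ᶠ[A, K]ˣ) (v : HeightOneSpectrum A) :
    Valued.v ((u : 𝔸ᶠ[A, K]) v) =
      WithZero.exp (-FractionalIdeal.count K v (ideleIdeal u : FractionalIdeal A⁰ K)) := by
  have h : FractionalIdeal.count K v (ideleIdeal u : FractionalIdeal A⁰ K) = _ :=
    (exists_ideleIdeal u).choose_spec v
  rw [h, neg_neg, WithZero.exp_log (valued_idele_ne_zero u v)]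

lemma idele_mul_mem_adelicSpan (u : 𝔸ᶠ[A, K]ˣ) {I : (FractionalIdeal A⁰ K)ˣ} {z : 𝔸ᶠ[A, K]} :
    u * z ∈ adelicSpan (ideleIdeal u * I) ↔ z ∈ adelicSpan I := by
  rw [mem_adelicSpan_iff, mem_adelicSpan_iff]
  refine forall_congr' fun v => ?_
  rw [adele_mul_apply, map_mul, valued_idele, Units.val_mul,
    FractionalIdeal.count_mul K v (Units.ne_zero _) (Units.ne_zero _), neg_add, WithZero.exp_add,
    mul_le_mul_iff_right₀ (by simp)]

lemma ideleIdeal_unitEmbedding (a : Kˣ) :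
    ideleIdeal (FiniteAdeleRing.unitEmbedding A K a) = toPrincipalIdeal A K a :=
  fractionalIdeal_ext fun v => by
    have h := valued_idele (FiniteAdeleRing.unitEmbedding A K a) v
    rw [FiniteAdeleRing.unitEmbedding_apply, valued_algebraMap_adele,
      valuation_eq_exp_neg_count v a.ne_zero, WithZero.exp_inj, neg_inj] at h
    rw [coe_toPrincipalIdeal, h]

lemma mem_range_of_mem_integralAdeles {x : K}
    (hx : algebraMap K 𝔸ᶠ[A, K] x ∈ integralAdeles A K) : ∃ a : A, algebraMap A K a = x :=
  HeightOneSpectrum.mem_integers_of_valuation_le_one K x fun v => by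
    rw [← valued_algebraMap_adele]
    exact hx v

lemma coe_mem_integralAdeles (u : integralIdeles A K) :
    ((u : 𝔸ᶠ[A, K]ˣ) : 𝔸ᶠ[A, K]) ∈ integralAdeles A K :=
  u.2

/-- An element of this ideal lies in `u R ⊆ R`, and `R ∩ K = A`. -/
lemma ideleIdeal_le_one (u : integralIdeles A K) :
    (ideleIdeal (u : 𝔸ᶠ[A, K]ˣ) : FractionalIdeal A⁰ K) ≤ 1 := by
  intro x hx
  have h1 : algebraMap K 𝔸ᶠ[A, K] x ∈ adelicSpan (ideleIdeal (u : 𝔸ᶠ[A, K]ˣ)) :=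
    Submodule.subset_span ⟨x, hx, rfl⟩
  obtain ⟨z, hz⟩ : ∃ z, algebraMap K 𝔸ᶠ[A, K] x = (u : 𝔸ᶠ[A, K]ˣ) * z :=
    ⟨_, (Units.mul_inv_cancel_left (u : 𝔸ᶠ[A, K]ˣ) _).symm⟩
  rw [hz, ← mul_one (ideleIdeal (u : 𝔸ᶠ[A, K]ˣ)), idele_mul_mem_adelicSpan,
    mem_adelicSpan_one] at h1
  obtain ⟨a, ha⟩ := mem_range_of_mem_integralAdeles (A := A) (x := x)
    (hz ▸ mul_mem (coe_mem_integralAdeles u) h1)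
  exact (FractionalIdeal.mem_one_iff A⁰).2 ⟨a, ha⟩

/-- If `c` clears the denominators of `I`, then the lattice is a closed subset of the compact set
`c⁻¹ R`. -/
lemma isCompact_adelicSpan (hfin : ∀ I : Ideal A, I ≠ ⊥ → Finite (A ⧸ I))
    (I : (FractionalIdeal A⁰ K)ˣ) : IsCompact (adelicSpan I : Set 𝔸ᶠ[A, K]) := by
  obtain ⟨c, I₀, hc, hI⟩ := FractionalIdeal.exists_eq_spanSingleton_mul (I : FractionalIdeal A⁰ K)
  have hcK : algebraMap A K c ≠ 0 := by simpa using hc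
  let d := Units.mk0 _ hcK
  have hle : ((toPrincipalIdeal A K d * I : (FractionalIdeal A⁰ K)ˣ) : FractionalIdeal A⁰ K) ≤
      ((1 : (FractionalIdeal A⁰ K)ˣ) : FractionalIdeal A⁰ K) := by
    rw [Units.val_mul, coe_toPrincipalIdeal, Units.val_mk0, hI, ← mul_assoc,
      FractionalIdeal.spanSingleton_mul_spanSingleton, mul_inv_cancel₀ hcK,
      FractionalIdeal.spanSingleton_one, one_mul, Units.val_one]
    exact FractionalIdeal.coeIdeal_le_one
  have hR : IsCompact (integralAdeles A K : Set 𝔸ᶠ[A, K]) := isCompact_integralAdeles hfin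
  let w := FiniteAdeleRing.unitEmbedding A K d
  have hcont : Continuous fun z : 𝔸ᶠ[A, K] => ((w⁻¹ : 𝔸ᶠ[A, K]ˣ) : 𝔸ᶠ[A, K]) * z := by fun_prop
  refine (hR.image hcont).of_isClosed_subset (isClosed_adelicSpan I) fun z hz => ?_
  refine ⟨w * z, mem_adelicSpan_one.1 (adelicSpan_mono hle (smul_mem_adelicSpan d hz)), ?_⟩
  simp only [Units.inv_mul_cancel_left]

/-- Every idele is the quotient of an integral one by an element of `K`. -/
lemma exists_mul_mem_integralIdeles (w : 𝔸ᶠ[A, K]ˣ) :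
    ∃ (a : Kˣ) (u : integralIdeles A K),
      (u : 𝔸ᶠ[A, K]ˣ) = FiniteAdeleRing.unitEmbedding A K a * w := by
  obtain ⟨c, I₀, hc, hI⟩ :=
    FractionalIdeal.exists_eq_spanSingleton_mul (ideleIdeal w : FractionalIdeal A⁰ K)
  have hcK : algebraMap A K c ≠ 0 := by simpa using hc
  refine ⟨Units.mk0 _ hcK, ⟨FiniteAdeleRing.unitEmbedding A K (Units.mk0 _ hcK) * w, ?_⟩, rfl⟩
  have hle : (ideleIdeal (FiniteAdeleRing.unitEmbedding A K (Units.mk0 _ hcK) * w) :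
      FractionalIdeal A⁰ K) ≤ ((1 : (FractionalIdeal A⁰ K)ˣ) : FractionalIdeal A⁰ K) := by
    rw [map_mul, ideleIdeal_unitEmbedding, Units.val_mul, coe_toPrincipalIdeal, Units.val_mk0, hI,
      ← mul_assoc, FractionalIdeal.spanSingleton_mul_spanSingleton, mul_inv_cancel₀ hcK,
      FractionalIdeal.spanSingleton_one, one_mul, Units.val_one]
    exact FractionalIdeal.coeIdeal_le_one
  have h1 : (1 : 𝔸ᶠ[A, K]) ∈ adelicSpan (1 : (FractionalIdeal A⁰ K)ˣ) :=
    mem_adelicSpan_one.2 (one_mem _)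
  have h2 := (idele_mul_mem_adelicSpan
    (FiniteAdeleRing.unitEmbedding A K (Units.mk0 _ hcK) * w)).2 h1
  rw [mul_one, mul_one] at h2
  exact mem_adelicSpan_one.1 (adelicSpan_mono hle h2)

end LocalDescription

/-! ### The elements `shift B` of the convolution algebra -/

section Algebra

variable {A K : Type*} [CommRing A] [IsDedekindDomain A] [Field K] [Algebra A K]
  [IsFractionRing A K] {C : Type*} [NormedField C]

variable (A K) in
/-- The space of commensurability classes modulo `Kˣ` is compact: finitely many ideals represent
all ideal classes, and the lattices `Λ R` are compact. -/
def IsCocompact : Prop :=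
  (∃ T : Set (FractionalIdeal A⁰ K)ˣ, T.Finite ∧ ∀ I, ∃ r : Kˣ, toPrincipalIdeal A K r * I ∈ T) ∧
    ∀ I : (FractionalIdeal A⁰ K)ˣ, IsCompact (adelicSpan I : Set 𝔸ᶠ[A, K])

namespace ConvAlg

lemma extZero_mul_apply (f g : ConvAlg A K C) (I J : (FractionalIdeal A⁰ K)ˣ) (z : 𝔸ᶠ[A, K]) :
    extZero (f * g).1 I J z = ∑ᶠ T, extZero f.1 I T z * extZero g.1 T J z :=
  extZero_conv _ _ _ _ _

open Classical in
/-- The characteristic function of the pairs `((Λ, φ), (B Λ, φ))`, for a fractional ideal `B`. -/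
noncomputable def shift (hc : IsCocompact A K) (B : (FractionalIdeal A⁰ K)ˣ) : ConvAlg A K C where
  val Q := if Q.snd.lat = B * Q.fst.lat then 1 else 0
  property := by
    refine ⟨continuous_def.2 fun U _ => CommPair.isOpen_lat fun I J =>
      (if J = B * I then (1 : C) else 0) ∈ U, fun r Q => ?_, ?_⟩
    · have h : (r • Q).snd.lat = B * (r • Q).fst.lat ↔ Q.snd.lat = B * Q.fst.lat := by
        change toPrincipalIdeal A K r * Q.snd.lat = B * (toPrincipalIdeal A K r * Q.fst.lat) ↔ _
        rw [mul_left_comm, mul_right_inj]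
      simp only [h]
    · obtain ⟨⟨T, hT, hT'⟩, hcomp⟩ := hc
      -- Modulo `Kˣ` the first ideal lies in the finite set `T`. It determines the second one, and
      -- the common adele runs through a compact set.
      refine ⟨⋃ t ∈ T, Set.range fun z : {z : 𝔸ᶠ[A, K] // z ∈ adelicSpan t ∧
        z ∈ adelicSpan (B * t)} => CommPair.mk' t (B * t) z.1 z.2,
        hT.isCompact_biUnion fun t _ => ?_, fun Q hQ => ?_⟩
      · have : CompactSpace {z : 𝔸ᶠ[A, K] // z ∈ adelicSpan t ∧ z ∈ adelicSpan (B * t)} :=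
          isCompact_iff_compactSpace.1 ((hcomp t).inter_right (isClosed_adelicSpan (B * t)))
        exact isCompact_range (CommPair.continuous_mk' _ _)
      · obtain ⟨r, hr⟩ := hT' Q.fst.lat
        have h1 : Q.snd.lat = B * Q.fst.lat := by
          by_contra h
          exact hQ (if_neg h)
        have h2 : (r • Q).snd.lat = B * (r • Q).fst.lat := by
          change toPrincipalIdeal A K r * Q.snd.lat = B * (toPrincipalIdeal A K r * Q.fst.lat)
          rw [h1, mul_left_comm]
        refine ⟨r, Set.mem_biUnion hr ⟨⟨(r • Q).fst.phi, (r • Q).fst.mem, ?_⟩, ?_⟩⟩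
        · have h3 := (r • Q).snd.mem
          rw [h2, ← (r • Q).comm] at h3
          exact h3
        · exact CommPair.ext (KLattice.ext rfl rfl) (KLattice.ext h2.symm (r • Q).comm)

variable (hc : IsCocompact A K)

open Classical in
lemma shift_apply (B : (FractionalIdeal A⁰ K)ˣ) (Q : CommPair A K) :
    (shift hc B : ConvAlg A K C).1 Q = if Q.snd.lat = B * Q.fst.lat then 1 else 0 := rfl

open Classical in
lemma extZero_shift (B I J : (FractionalIdeal A⁰ K)ˣ) (z : 𝔸ᶠ[A, K]) :
    extZero (shift hc B : ConvAlg A K C).1 I J z =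
      if J = B * I ∧ z ∈ adelicSpan I ∧ z ∈ adelicSpan J then 1 else 0 := by
  by_cases h : z ∈ adelicSpan I ∧ z ∈ adelicSpan J
  · rw [extZero, dif_pos h, shift_apply]
    simp only [h, and_self, and_true]
    rfl
  · rw [extZero, dif_neg h, if_neg fun h' => h h'.2]

-- Left multiplication by `shift B` leaves only the term `T = B I` of the convolution sum. The
-- condition on `z` is not automatic, as `B I` need not be contained in `I`.
open Classical in
lemma extZero_shift_mul (B : (FractionalIdeal A⁰ K)ˣ) (f : ConvAlg A K C)
    (I J : (FractionalIdeal A⁰ K)ˣ) (z : 𝔸ᶠ[A, K]) :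
    extZero (shift hc B * f).1 I J z =
      if z ∈ adelicSpan I then extZero f.1 (B * I) J z else 0 := by
  rw [extZero_mul_apply, finsum_eq_single _ (B * I) fun T hT => by
    rw [extZero_shift, if_neg fun h => hT h.1, zero_mul]]
  rw [extZero_shift]
  by_cases h0 : extZero f.1 (B * I) J z = 0
  · rw [h0, mul_zero, ite_self]
  · have h1 := mem_of_extZero h0
    by_cases h2 : z ∈ adelicSpan I
    · rw [if_pos ⟨rfl, h2, h1.1⟩, if_pos h2, one_mul]
    · rw [if_neg fun h => h2 h.2.1, if_neg h2, zero_mul]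

open Classical in
lemma extZero_mul_shift (B : (FractionalIdeal A⁰ K)ˣ) (f : ConvAlg A K C)
    (I J : (FractionalIdeal A⁰ K)ˣ) (z : 𝔸ᶠ[A, K]) :
    extZero (f * shift hc B).1 I J z =
      if z ∈ adelicSpan J then extZero f.1 I (B⁻¹ * J) z else 0 := by
  rw [extZero_mul_apply, finsum_eq_single _ (B⁻¹ * J) fun T hT => by
    rw [extZero_shift, if_neg fun h => hT (by rw [h.1, inv_mul_cancel_left]), mul_zero]]
  rw [extZero_shift]
  by_cases h0 : extZero f.1 I (B⁻¹ * J) z = 0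
  · rw [h0, zero_mul, ite_self]
  · have h1 := mem_of_extZero h0
    by_cases h2 : z ∈ adelicSpan J
    · rw [if_pos ⟨by rw [mul_inv_cancel_left], h1.2, h2⟩, if_pos h2, mul_one]
    · rw [if_neg fun h => h2 h.2.2, if_neg h2, mul_zero]

lemma isIdentity_shift_one : IsIdentity (shift hc 1 : ConvAlg A K C) := by
  classical
  refine fun f => ⟨ext_of fun I J z => ?_, ext_of fun I J z => ?_⟩
  · rw [extZero_shift_mul, one_mul]
    by_cases h : extZero f.1 I J z = 0
    · rw [h, ite_self]
    · rw [if_pos (mem_of_extZero h).1]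
  · rw [extZero_mul_shift, inv_one, one_mul]
    by_cases h : extZero f.1 I J z = 0
    · rw [h, ite_self]
    · rw [if_pos (mem_of_extZero h).2]

/-- The product leads from `Λ` to `B⁻¹ Λ` and back. The intermediate pair exists because `Λ ⊆ B⁻¹ Λ`
for integral `B`. In the opposite order the path runs through `B Λ` and only yields the
characteristic function of the condition `φ ∈ B Λ R`. -/
lemma shift_inv_mul_shift {B : (FractionalIdeal A⁰ K)ˣ} (hB : (B : FractionalIdeal A⁰ K) ≤ 1) :
    (shift hc B⁻¹ * shift hc B : ConvAlg A K C) = shift hc 1 := by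
  classical
  refine ext_of fun I J z => ?_
  have hI : (I : FractionalIdeal A⁰ K) ≤ (B⁻¹ * I : (FractionalIdeal A⁰ K)ˣ) := by
    have h1 : ((B * (B⁻¹ * I) : (FractionalIdeal A⁰ K)ˣ) : FractionalIdeal A⁰ K) ≤
        (B⁻¹ * I : (FractionalIdeal A⁰ K)ˣ) := by
      rw [Units.val_mul]
      exact mul_le_of_le_one_left' hB
    rwa [mul_inv_cancel_left] at h1
  rw [extZero_shift_mul, extZero_shift, extZero_shift, mul_inv_cancel_left, one_mul]
  by_cases h : z ∈ adelicSpan I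
  · rw [if_pos h]
    simp only [h, adelicSpan_mono hI h, true_and]
  · rw [if_neg h, if_neg fun h' => h h'.2.1]

/-- Conjugation by `shift B` for an integral ideal `B`. -/
lemma extZero_shift_mul_mul_shift {B : (FractionalIdeal A⁰ K)ˣ}
    (hB : (B : FractionalIdeal A⁰ K) ≤ 1) (f : ConvAlg A K C)
    (I J : (FractionalIdeal A⁰ K)ˣ) (z : 𝔸ᶠ[A, K]) :
    extZero (shift hc B * f * shift hc B⁻¹).1 I J z = extZero f.1 (B * I) (B * J) z := by
  classical
  have hle : ∀ I : (FractionalIdeal A⁰ K)ˣ, ((B * I : (FractionalIdeal A⁰ K)ˣ) :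
      FractionalIdeal A⁰ K) ≤ I := fun I => by
    rw [Units.val_mul]
    exact mul_le_of_le_one_left' hB
  rw [extZero_mul_shift, extZero_shift_mul, inv_inv]
  by_cases h : extZero f.1 (B * I) (B * J) z = 0
  · rw [h, ite_self, ite_self]
  · have h1 := mem_of_extZero h
    rw [if_pos (adelicSpan_mono (hle J) h1.2), if_pos (adelicSpan_mono (hle I) h1.1)]

/-- On the support of `shift B` the ratio of the two ideals is `Λ / (B Λ) = B⁻¹`. -/
lemma twist_shift (c : (FractionalIdeal A⁰ K)ˣ → C) (B : (FractionalIdeal A⁰ K)ˣ) :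
    twist c (shift hc B) = c B⁻¹ • (shift hc B : ConvAlg A K C) := by
  refine Subtype.ext (funext fun Q => ?_)
  change c (Q.fst.lat * Q.snd.lat⁻¹) * _ = c B⁻¹ * _
  rw [shift_apply]
  split_ifs with h
  · rw [h, mul_inv_rev, mul_inv_cancel_left]
  · rw [mul_zero, mul_zero]

end ConvAlg

/-! ### The action of the ideles -/

/-- The lattice `(u Λ, u φ)` for an idele `u`. -/
noncomputable def KLattice.ideleMul (u : 𝔸ᶠ[A, K]ˣ) (L : KLattice A K) : KLattice A K where
  lat := ideleIdeal u * L.lat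
  phi := u * L.phi
  mem := (idele_mul_mem_adelicSpan u).2 L.mem

lemma KLattice.continuous_ideleMul (u : 𝔸ᶠ[A, K]ˣ) :
    Continuous (KLattice.ideleMul (A := A) (K := K) u) := by
  refine continuous_inf_rng.2 ⟨continuous_induced_rng.2 ?_, continuous_induced_rng.2 ?_⟩
  · let : TopologicalSpace (FractionalIdeal A⁰ K)ˣ := ⊥
    have : DiscreteTopology (FractionalIdeal A⁰ K)ˣ := ⟨rfl⟩
    exact (continuous_of_discreteTopology (f := fun I => ideleIdeal u * I)).comp
      (continuous_iff_le_induced.2 inf_le_left : Continuous (KLattice.lat (A := A) (K := K)))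
  · exact (continuous_const_mul (u : 𝔸ᶠ[A, K])).comp
      (continuous_iff_le_induced.2 inf_le_right : Continuous (KLattice.phi (A := A) (K := K)))

/-- The diagonal action of an idele on commensurable pairs. -/
noncomputable def CommPair.ideleMul (u : 𝔸ᶠ[A, K]ˣ) (Q : CommPair A K) : CommPair A K where
  fst := Q.fst.ideleMul u
  snd := Q.snd.ideleMul u
  comm := congrArg ((u : 𝔸ᶠ[A, K]) * ·) Q.comm

lemma CommPair.continuous_ideleMul (u : 𝔸ᶠ[A, K]ˣ) :
    Continuous (CommPair.ideleMul (A := A) (K := K) u) := by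
  have h1 : Continuous fun Q : CommPair A K => (Q.ideleMul u).fst :=
    (KLattice.continuous_ideleMul u).comp (continuous_iff_le_induced.2 inf_le_left)
  have h2 : Continuous fun Q : CommPair A K => (Q.ideleMul u).snd :=
    (KLattice.continuous_ideleMul u).comp (continuous_iff_le_induced.2 inf_le_right)
  exact continuous_inf_rng.2 ⟨continuous_induced_rng.2 h1, continuous_induced_rng.2 h2⟩

lemma CommPair.ideleMul_mul (u w : 𝔸ᶠ[A, K]ˣ) (Q : CommPair A K) :
    Q.ideleMul (u * w) = (Q.ideleMul w).ideleMul u := by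
  have h : ∀ L : KLattice A K, L.ideleMul (u * w) = (L.ideleMul w).ideleMul u := fun L =>
    KLattice.ext (by simp only [KLattice.ideleMul, map_mul, mul_assoc])
      (by simp only [KLattice.ideleMul, Units.val_mul, mul_assoc])
  exact CommPair.ext (h _) (h _)

lemma CommPair.ideleMul_one (Q : CommPair A K) : Q.ideleMul 1 = Q := by
  have h : ∀ L : KLattice A K, L.ideleMul 1 = L := fun L =>
    KLattice.ext (by simp only [KLattice.ideleMul, map_one, one_mul])
      (by simp only [KLattice.ideleMul, Units.val_one, one_mul])
  exact CommPair.ext (h _) (h _)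

lemma CommPair.ideleMul_unitEmbedding (a : Kˣ) (Q : CommPair A K) :
    Q.ideleMul (FiniteAdeleRing.unitEmbedding A K a) = a • Q := by
  have h : ∀ L : KLattice A K, L.ideleMul (FiniteAdeleRing.unitEmbedding A K a) = a • L :=
    fun L => KLattice.ext (congrArg (· * L.lat) (ideleIdeal_unitEmbedding a)) rfl
  exact CommPair.ext (h _) (h _)

lemma CommPair.ideleMul_smul (u : 𝔸ᶠ[A, K]ˣ) (r : Kˣ) (Q : CommPair A K) :
    (r • Q).ideleMul u = r • Q.ideleMul u := by
  rw [← CommPair.ideleMul_unitEmbedding, ← CommPair.ideleMul_unitEmbedding,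
    ← CommPair.ideleMul_mul, ← CommPair.ideleMul_mul, mul_comm]

namespace ConvAlg

/-- The linear automorphism `f ↦ ((L, L') ↦ f(u⁻¹ L, u⁻¹ L'))`. -/
noncomputable def translateₗ (u : 𝔸ᶠ[A, K]ˣ) : ConvAlg A K C →ₗ[C] ConvAlg A K C where
  toFun f := ⟨fun Q => f.1 (Q.ideleMul u⁻¹), f.2.1.comp (CommPair.continuous_ideleMul _),
    fun r Q => by
      change f.1 ((r • Q).ideleMul u⁻¹) = f.1 (Q.ideleMul u⁻¹)
      rw [CommPair.ideleMul_smul, f.2.2.1], by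
    obtain ⟨S, hS, hS'⟩ := f.2.2.2
    refine ⟨CommPair.ideleMul u '' S, hS.image (CommPair.continuous_ideleMul u), fun Q hQ => ?_⟩
    obtain ⟨r, hr⟩ := hS' _ hQ
    refine ⟨r, _, hr, ?_⟩
    rw [CommPair.ideleMul_smul, ← CommPair.ideleMul_mul, mul_inv_cancel, CommPair.ideleMul_one]⟩
  map_add' _ _ := rfl
  map_smul' _ _ := rfl

lemma extZero_translateₗ (u : 𝔸ᶠ[A, K]ˣ) (f : ConvAlg A K C) (I J : (FractionalIdeal A⁰ K)ˣ)
    (z : 𝔸ᶠ[A, K]) : extZero (translateₗ u f).1 I J z =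
      extZero f.1 ((ideleIdeal u)⁻¹ * I) ((ideleIdeal u)⁻¹ * J) ((u⁻¹ : 𝔸ᶠ[A, K]ˣ) * z) := by
  have key : ∀ I, ((u⁻¹ : 𝔸ᶠ[A, K]ˣ) : 𝔸ᶠ[A, K]) * z ∈ adelicSpan ((ideleIdeal u)⁻¹ * I) ↔
      z ∈ adelicSpan I := fun I => by
    rw [← map_inv]
    exact idele_mul_mem_adelicSpan u⁻¹
  by_cases h : z ∈ adelicSpan I ∧ z ∈ adelicSpan J
  · rw [extZero, dif_pos h, extZero, dif_pos ⟨(key I).2 h.1, (key J).2 h.2⟩]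
    refine congrArg f.1 (CommPair.ext (KLattice.ext ?_ rfl) (KLattice.ext ?_ rfl)) <;>
    exact congrArg (· * _) (map_inv ideleIdeal u)
  · rw [extZero, dif_neg h, extZero, dif_neg fun h' => h ⟨(key I).1 h'.1, (key J).1 h'.2⟩]

/-- The algebra automorphism `f ↦ ((L, L') ↦ f(u⁻¹ L, u⁻¹ L'))`. -/
noncomputable def translate (C : Type*) [NormedField C] (u : 𝔸ᶠ[A, K]ˣ) :
    ConvAlg A K C →ₙₐ[C] ConvAlg A K C where
  toFun := translateₗ u
  map_smul' c f := map_smul _ c f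
  map_zero' := map_zero _
  map_add' f g := map_add _ f g
  map_mul' f g := ext_of fun I J z => by
    simp only [extZero_translateₗ, extZero_mul_apply]
    exact (finsum_comp_equiv (Equiv.mulLeft (ideleIdeal u)⁻¹)).symm

lemma translate_apply (u : 𝔸ᶠ[A, K]ˣ) (f : ConvAlg A K C) (Q : CommPair A K) :
    (translate C u f).1 Q = f.1 (Q.ideleMul u⁻¹) := rfl

lemma extZero_translate (u : 𝔸ᶠ[A, K]ˣ) (f : ConvAlg A K C) (I J : (FractionalIdeal A⁰ K)ˣ)
    (z : 𝔸ᶠ[A, K]) : extZero (translate C u f).1 I J z =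
      extZero f.1 ((ideleIdeal u)⁻¹ * I) ((ideleIdeal u)⁻¹ * J) ((u⁻¹ : 𝔸ᶠ[A, K]ˣ) * z) :=
  extZero_translateₗ u f I J z

lemma translate_mul (u w : 𝔸ᶠ[A, K]ˣ) (f : ConvAlg A K C) :
    translate C (u * w) f = translate C u (translate C w f) :=
  Subtype.ext <| funext fun Q => by
    rw [translate_apply, translate_apply, translate_apply, ← CommPair.ideleMul_mul, mul_inv_rev]

lemma translate_one (f : ConvAlg A K C) : translate C 1 f = f :=
  Subtype.ext <| funext fun Q => by rw [translate_apply, inv_one, CommPair.ideleMul_one]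

/-- This is the `Kˣ`-invariance of the elements of the algebra. It makes principal `u` act by inner
endomorphisms and lets the action on KMS states factor through the idele classes. -/
lemma translate_unitEmbedding (a : Kˣ) (f : ConvAlg A K C) :
    translate C (FiniteAdeleRing.unitEmbedding A K a) f = f :=
  Subtype.ext <| funext fun Q => by
    rw [translate_apply, ← map_inv, CommPair.ideleMul_unitEmbedding, f.2.2.1]

/-- Translation multiplies both ideals of a pair by the same ideal, so their ratio does not change.
-/
lemma translate_shift (hc : IsCocompact A K) (u : 𝔸ᶠ[A, K]ˣ) (B : (FractionalIdeal A⁰ K)ˣ) :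
    translate C u (shift hc B : ConvAlg A K C) = shift hc B :=
  Subtype.ext <| funext fun Q => by
    classical
    rw [translate_apply, shift_apply, shift_apply]
    refine if_congr ?_ rfl rfl
    change ideleIdeal u⁻¹ * Q.snd.lat = B * (ideleIdeal u⁻¹ * Q.fst.lat) ↔ _
    rw [mul_left_comm, mul_right_inj]

lemma translate_twist (u : 𝔸ᶠ[A, K]ˣ) (c : (FractionalIdeal A⁰ K)ˣ → C) (f : ConvAlg A K C) :
    translate C u (twist c f) = twist c (translate C u f) :=
  Subtype.ext <| funext fun Q => by
    change c ((ideleIdeal u⁻¹ * Q.fst.lat) * (ideleIdeal u⁻¹ * Q.snd.lat)⁻¹) * _ =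
      c (Q.fst.lat * Q.snd.lat⁻¹) * _
    rw [mul_inv, mul_mul_mul_comm, mul_inv_cancel, one_mul]
    rfl

end ConvAlg

end Algebra

/-! ### Ultrametric norms, and the operator norm as a supremum norm -/

namespace Place

variable {K : Type*} [Field K] (P : Place K)

instance : IsUltrametricDist (AlgebraicClosure P.KInf) :=
  IsUltrametricDist.isUltrametricDist_of_isNonarchimedean_norm
    (isNonarchimedean_spectralNorm (K := P.KInf) (L := AlgebraicClosure P.KInf))

instance : IsUltrametricDist P.CInf :=
  IsUltrametricDist.isUltrametricDist_of_forall_norm_add_le_max_norm fun x y => by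
    induction x, y using UniformSpace.Completion.induction_on₂ with
    | hp => exact isClosed_le (by fun_prop) (by fun_prop)
    | ih a b =>
      rw [← UniformSpace.Completion.coe_add]
      simp only [UniformSpace.Completion.norm_coe]
      exact IsUltrametricDist.norm_add_le_max a b

lemma norm_toKInf (a : K) : ‖P.toKInf a‖ = P.absVal a :=
  UniformSpace.Completion.norm_coe _

/-- The embedding of `K` in `K∞` as a ring homomorphism. -/
noncomputable def toKInfHom : K →+* P.KInf :=
  (UniformSpace.Completion.coeRingHom (α := WithAbs P.absVal)).comp
    (WithAbs.equiv P.absVal).symm.toRingHom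

lemma toKInfHom_apply (a : K) : P.toKInfHom a = P.toKInf a := rfl

lemma norm_embed (a : P.KInf) : ‖P.embed a‖ = ‖a‖ :=
  (UniformSpace.Completion.norm_coe _).trans (spectralNorm_extends a)

lemma denseRange_toKInf : DenseRange P.toKInf :=
  UniformSpace.Completion.denseRange_coe.comp
    (WithAbs.equiv P.absVal).symm.surjective.denseRange (UniformSpace.Completion.continuous_coe _)

end Place

section Norm

variable {A K : Type*} [CommRing A] [IsDedekindDomain A] [Field K] [Algebra A K]
  [IsFractionRing A K] {C : Type*} [NormedField C]

/-- Test the representation at the first lattice of the pair on the point mass at the second. -/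
lemma enorm_apply_le_opNorm (f : CommPair A K → C) (Q : CommPair A K) : ‖f Q‖ₑ ≤ opNorm f := by
  classical
  let ξ : {M : KLattice A K // M.phi = Q.fst.phi} →₀ C := Finsupp.single ⟨Q.snd, Q.comm.symm⟩ 1
  have hξ : ξ ≠ 0 := by simp [ξ]
  have h1 : rep f Q.fst ξ ⟨Q.fst, rfl⟩ = f Q := by
    rw [rep, Finsupp.sum_single_index (mul_zero _), mul_one]
  have h2 : (⨆ M, ‖ξ M‖ₑ) ≤ 1 := iSup_le fun M => by
    rw [Finsupp.single_apply]
    split_ifs <;> simp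
  refine le_trans ?_ (le_iSup_of_le Q.fst (le_iSup₂_of_le ξ hξ le_rfl))
  calc ‖f Q‖ₑ = ‖rep f Q.fst ξ ⟨Q.fst, rfl⟩‖ₑ / 1 := by rw [h1, div_one]
    _ ≤ _ := ENNReal.div_le_div (le_iSup (fun M => ‖rep f Q.fst ξ M‖ₑ) _) h2

/-- By the ultrametric inequality a finite sum is no larger than its largest term. With the previous
lemma, `opNorm` is the supremum norm of `f` over all pairs. -/
lemma opNorm_le [IsUltrametricDist C] {f : CommPair A K → C} {B : ℝ≥0∞} (h : ∀ Q, ‖f Q‖ₑ ≤ B) :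
    opNorm f ≤ B := by
  refine iSup_le fun L => iSup₂_le fun ξ _ => ENNReal.div_le_of_le_mul (iSup_le fun M => ?_)
  have : Nonempty {M : KLattice A K // M.phi = L.phi} := ⟨M⟩
  obtain ⟨N, -, hN⟩ := IsUltrametricDist.exists_norm_finsetSum_le ξ.support
    fun N => f ⟨M, N, M.2.trans N.2.symm⟩ * ξ N
  have h1 : ‖rep f L ξ M‖ₑ ≤ ‖f ⟨M, N, M.2.trans N.2.symm⟩ * ξ N‖ₑ := enorm_le_iff_norm_le.2 hN
  rw [enorm_mul] at h1
  exact h1.trans (mul_le_mul' (h _) (le_iSup (fun N => ‖ξ N‖ₑ) N))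

lemma opNorm_le_opNorm [IsUltrametricDist C] {f g : CommPair A K → C}
    (h : ∀ Q, g Q = 0 ∨ ∃ Q', g Q = f Q') : opNorm g ≤ opNorm f :=
  opNorm_le fun Q => by
    obtain h0 | ⟨Q', h1⟩ := h Q
    · simp [h0]
    · exact h1 ▸ enorm_apply_le_opNorm f Q'

end Norm

/-! ### The endomorphisms `θ_u` -/

section Endomorphisms

variable {A K : Type*} [CommRing A] [IsDedekindDomain A] [Field K] [Algebra A K]
  [IsFractionRing A K] (C : Type*) [NormedField C] (hc : IsCocompact A K)

namespace ConvAlg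

/-- Conjugation by the isometry `shift B`, for an integral ideal `B`. -/
noncomputable def conjShift (B : (FractionalIdeal A⁰ K)ˣ) (hB : (B : FractionalIdeal A⁰ K) ≤ 1) :
    ConvAlg A K C →ₙₐ[C] ConvAlg A K C where
  toFun f := shift hc B * f * shift hc B⁻¹
  map_smul' c f := by simp only [mul_smul_comm, smul_mul_assoc, MonoidHom.id_apply]
  map_zero' := by rw [mul_zero, zero_mul]
  map_add' f g := by rw [mul_add, add_mul]
  map_mul' f g := by
    have h : (shift hc B⁻¹ * (shift hc B * (g * shift hc B⁻¹)) : ConvAlg A K C) =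
        g * shift hc B⁻¹ := by
      rw [← mul_assoc, shift_inv_mul_shift hc hB, (isIdentity_shift_one hc _).1]
    simp only [mul_assoc, h]

/-- The endomorphism `θ_u`. -/
noncomputable def divEndo (u : integralIdeles A K) : ConvAlg A K C →ₙₐ[C] ConvAlg A K C :=
  (conjShift C hc (ideleIdeal (u : 𝔸ᶠ[A, K]ˣ)) (ideleIdeal_le_one u)).comp (translate C u)

variable {C}

lemma divEndo_apply (u : integralIdeles A K) (f : ConvAlg A K C) :
    divEndo C hc u f = shift hc (ideleIdeal (u : 𝔸ᶠ[A, K]ˣ)) * translate C (u : 𝔸ᶠ[A, K]ˣ) f *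
      shift hc (ideleIdeal (u : 𝔸ᶠ[A, K]ˣ))⁻¹ := rfl

/-- Translation divides the ideals by the ideal of `u` and conjugation multiplies them back, so only
the adele is divided by `u`. Extension by zero encodes divisibility: the right side vanishes unless
`u⁻¹ z` lies in both lattices. -/
lemma extZero_divEndo (u : integralIdeles A K) (f : ConvAlg A K C)
    (I J : (FractionalIdeal A⁰ K)ˣ) (z : 𝔸ᶠ[A, K]) :
    extZero (divEndo C hc u f).1 I J z =
      extZero f.1 I J (((u : 𝔸ᶠ[A, K]ˣ)⁻¹ : 𝔸ᶠ[A, K]ˣ) * z) := by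
  rw [divEndo_apply, extZero_shift_mul_mul_shift hc (ideleIdeal_le_one u), extZero_translate,
    inv_mul_cancel_left, inv_mul_cancel_left]

lemma divEndo_apply_of_isQuotientBy (u : integralIdeles A K) (f : ConvAlg A K C)
    {Q Q' : CommPair A K} (h : IsQuotientBy (u : 𝔸ᶠ[A, K]ˣ) Q.fst Q'.fst)
    (h' : IsQuotientBy (u : 𝔸ᶠ[A, K]ˣ) Q.snd Q'.snd) : (divEndo C hc u f).1 Q = f.1 Q' := by
  rw [← extZero_self (divEndo C hc u f).1 Q, extZero_divEndo, h.2, Units.inv_mul_cancel_left, ← h.1,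
    ← h'.1,
    extZero_self]

lemma exists_isQuotientBy_iff (u : 𝔸ᶠ[A, K]ˣ) (L : KLattice A K) :
    (∃ M, IsQuotientBy u L M) ↔ ((u⁻¹ : 𝔸ᶠ[A, K]ˣ) : 𝔸ᶠ[A, K]) * L.phi ∈ adelicSpan L.lat := by
  constructor
  · rintro ⟨M, h1, h2⟩
    rw [h2, Units.inv_mul_cancel_left, ← h1]
    exact M.mem
  · intro h
    exact ⟨⟨L.lat, _, h⟩, rfl, (Units.mul_inv_cancel_left _ _).symm⟩

lemma divEndo_apply_eq_zero (u : integralIdeles A K) (f : ConvAlg A K C) {Q : CommPair A K}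
    (h : ¬ ((∃ M, IsQuotientBy (u : 𝔸ᶠ[A, K]ˣ) Q.fst M) ∧
      ∃ M, IsQuotientBy (u : 𝔸ᶠ[A, K]ˣ) Q.snd M)) : (divEndo C hc u f).1 Q = 0 := by
  by_contra h0
  rw [← extZero_self (divEndo C hc u f).1 Q, extZero_divEndo] at h0
  have h1 := mem_of_extZero h0
  exact h ⟨(exists_isQuotientBy_iff _ _).2 h1.1,
    (exists_isQuotientBy_iff _ _).2 (Q.comm ▸ h1.2)⟩

lemma divEndo_one : divEndo C hc 1 = NonUnitalAlgHom.id C (ConvAlg A K C) :=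
  NonUnitalAlgHom.ext fun f => ext_of fun I J z => by
    rw [extZero_divEndo]
    simp

lemma divEndo_mul (u w : integralIdeles A K) :
    divEndo C hc (u * w) = (divEndo C hc u).comp (divEndo C hc w) :=
  NonUnitalAlgHom.ext fun f => ext_of fun I J z => by
    rw [NonUnitalAlgHom.comp_apply, extZero_divEndo, extZero_divEndo, extZero_divEndo,
      Submonoid.coe_mul, mul_inv_rev, Units.val_mul, mul_assoc]

lemma divEndo_twist (u : integralIdeles A K) (c : (FractionalIdeal A⁰ K)ˣ → C)
    (f : ConvAlg A K C) : divEndo C hc u (twist c f) = twist c (divEndo C hc u f) := by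
  have key : ∀ (f : ConvAlg A K C) I J z,
      extZero (twist c f).1 I J z = c (I * J⁻¹) * extZero f.1 I J z := fun f I J z => by
    unfold extZero
    split_ifs
    · rfl
    · rw [mul_zero]
  exact ext_of fun I J z => by rw [extZero_divEndo, key, key, extZero_divEndo]

lemma opNorm_divEndo_le [IsUltrametricDist C] (u : integralIdeles A K) (f : ConvAlg A K C) :
    opNorm (divEndo C hc u f).1 ≤ opNorm f.1 :=
  opNorm_le_opNorm fun Q => by
    by_cases h : (∃ M, IsQuotientBy (u : 𝔸ᶠ[A, K]ˣ) Q.fst M) ∧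
      ∃ M, IsQuotientBy (u : 𝔸ᶠ[A, K]ˣ) Q.snd M
    · obtain ⟨⟨M, hM⟩, N, hN⟩ := h
      refine Or.inr ⟨⟨M, N, ?_⟩, divEndo_apply_of_isQuotientBy hc u f hM hN⟩
      have h1 := Q.comm
      rw [hM.2, hN.2] at h1
      exact (Units.mul_right_inj _).1 h1
    · exact Or.inl (divEndo_apply_eq_zero hc u f h)

lemma opNorm_translate_le [IsUltrametricDist C] (u : 𝔸ᶠ[A, K]ˣ) (f : ConvAlg A K C) :
    opNorm (translate C u f).1 ≤ opNorm f.1 :=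
  opNorm_le_opNorm fun Q => Or.inr ⟨_, translate_apply u f Q⟩

/-- An `a ∈ Kˣ` with `1 / a ∉ A` acts non-trivially: `(A, 1)` is not divisible by `a`. -/
lemma divEndo_ne_id (u : integralIdeles A K) {a : Kˣ}
    (ha : ((a⁻¹ : Kˣ) : K) ∉ Set.range (algebraMap A K))
    (hu : (u : 𝔸ᶠ[A, K]ˣ) = FiniteAdeleRing.unitEmbedding A K a) :
    divEndo C hc u ≠ NonUnitalAlgHom.id C (ConvAlg A K C) := by
  classical
  intro h
  have h1 : (1 : 𝔸ᶠ[A, K]) ∈ adelicSpan (1 : (FractionalIdeal A⁰ K)ˣ) :=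
    mem_adelicSpan_one.2 (one_mem _)
  let L : KLattice A K := ⟨1, 1, h1⟩
  have h2 : (shift hc 1 : ConvAlg A K C).1 ⟨L, L, rfl⟩ = 1 := by
    rw [shift_apply, one_mul, if_pos rfl]
  have h3 : ¬ ∃ M, IsQuotientBy (u : 𝔸ᶠ[A, K]ˣ) L M := by
    rw [exists_isQuotientBy_iff, hu, ← map_inv]
    intro h4
    have h5 := mem_adelicSpan_one.1 h4
    rw [mul_one] at h5
    exact ha (mem_range_of_mem_integralAdeles h5)
  have h4 := divEndo_apply_eq_zero hc u (shift hc 1 : ConvAlg A K C) (Q := ⟨L, L, rfl⟩)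
    fun h5 => h3 h5.1
  rw [h] at h4
  exact one_ne_zero (h2.symm.trans h4)

end ConvAlg

end Endomorphisms

/-! ### KMS states and the action of the idele classes -/

lemma onePow_zero (p : ℕ) [Fact p.Prime] {C : Type*} [NormedField C] (w : C) :
    onePow p w 0 = 1 := by
  rw [onePow, tsum_eq_single 0 fun j hj => by
    rw [Ring.choose_zero_pos _ (Nat.pos_of_ne_zero hj), map_zero, ZMod.val_zero, Nat.cast_zero,
      zero_mul], Ring.choose_zero_right, map_one, ZMod.val_one, Nat.cast_one, pow_zero, one_mul]

/-- Used with `S` the integral ideles, which meet every coset of the principal ideles. -/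
lemma quotient_monoidHom_ext {G H : Type*} [CommGroup G] [Group H] {N : Subgroup G} {S : Set G}
    (hS : ∀ w, ∃ n ∈ N, n * w ∈ S) {Ψ Ψ' : G ⧸ N →* H}
    (h : ∀ s ∈ S, Ψ (QuotientGroup.mk s) = Ψ' (QuotientGroup.mk s)) : Ψ = Ψ' := by
  refine QuotientGroup.monoidHom_ext _ (MonoidHom.ext fun w => ?_)
  obtain ⟨n, hn, hw⟩ := hS w
  have h1 : (QuotientGroup.mk w : G ⧸ N) = QuotientGroup.mk (n * w) :=
    QuotientGroup.eq.2 (by rwa [mul_comm, mul_inv_cancel_right])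
  simp only [MonoidHom.comp_apply, QuotientGroup.mk'_apply]
  rw [h1, h _ hw]

section KMS

variable (F : Type*) [Field F] (p : ℕ) [Fact p.Prime]
  {A K : Type*} [CommRing A] [IsDedekindDomain A] [Field K] [Algebra A K] [IsFractionRing A K]
  [Algebra F A] (P : Place K) (π : P.KInf)

/-- At `y = 0` the one-unit factor is `1` and only a power of `x` remains. This is what makes the
normalizing factor `φ (θ_u 1)` invertible. -/
lemma idealPow_ne_zero (x : P.CInfˣ) (I : (FractionalIdeal A⁰ K)ˣ) :
    idealPow F p P π (x, 0) I ≠ 0 := by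
  rw [idealPow, onePow_zero, mul_one]
  exact Units.ne_zero _

variable {F p P π} {x : P.CInfˣ} {φ : ConvAlg A K P.CInf →ₗ[P.CInf] P.CInf}

open ConvAlg

lemma IsKMS.apply_eq_one (h : IsKMS F p P π x φ) {e : ConvAlg A K P.CInf} (he : IsIdentity e) :
    φ e = 1 := by
  obtain ⟨e', he', h1⟩ := h.normalized
  rw [← h1, ← (he e').2, (he' e).1]

/-- The KMS condition moves the left factor `shift B` to the right end, at the cost of its
eigenvalue. There it cancels against `shift B⁻¹`. -/
lemma IsKMS.apply_conj_shift (h : IsKMS F p P π x φ) (hc : IsCocompact A K)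
    {B : (FractionalIdeal A⁰ K)ˣ} (hB : (B : FractionalIdeal A⁰ K) ≤ 1) (f : ConvAlg A K P.CInf) :
    φ (shift hc B * f * shift hc B⁻¹) = idealPow F p P π (x, 0) B⁻¹ * φ f := by
  rw [mul_assoc, ← h.kms, timeEvolution, twist_shift, mul_smul_comm, mul_assoc,
    shift_inv_mul_shift hc hB, (isIdentity_shift_one hc _).2, map_smul, smul_eq_mul]

lemma IsKMS.apply_divEndo (h : IsKMS F p P π x φ) (hc : IsCocompact A K) (u : integralIdeles A K)
    (f : ConvAlg A K P.CInf) : φ (divEndo P.CInf hc u f) =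
      idealPow F p P π (x, 0) (ideleIdeal (u : 𝔸ᶠ[A, K]ˣ))⁻¹ *
        φ (translate P.CInf (u : 𝔸ᶠ[A, K]ˣ) f) := by
  rw [divEndo_apply, h.apply_conj_shift hc (ideleIdeal_le_one u)]

lemma IsKMS.apply_divEndo_one (h : IsKMS F p P π x φ) (hc : IsCocompact A K)
    (u : integralIdeles A K) : φ (divEndo P.CInf hc u (shift hc 1)) =
      idealPow F p P π (x, 0) (ideleIdeal (u : 𝔸ᶠ[A, K]ˣ))⁻¹ := by
  rw [h.apply_divEndo, translate_shift, h.apply_eq_one (isIdentity_shift_one hc), mul_one]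

lemma IsKMS.comp_translate (hc : IsCocompact A K) (h : IsKMS F p P π x φ) (u : 𝔸ᶠ[A, K]ˣ) :
    IsKMS F p P π x (φ ∘ₗ translateₗ u) where
  bounded := by
    obtain ⟨B, hB⟩ := h.bounded
    exact ⟨B, fun f => (hB _).trans (mul_le_mul_right (opNorm_translate_le u f) _)⟩
  kms f g := by
    have h1 := h.kms (translate P.CInf u f) (translate P.CInf u g)
    rw [timeEvolution, ← translate_twist, ← map_mul, ← map_mul] at h1
    exact h1
  normalized := ⟨shift hc 1, isIdentity_shift_one hc,
    (congrArg φ (translate_shift hc u 1)).trans (h.apply_eq_one (isIdentity_shift_one hc))⟩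

variable (F p P π x)

/-- The action of the ideles on KMS functionals by translation. -/
noncomputable def kmsTranslate (hc : IsCocompact A K) : 𝔸ᶠ[A, K]ˣ →*
    Equiv.Perm {φ : ConvAlg A K P.CInf →ₗ[P.CInf] P.CInf // IsKMS F p P π x φ} :=
  have h : ∀ u w : 𝔸ᶠ[A, K]ˣ,
      (translateₗ u : ConvAlg A K P.CInf →ₗ[P.CInf] _) ∘ₗ translateₗ w = translateₗ (u * w) :=
    fun u w => LinearMap.ext fun f => (translate_mul u w f).symm
  have h1 : (translateₗ 1 : ConvAlg A K P.CInf →ₗ[P.CInf] _) = LinearMap.id :=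
    LinearMap.ext fun f => translate_one f
  { toFun u :=
      { toFun φ := ⟨φ.1 ∘ₗ translateₗ u, φ.2.comp_translate hc u⟩
        invFun φ := ⟨φ.1 ∘ₗ translateₗ u⁻¹, φ.2.comp_translate hc u⁻¹⟩
        left_inv φ := Subtype.ext <| by
          change (φ.1 ∘ₗ _) ∘ₗ _ = φ.1
          rw [LinearMap.comp_assoc, h, mul_inv_cancel, h1, LinearMap.comp_id]
        right_inv φ := Subtype.ext <| by
          change (φ.1 ∘ₗ _) ∘ₗ _ = φ.1
          rw [LinearMap.comp_assoc, h, inv_mul_cancel, h1, LinearMap.comp_id] }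
    map_one' := Equiv.ext fun φ => Subtype.ext <| by
      change φ.1 ∘ₗ _ = φ.1
      rw [h1, LinearMap.comp_id]
    -- Precomposition reverses the order of the factors, which is harmless in a commutative group.
    map_mul' u w := Equiv.ext fun φ => Subtype.ext <| by
      change φ.1 ∘ₗ translateₗ (u * w) = (φ.1 ∘ₗ translateₗ w) ∘ₗ translateₗ u
      rw [LinearMap.comp_assoc, h, mul_comm] }

lemma kmsTranslate_apply (hc : IsCocompact A K) (u : 𝔸ᶠ[A, K]ˣ)
    (φ : {φ : ConvAlg A K P.CInf →ₗ[P.CInf] P.CInf // IsKMS F p P π x φ}) (f : ConvAlg A K P.CInf) :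
    (kmsTranslate F p P π x hc u φ).1 f = φ.1 (translate P.CInf u f) := rfl

/-- Normalization cancels the eigenvalue in `IsKMS.apply_divEndo` and leaves translation, which is
trivial on principal ideles. Uniqueness holds because every idele becomes integral after
multiplication by an element of `Kˣ`. -/
lemma existsUnique_action (hc : IsCocompact A K) :
    ∃! Ψ : (𝔸ᶠ[A, K]ˣ ⧸ (FiniteAdeleRing.unitEmbedding A K).range) →*
        Equiv.Perm {φ : ConvAlg A K P.CInf →ₗ[P.CInf] P.CInf // IsKMS F p P π x φ},
      ∀ (u : integralIdeles A K) φ f, (Ψ (QuotientGroup.mk (u : 𝔸ᶠ[A, K]ˣ)) φ).1 f =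
        (φ.1 (divEndo P.CInf hc u (shift hc 1)))⁻¹ * φ.1 (divEndo P.CInf hc u f) := by
  have key : ∀ (u : integralIdeles A K)
      (φ : {φ : ConvAlg A K P.CInf →ₗ[P.CInf] P.CInf // IsKMS F p P π x φ}) f,
      (kmsTranslate F p P π x hc (u : 𝔸ᶠ[A, K]ˣ) φ).1 f =
        (φ.1 (divEndo P.CInf hc u (shift hc 1)))⁻¹ * φ.1 (divEndo P.CInf hc u f) := by
    intro u φ f
    rw [φ.2.apply_divEndo_one, φ.2.apply_divEndo,
      inv_mul_cancel_left₀ (idealPow_ne_zero F p P π x _),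
      kmsTranslate_apply]
  refine ⟨QuotientGroup.lift _ (kmsTranslate F p P π x hc) ?_, fun u φ f => ?_, fun Ψ hΨ => ?_⟩
  · rintro _ ⟨a, rfl⟩
    refine Equiv.ext fun φ => Subtype.ext <| LinearMap.ext fun f => ?_
    rw [kmsTranslate_apply, translate_unitEmbedding]
    rfl
  · exact key u φ f
  · refine quotient_monoidHom_ext (S := Set.range fun u : integralIdeles A K => (u : 𝔸ᶠ[A, K]ˣ))
      (fun w => ?_) ?_
    · obtain ⟨a, u, hu⟩ := exists_mul_mem_integralIdeles w
      exact ⟨_, ⟨a, rfl⟩, u, hu⟩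
    · rintro _ ⟨u, rfl⟩
      refine Equiv.ext fun φ => Subtype.ext <| LinearMap.ext fun f => ?_
      exact (hΨ u φ f).trans (key u φ f).symm

end KMS

/-- In an algebraically closed field, one of the `n`-th roots of a one-unit is a one-unit. -/
lemma exists_pow_eq_oneUnit {E : Type*} [NormedField E] [IsAlgClosed E] {n : ℕ}
    (hn : n ≠ 0) {w : E} (hw : ‖w - 1‖ < 1) :
    ∃ x : E, x ^ n = w ∧ ‖x - 1‖ < 1 := by
  by_contra! h
  let f : Polynomial E := Polynomial.X ^ n - Polynomial.C w
  have hf : f.Monic := Polynomial.monic_X_pow_sub_C w hn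
  -- The norm of `1 - w` is the product of the distances from `1` to the `n`-th roots of `w`, so
  -- these distances cannot all be at least `1`.
  have h1 := (IsAlgClosed.splits f).eval_eq_prod_roots_of_monic hf 1
  have h2 : 1 ≤ ‖((f.roots.map fun a => 1 - a).prod : E)‖ := by
    refine Multiset.prod_induction (fun x : E => 1 ≤ ‖x‖) _ (fun a b ha hb => ?_) (by simp) ?_
    · rw [norm_mul]
      exact one_le_mul_of_one_le_of_one_le ha hb
    · intro a ha
      obtain ⟨x, hx, rfl⟩ := Multiset.mem_map.1 ha
      rw [norm_sub_rev]
      refine h x ?_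
      have h3 := (Polynomial.mem_roots'.1 hx).2
      simpa [f, sub_eq_zero] using h3
  rw [← h1] at h2
  have h3 : ‖f.eval 1‖ = ‖w - 1‖ := by
    rw [norm_sub_rev]
    simp [f]
  exact absurd hw (not_lt.2 (h3 ▸ h2))

/-! ### One-units of an ultrametric field and their divisibility -/

section OneUnits

variable {E : Type*} [NormedField E] [IsUltrametricDist E]

lemma norm_eq_of_norm_sub_lt {x y : E} (h : ‖x - y‖ < ‖y‖) : ‖x‖ = ‖y‖ := by
  have h1 := IsUltrametricDist.norm_add_eq_max_of_norm_ne_norm h.ne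
  rwa [sub_add_cancel, max_eq_right h.le] at h1

lemma norm_mul_sub_one_lt {x y : E} (hx : ‖x - 1‖ < 1) (hy : ‖y - 1‖ < 1) :
    ‖x * y - 1‖ < 1 := by
  have hx1 : ‖x‖ = 1 := by simpa using norm_eq_of_norm_sub_lt (y := (1 : E)) (by simpa using hx)
  have h : x * y - 1 = x * (y - 1) + (x - 1) := by ring
  rw [h]
  refine (IsUltrametricDist.norm_add_le_max _ _).trans_lt (max_lt ?_ hx)
  rwa [norm_mul, hx1, one_mul]

variable (E) in
/-- The group of one-units of a non-archimedean field. -/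
def oneUnits : Subgroup Eˣ where
  carrier := {u | ‖(u : E) - 1‖ < 1}
  mul_mem' ha hb := norm_mul_sub_one_lt ha hb
  one_mem' := by simp
  inv_mem' {u} hu := by
    have h1 : ‖(u : E)‖ = 1 := by
      simpa using norm_eq_of_norm_sub_lt (y := (1 : E)) (by simpa using hu)
    have h : ((u⁻¹ : Eˣ) : E) - 1 = -((u⁻¹ : Eˣ) : E) * ((u : E) - 1) := by
      rw [neg_mul, mul_sub, Units.inv_mul]
      ring
    change ‖((u⁻¹ : Eˣ) : E) - 1‖ < 1
    rw [h, norm_mul, norm_neg, Units.val_inv_eq_inv_val, norm_inv, h1, inv_one, one_mul]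
    exact hu

lemma mem_oneUnits {u : Eˣ} : u ∈ oneUnits E ↔ ‖(u : E) - 1‖ < 1 := Iff.rfl

noncomputable instance [IsAlgClosed E] : RootableBy (oneUnits E) ℕ :=
  rootableByOfPowLeftSurj _ _ fun {n} hn w => by
    obtain ⟨x, hx, hx1⟩ := exists_pow_eq_oneUnit hn w.2
    have hx0 : x ≠ 0 := by
      rintro rfl
      simp at hx1
    exact ⟨⟨Units.mk0 x hx0, hx1⟩, Subtype.ext (Units.ext hx)⟩

end OneUnits

/-- Homomorphisms to a divisible commutative group extend. -/
lemma exists_extension_of_rootable {M N D : Type*} [CommGroup M] [CommGroup N] [CommGroup D]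
    [RootableBy D ℕ] (f : M →* N) (g : M →* D) (h : f.ker ≤ g.ker) :
    ∃ g' : N →* D, ∀ m, g' (f m) = g m := by
  let : RootableBy D ℤ := Group.rootableByIntOfRootableByNat D
  let : DivisibleBy (Additive D) ℤ :=
    { div := fun a n => Additive.ofMul (RootableBy.root a.toMul n)
      div_zero := fun a => congrArg Additive.ofMul (RootableBy.root_zero a.toMul)
      div_cancel := fun a hn => congrArg Additive.ofMul (RootableBy.root_cancel a.toMul hn) }
  -- Divisible abelian groups are injective by Baer's criterion; the extension is along the
  -- embedding of `M / ker f` in `N`.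
  obtain ⟨g', hg'⟩ := (Module.Baer.of_divisible (Additive D)).extension_property_addMonoidHom
    (MonoidHom.toAdditive (QuotientGroup.kerLift f)) (QuotientGroup.kerLift_injective f)
    (MonoidHom.toAdditive (QuotientGroup.lift f.ker g h))
  exact ⟨MonoidHom.toAdditive.symm g', fun m =>
    congrArg Additive.toMul (DFunLike.congr_fun hg' (Additive.ofMul (QuotientGroup.mk m)))⟩

lemma norm_sub_lt_of_lt {E : Type*} [NormedField E] [IsUltrametricDist E] {x y : E} {r : ℝ}
    (hx : ‖x‖ < r) (hy : ‖y‖ < r) : ‖x - y‖ < r := by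
  rw [sub_eq_add_neg]
  exact (IsUltrametricDist.norm_add_le_max _ _).trans_lt (max_lt hx (by rwa [norm_neg]))

/-! ### Valuation, sign and Teichmüller decomposition in `K∞` -/

namespace Place

variable {K : Type*} [Field K] (P : Place K)

lemma one_lt_resCard_real : (1 : ℝ) < P.resCard := by exact_mod_cast P.one_lt_resCard

lemma resCard_pos : (0 : ℝ) < P.resCard := one_pos.trans P.one_lt_resCard_real

lemma exists_norm_sub_lt (x : P.KInf) {ε : ℝ} (hε : 0 < ε) : ∃ a : K, ‖P.toKInf a - x‖ < ε := by
  obtain ⟨a, ha⟩ := P.denseRange_toKInf.exists_dist_lt x hε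
  exact ⟨a, by rwa [dist_comm, dist_eq_norm] at ha⟩

/-- `K` is dense and an ultrametric norm is locally constant away from `0`, so completion adds no
new values. -/
lemma exists_norm_eq_zpow {x : P.KInf} (hx : x ≠ 0) : ∃ n : ℤ, ‖x‖ = (P.resCard : ℝ) ^ n := by
  obtain ⟨a, ha⟩ := P.exists_norm_sub_lt x (norm_pos_iff.2 hx)
  have h1 := norm_eq_of_norm_sub_lt ha
  rw [norm_toKInf] at h1
  have ha0 : P.val a ≠ 0 := by
    rw [Valuation.ne_zero_iff]
    rintro rfl
    rw [map_zero] at h1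
    exact hx (norm_eq_zero.1 h1.symm)
  exact ⟨WithZero.log (P.val a), by rw [← h1, P.absVal_eq_zpow (WithZero.exp_log ha0).symm]⟩

lemma ord_eq {x : P.KInf} {n : ℤ} (h : ‖x‖ = (P.resCard : ℝ) ^ n) : P.ord x = -n := by
  rw [ord, h, Int.log_zpow P.one_lt_resCard]

lemma norm_eq_zpow_ord {x : P.KInf} (hx : x ≠ 0) : ‖x‖ = (P.resCard : ℝ) ^ (-P.ord x) := by
  obtain ⟨n, hn⟩ := P.exists_norm_eq_zpow hx
  rw [P.ord_eq hn, neg_neg, hn]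

lemma ord_mul {x y : P.KInf} (hx : x ≠ 0) (hy : y ≠ 0) : P.ord (x * y) = P.ord x + P.ord y := by
  rw [P.ord_eq (n := -P.ord x + -P.ord y), neg_add, neg_neg, neg_neg]
  rw [norm_mul, P.norm_eq_zpow_ord hx, P.norm_eq_zpow_ord hy, zpow_add₀ P.resCard_pos.ne']

lemma ord_eq_zero {x : P.KInf} (hx : ‖x‖ = 1) : P.ord x = 0 := by
  rw [P.ord_eq (n := 0) (by rw [hx, zpow_zero]), neg_zero]

variable {P} {π : P.KInf}

lemma IsUniformizer.ne_zero (hπ : P.IsUniformizer π) : π ≠ 0 := by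
  rw [← norm_ne_zero_iff, hπ]
  exact inv_ne_zero P.resCard_pos.ne'

lemma IsUniformizer.norm_zpow (hπ : P.IsUniformizer π) (n : ℤ) :
    ‖π ^ n‖ = (P.resCard : ℝ) ^ (-n) := by
  rw [_root_.norm_zpow, hπ, inv_zpow, zpow_neg]

lemma IsUniformizer.norm_angle (hπ : P.IsUniformizer π) {x : P.KInf} (hx : x ≠ 0) :
    ‖P.angle π x‖ = 1 := by
  rw [angle, norm_mul, hπ.norm_zpow, P.norm_eq_zpow_ord hx, ← zpow_add₀ P.resCard_pos.ne',
    neg_neg, neg_add_cancel, zpow_zero]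

lemma IsUniformizer.angle_mul (hπ : P.IsUniformizer π) {x y : P.KInf} (hx : x ≠ 0) (hy : y ≠ 0) :
    P.angle π (x * y) = P.angle π x * P.angle π y := by
  rw [angle, angle, angle, P.ord_mul hx hy, neg_add, zpow_add₀ hπ.ne_zero, mul_mul_mul_comm]

lemma angle_eq_self {x : P.KInf} (hx : ‖x‖ = 1) : P.angle π x = x := by
  rw [angle, P.ord_eq_zero hx, neg_zero, zpow_zero, mul_one]

lemma IsUniformizer.angle_mul_zpow (hπ : P.IsUniformizer π) {x : P.KInf} (hx : ‖x‖ = 1) (n : ℤ) :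
    P.angle π (x * π ^ n) = x := by
  rw [angle, P.ord_eq (n := -n) (by rw [norm_mul, hx, one_mul, hπ.norm_zpow]), neg_neg, mul_assoc,
    ← zpow_add₀ hπ.ne_zero, add_neg_cancel, zpow_zero, mul_one]

variable (P) in
lemma toKInf_ne_zero (a : Kˣ) : P.toKInf a ≠ 0 :=
  (map_ne_zero P.toKInfHom).2 a.ne_zero

/-- The homomorphism `a ↦ ⟨a⟩`. -/
noncomputable def IsUniformizer.angleHom (hπ : P.IsUniformizer π) : Kˣ →* P.KInf where
  toFun a := P.angle π (P.toKInf a)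
  map_one' := by
    have h : P.toKInf ((1 : Kˣ) : K) = 1 := map_one P.toKInfHom
    rw [h, angle_eq_self norm_one]
  map_mul' a b := by
    have h : P.toKInf ((a * b : Kˣ) : K) = P.toKInf a * P.toKInf b := map_mul P.toKInfHom _ _
    rw [h, hπ.angle_mul (P.toKInf_ne_zero a) (P.toKInf_ne_zero b)]

variable (P) in
lemma charP_kInf (p : ℕ) [CharP K p] : CharP P.KInf p :=
  charP_of_injective_ringHom P.toKInfHom.injective p

variable (p : ℕ) [Fact p.Prime] [CharP K p]

variable (P) in
lemma exists_resCard_eq_pow : ∃ n : ℕ, P.resCard = p ^ n := by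
  have := P.finite_residue
  have := Fintype.ofFinite (IsLocalRing.ResidueField P.val.valuationSubring)
  have h0 : (p : IsLocalRing.ResidueField P.val.valuationSubring) = 0 := by
    have h1 : (p : P.val.valuationSubring) = 0 :=
      Subtype.ext (by push_cast; exact CharP.cast_eq_zero K p)
    rw [← map_natCast (IsLocalRing.residue P.val.valuationSubring), h1, map_zero]
  have : CharP (IsLocalRing.ResidueField P.val.valuationSubring) p :=
    (CharP.charP_iff_prime_eq_zero Fact.out).2 h0
  obtain ⟨n, -, hn⟩ := FiniteField.card (IsLocalRing.ResidueField P.val.valuationSubring) p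
  exact ⟨n, by rw [resCard, Nat.card_eq_fintype_card, hn]⟩

-- Elements of the residue field satisfy `X ^ Q = X` for `Q` its cardinality. Passing from an
-- approximation in `K` to `u` uses that the `Q`-th power map is additive in characteristic `p`.
include p in
lemma norm_pow_resCard_sub_lt {u : P.KInf} (hu : ‖u‖ = 1) : ‖u ^ P.resCard - u‖ < 1 := by
  have := P.finite_residue
  have := Fintype.ofFinite (IsLocalRing.ResidueField P.val.valuationSubring)
  have := P.charP_kInf p
  obtain ⟨n, hn⟩ := P.exists_resCard_eq_pow p
  obtain ⟨a, ha⟩ := P.exists_norm_sub_lt u one_pos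
  have hmono := WithZeroMulInt.toNNReal_strictMono P.one_lt_resCard'
  have ha1 : P.absVal a = 1 := by
    rw [← norm_toKInf, norm_eq_of_norm_sub_lt (hu ▸ ha), hu]
  have ha2 : P.val a ≤ 1 := by
    refine hmono.le_iff_le.1 ?_
    rw [map_one]
    exact_mod_cast ha1.le
  have h1 : ‖P.toKInf a ^ P.resCard - P.toKInf a‖ < 1 := by
    let x : P.val.valuationSubring := ⟨a, ha2⟩
    have h2 : IsLocalRing.residue _ (x ^ P.resCard - x) = 0 := by
      rw [map_sub, map_pow, resCard, Nat.card_eq_fintype_card, FiniteField.pow_card, sub_self]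
    rw [IsLocalRing.residue_eq_zero_iff, IsLocalRing.mem_maximalIdeal, mem_nonunits_iff,
      isUnit_valuationSubring_iff] at h2
    have h3 : P.val (a ^ P.resCard - a) < 1 := lt_of_le_of_ne (x ^ P.resCard - x).2 h2
    have h4 : P.absVal (a ^ P.resCard - a) < 1 := by
      have h5 := hmono h3
      rw [map_one] at h5
      exact_mod_cast h5
    have h5 : P.toKInf (a ^ P.resCard - a) = P.toKInf a ^ P.resCard - P.toKInf a := by
      rw [← toKInfHom_apply, map_sub, map_pow]
      rfl
    rwa [← h5, norm_toKInf]
  have h2 : u ^ P.resCard - u = (P.toKInf a ^ P.resCard - P.toKInf a) -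
      ((P.toKInf a - u) ^ P.resCard - (P.toKInf a - u)) := by
    rw [hn, sub_pow_char_pow]
    ring
  have h3 : ‖(P.toKInf a - u) ^ P.resCard‖ < 1 := by
    rw [norm_pow]
    exact pow_lt_one₀ (norm_nonneg _) ha (by have := P.one_lt_resCard; omega)
  rw [h2]
  exact norm_sub_lt_of_lt h1 (norm_sub_lt_of_lt h3 ha)

include p in
/-- The Teichmüller decomposition: a unit of `K∞` and some one-unit have the same
`(q ^ d - 1)`-st power. -/
lemma exists_oneUnit_pow_eq {u : P.KInf} (hu : ‖u‖ = 1) :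
    ∃ y : P.KInf, ‖y - 1‖ < 1 ∧ y ^ (P.resCard - 1) = u ^ (P.resCard - 1) := by
  have := P.charP_kInf p
  obtain ⟨n, hn⟩ := P.exists_resCard_eq_pow p
  have hQ := P.one_lt_resCard
  set Q := P.resCard with hQdef
  have h0 : ‖u ^ Q - u‖ < 1 := norm_pow_resCard_sub_lt p hu
  -- Consecutive terms differ by `(u ^ Q - u) ^ Q ^ i`, so the sequence converges. The limit `ζ` is
  -- the Teichmüller representative of `u`, with `ζ ^ (Q - 1) = 1`, and `u / ζ` is the required
  -- one-unit.
  let z : ℕ → P.KInf := fun i => u ^ Q ^ i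
  have hz : ∀ i, z (i + 1) - z i = (u ^ Q - u) ^ Q ^ i := fun i => by
    simp only [z, hn, ← pow_mul]
    rw [sub_pow_char_pow, ← pow_mul, ← pow_add, mul_add, mul_one, add_comm]
  have hlt : ∀ i, ‖z i - u‖ ≤ ‖u ^ Q - u‖ := fun i => by
    induction i with
    | zero => simp [z]
    | succ i ih =>
      have h1 : z (i + 1) - u = (z (i + 1) - z i) + (z i - u) := by ring
      rw [h1, hz]
      refine (IsUltrametricDist.norm_add_le_max _ _).trans (max_le ?_ ih)
      rw [norm_pow]
      exact pow_le_of_le_one (norm_nonneg _) h0.le (pow_ne_zero _ (by omega))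
  have hcauchy : CauchySeq z := by
    refine NonarchimedeanAddGroup.cauchySeq_of_tendsto_sub_nhds_zero ?_
    simp only [hz]
    rw [tendsto_zero_iff_norm_tendsto_zero]
    simp only [norm_pow]
    exact (tendsto_pow_atTop_nhds_zero_of_lt_one (norm_nonneg _) h0).comp
      (tendsto_pow_atTop_atTop_of_one_lt hQ)
  obtain ⟨ζ, hζ⟩ := cauchySeq_tendsto_of_complete hcauchy
  have h1 : ‖ζ - u‖ < 1 := lt_of_le_of_lt
    (le_of_tendsto' ((hζ.sub_const u).norm) hlt) h0
  have h2 : ζ ^ Q = ζ := by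
    refine tendsto_nhds_unique ?_ (hζ.comp (Filter.tendsto_add_atTop_nat 1))
    refine (hζ.pow Q).congr fun i => ?_
    simp only [z, Function.comp, ← pow_mul, pow_succ]
  have h3 : ‖ζ‖ = 1 := by rw [norm_eq_of_norm_sub_lt (hu ▸ h1), hu]
  have h4 : ζ ≠ 0 := by
    rw [← norm_ne_zero_iff, h3]
    exact one_ne_zero
  have h5 : ζ ^ (Q - 1) = 1 := by
    refine mul_right_cancel₀ h4 ?_
    rw [← pow_succ, Nat.sub_add_cancel hQ.le, h2, one_mul]
  refine ⟨u / ζ, ?_, by rw [div_pow, h5, div_one]⟩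
  rw [div_sub_one h4, norm_div, h3, div_one, norm_sub_rev]
  exact h1

end Place

/-! ### Existence of `I ↦ ⟨I⟩`, and the eigenvalues attached to principal ideals -/

namespace IsRegularOutside

variable {F A K : Type*} [Field F] [CommRing A] [Field K] [Algebra A K]
  [IsFractionRing A K] [Algebra F K] [Finite F] {P : Place K}

/-- A generator of the unit ideal is a unit of `A`, hence a constant, and a constant `c ≠ 1`
satisfies `|c - 1| = 1`. A positive generator is thus determined by its ideal. -/
lemma eq_one_of_toPrincipalIdeal_eq_one (hA : IsRegularOutside F A P) {a : Kˣ}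
    (ha : toPrincipalIdeal A K a = 1) (h1 : ‖P.toKInf a - 1‖ < 1) : a = 1 := by
  have key : ∀ a : Kˣ, toPrincipalIdeal A K a = 1 → ∃ b : A, algebraMap A K b = a := fun a ha => by
    rw [toPrincipalIdeal_eq_iff] at ha
    have h2 := FractionalIdeal.mem_spanSingleton_self A⁰ (a : K)
    rw [ha] at h2
    exact (FractionalIdeal.mem_one_iff A⁰).1 h2
  obtain ⟨b, hb⟩ := key a ha
  obtain ⟨b', hb'⟩ := key a⁻¹ (by rw [map_inv, ha, inv_one])
  have h3 : b * b' = 1 := IsFractionRing.injective A K (by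
    rw [map_mul, hb, hb', map_one, Units.mul_inv])
  obtain ⟨c, hc⟩ := hA.unit_mem_constants (Units.mkOfMulEqOne b b' h3)
  have h4 : algebraMap F K c = a := hc.trans hb
  have h5 : c - 1 = 0 := by
    by_contra h
    have h6 : P.absVal (a - 1) = 1 := by
      rw [P.absVal_eq_zpow (n := 0), zpow_zero]
      rw [← h4, ← map_one (algebraMap F K), ← map_sub, P.val_algebraMap_eq_one h, WithZero.exp_zero]
    rw [← P.norm_toKInf, ← P.toKInfHom_apply, map_sub, map_one, P.toKInfHom_apply] at h6
    exact h1.ne h6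
  ext
  rw [← h4, sub_eq_zero.1 h5, map_one, Units.val_one]

variable [IsDedekindDomain A] [Algebra F A] {π : P.KInf}

/-- The homomorphism `I ↦ ⟨I⟩` exists. -/
theorem exists_angleIdeal (hA : IsRegularOutside F A P) (hπ : P.IsUniformizer π) :
    ∃ h : (FractionalIdeal A⁰ K)ˣ →* P.CInfˣ, (∀ I, ‖(h I : P.CInf) - 1‖ < 1) ∧
      ∀ a : Kˣ, P.IsPositive π (P.toKInf a) →
        (h (toPrincipalIdeal A K a) : P.CInf) = P.embed (P.angle π (P.toKInf a)) := by
  let Kpos : Subgroup Kˣ := (oneUnits P.KInf).comap hπ.angleHom.toHomUnits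
  -- The values are taken in the algebraic closure, where divisibility of the one-units comes from
  -- extracting roots. The embedding in `C∞` is applied only at the end.
  let g : Kpos →* oneUnits (AlgebraicClosure P.KInf) :=
    ((Units.map (algebraMap P.KInf (AlgebraicClosure P.KInf)).toMonoidHom).comp
      (hπ.angleHom.toHomUnits.comp Kpos.subtype)).codRestrict _ fun a => by
        have h1 : ‖P.angle π (P.toKInf (a : Kˣ)) - 1‖ < 1 := a.2
        rw [mem_oneUnits]
        change ‖algebraMap P.KInf (AlgebraicClosure P.KInf) (P.angle π (P.toKInf (a : Kˣ))) - 1‖ < 1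
        rw [← map_one (algebraMap P.KInf (AlgebraicClosure P.KInf)), ← map_sub]
        exact (spectralNorm_extends _).trans_lt h1
  obtain ⟨g', hg'⟩ := exists_extension_of_rootable ((toPrincipalIdeal A K).comp Kpos.subtype) g
    fun a ha => by
      have h1 : ‖P.angle π (P.toKInf (a : Kˣ)) - 1‖ < 1 := a.2
      -- The kernel condition: if `(a)` is trivial, then `|a| = 1` by the product formula, so `⟨a⟩ =
      -- a`. Positivity then says that `a` itself is a one-unit, whence `a = 1`.
      have h2 : P.absVal (a : Kˣ) = 1 := by
        rw [hA.absVal_eq_pow_degIdeal (A := A), show toPrincipalIdeal A K (a : Kˣ) = 1 from ha,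
          degIdeal_one, zpow_zero]
      rw [Place.angle_eq_self ((P.norm_toKInf _).trans h2)] at h1
      have h3 : a = 1 := Subtype.ext (hA.eq_one_of_toPrincipalIdeal_eq_one ha h1)
      rw [h3]
      exact one_mem _
  refine ⟨(Units.map (UniformSpace.Completion.coeRingHom
    (α := AlgebraicClosure P.KInf)).toMonoidHom).comp ((oneUnits _).subtype.comp g'),
    fun I => ?_, fun a ha => ?_⟩
  · have h1 : ‖((g' I : (AlgebraicClosure P.KInf)ˣ) : AlgebraicClosure P.KInf) - 1‖ < 1 := (g' I).2
    rw [← UniformSpace.Completion.norm_coe, UniformSpace.Completion.coe_sub,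
      UniformSpace.Completion.coe_one] at h1
    exact h1
  · have h1 := hg' ⟨a, ha⟩
    exact congrArg (fun w : oneUnits (AlgebraicClosure P.KInf) =>
      (((w : (AlgebraicClosure P.KInf)ˣ) : AlgebraicClosure P.KInf) : P.CInf)) h1

/-- `angleIdeal` is defined by choice; existence gives it its defining property. -/
lemma angleIdeal_spec (hA : IsRegularOutside F A P) (hπ : P.IsUniformizer π) :
    (∀ I, ‖(P.angleIdeal A π I : P.CInf) - 1‖ < 1) ∧ ∀ a : Kˣ, P.IsPositive π (P.toKInf a) →
      (P.angleIdeal A π (toPrincipalIdeal A K a) : P.CInf) = P.embed (P.angle π (P.toKInf a)) :=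
  Classical.epsilon_spec (hA.exists_angleIdeal hπ)

end IsRegularOutside

/-- Frobenius gives `‖z - 1‖ ^ p ^ n = ‖z - 1‖ < 1`, which forces `z = 1`. Hence one-units have at
most one one-unit root of order `p ^ n - 1`. -/
lemma eq_one_of_pow_eq_self {E : Type*} [NormedField E] (p : ℕ) [Fact p.Prime] [CharP E p]
    {z : E} (hz : ‖z - 1‖ < 1) {n : ℕ} (hn : 1 < p ^ n) (h : z ^ p ^ n = z) : z = 1 := by
  have h1 : ‖z - 1‖ ^ p ^ n = ‖z - 1‖ := by
    rw [← norm_pow, sub_pow_char_pow, h, one_pow]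
  by_contra h2
  have h3 : 0 < ‖z - 1‖ := norm_pos_iff.2 (sub_ne_zero.2 h2)
  exact (pow_lt_self_of_lt_one₀ h3 hz hn).ne h1

namespace IsRegularOutside

variable {F A K : Type*} [Field F] [CommRing A] [IsDedekindDomain A] [Field K] [Algebra A K]
  [IsFractionRing A K] [Algebra F K] [Finite F] {P : Place K}

/-- `A` is not a field. -/
lemma exists_inv_notMem (hA : IsRegularOutside F A P) :
    ∃ a : Kˣ, (a : K) ∈ Set.range (algebraMap A K) ∧
      ((a⁻¹ : Kˣ) : K) ∉ Set.range (algebraMap A K) := by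
  obtain ⟨x, hx⟩ := P.surj (WithZero.exp 1)
  -- The quotient `a / c` has a simple pole at infinity, so `a` or `c` has a pole there. Its inverse
  -- vanishes at infinity, which no nonzero element of `A` does.
  obtain ⟨a, c, hc, rfl⟩ := IsFractionRing.div_surjective (A := A) x
  have key : ∀ a : A, a ≠ 0 → P.val (algebraMap A K a) ≠ 1 → ∃ a : Kˣ,
      (a : K) ∈ Set.range (algebraMap A K) ∧ ((a⁻¹ : Kˣ) : K) ∉ Set.range (algebraMap A K) := by
    intro a ha h
    have haK : algebraMap A K a ≠ 0 := by simpa using ha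
    refine ⟨Units.mk0 _ haK, ⟨a, rfl⟩, ?_⟩
    rintro ⟨b, hb⟩
    have hb' : algebraMap A K b = (algebraMap A K a)⁻¹ := by simpa using hb
    have hb0 : b ≠ 0 := by
      rintro rfl
      rw [map_zero] at hb'
      exact inv_ne_zero haK hb'.symm
    have h1 := hA.one_le_val hb0
    rw [hb', map_inv₀] at h1
    have h2 := hA.one_le_val ha
    exact h (le_antisymm ((one_le_inv₀ (zero_lt_one.trans_le h2)).1 h1) h2)
  have hc0 := nonZeroDivisors.ne_zero hc
  by_cases h : P.val (algebraMap A K c) = 1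
  · refine key a ?_ fun h' => ?_
    · rintro rfl
      rw [map_zero, zero_div, map_zero] at hx
      exact WithZero.exp_ne_zero hx.symm
    · rw [map_div₀, h, h', div_one, ← WithZero.exp_zero, WithZero.exp_inj] at hx
      exact zero_ne_one hx
  · exact key c hc0 h

variable [Algebra F A] {π : P.KInf}

/-- The sign is a root of unity: principal ideals have the same powers as positive elements of
`K∞`. -/
theorem exists_isPositive_posPow_eq (hA : IsRegularOutside F A P) (hπ : P.IsUniformizer π) (p : ℕ)
    [Fact p.Prime] [CharP K p] (b : Kˣ) : ∃ l : P.KInf, P.IsPositive π l ∧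
      ∀ s, idealPow F p P π s (toPrincipalIdeal A K b) = P.posPow F p π l s := by
  have := P.charP_kInf p
  have : CharP P.CInf p := charP_of_injective_ringHom P.embed.injective p
  obtain ⟨n, hn⟩ := P.exists_resCard_eq_pow p
  have hQ := P.one_lt_resCard
  have hb := P.toKInf_ne_zero b
  obtain ⟨y, hy, hyu⟩ := Place.exists_oneUnit_pow_eq p (hπ.norm_angle hb)
  have hy1 : ‖y‖ = 1 := by
    simpa using norm_eq_of_norm_sub_lt (y := (1 : P.KInf)) (by simpa using hy)
  have hang := hπ.angle_mul_zpow hy1 (P.ord (P.toKInf b))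
  obtain ⟨h1, h2⟩ := hA.angleIdeal_spec (A := A) hπ
  -- Although `b` need not be positive, its power of order `resCard - 1` is, so the defining
  -- property of `angleIdeal` applies to that power.
  have hpow : P.angle π (P.toKInf ((b ^ (P.resCard - 1) : Kˣ) : K)) = y ^ (P.resCard - 1) := by
    rw [hyu]
    exact map_pow hπ.angleHom b _
  have hyQ : ‖y ^ (P.resCard - 1) - 1‖ < 1 := by
    have hy0 : y ≠ 0 := by
      rw [← norm_ne_zero_iff, hy1]
      exact one_ne_zero
    exact pow_mem (show Units.mk0 y hy0 ∈ oneUnits P.KInf from hy) (P.resCard - 1)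
  have hemb : (P.angleIdeal A π (toPrincipalIdeal A K b) : P.CInf) = P.embed y := by
    have h3 := h2 (b ^ (P.resCard - 1)) (by rwa [Place.IsPositive, hpow])
    rw [hpow, map_pow, map_pow, map_pow, Units.val_pow_eq_pow_val] at h3
    have h4 : ‖P.embed y - 1‖ < 1 := by
      rw [← map_one P.embed, ← map_sub, P.norm_embed]
      exact hy
    have hy0 : P.embed y ≠ 0 := by
      rw [← norm_ne_zero_iff, P.norm_embed, hy1]
      exact one_ne_zero
    -- The quotient of `⟨(b)⟩` by `y` is a one-unit whose power of order `resCard - 1` is `1`, hence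
    -- it is `1`.
    have h5 := (oneUnits P.CInf).div_mem (h1 (toPrincipalIdeal A K b))
      (show Units.mk0 _ hy0 ∈ oneUnits P.CInf from h4)
    rw [mem_oneUnits, Units.val_div_eq_div_val, Units.val_mk0] at h5
    refine (div_eq_one_iff_eq hy0).1 (eq_one_of_pow_eq_self p h5 (hn ▸ hQ) ?_)
    rw [← hn, ← Nat.sub_add_cancel hQ.le, pow_succ, div_pow, h3, div_self (pow_ne_zero _ hy0),
      one_mul]
  -- This element has the absolute value of `b`, hence by the product formula the degree of `(b)`,
  -- and its one-unit part is `y`.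
  refine ⟨y * π ^ P.ord (P.toKInf b), by rwa [Place.IsPositive, hang], fun s => ?_⟩
  have hdeg : P.deg F (y * π ^ P.ord (P.toKInf b)) = degIdeal F (toPrincipalIdeal A K b) := by
    rw [Place.deg, norm_mul, hy1, one_mul, hπ.norm_zpow, ← P.norm_eq_zpow_ord hb, P.norm_toKInf,
      hA.absVal_eq_pow_degIdeal (A := A), Int.log_zpow Finite.one_lt_card]
  rw [idealPow, Place.posPow, hemb, hang, hdeg]

end IsRegularOutside

/-! ### Principal ideals, and the assembly of the theorem -/

section Principal

variable {A K : Type*} [CommRing A] [IsDedekindDomain A] [Field K] [Algebra A K]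
  [IsFractionRing A K]

lemma unitEmbedding_mem_integralIdeles {a : Kˣ} (ha : (a : K) ∈ Set.range (algebraMap A K)) :
    FiniteAdeleRing.unitEmbedding A K a ∈ integralIdeles A K := by
  have h : algebraMap K 𝔸ᶠ[A, K] a ∈ adelicSpan (1 : (FractionalIdeal A⁰ K)ˣ) :=
    Submodule.subset_span ⟨a, (FractionalIdeal.mem_one_iff A⁰).2 ha, rfl⟩
  exact mem_adelicSpan_one.1 h

/-- For principal `u = a`, the pairs with `L' = a L_u` are the pairs `((Λ, φ), (a Λ, φ))`. -/
lemma exists_isQuotientBy_and_eq_smul_iff (a : Kˣ) {L L' : KLattice A K} (h : L.phi = L'.phi) :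
    (∃ M, IsQuotientBy (FiniteAdeleRing.unitEmbedding A K a) L M ∧ L' = a • M) ↔
      L'.lat = toPrincipalIdeal A K a * L.lat := by
  constructor
  · rintro ⟨M, hM, rfl⟩
    exact congrArg (toPrincipalIdeal A K a * ·) hM.1
  · intro h'
    have h1 : L' = a • a⁻¹ • L' := (smul_inv_smul a L').symm
    refine ⟨a⁻¹ • L', ⟨?_, ?_⟩, h1⟩
    · change toPrincipalIdeal A K a⁻¹ * L'.lat = L.lat
      rw [h', map_inv, inv_mul_cancel_left]
    · rw [h]
      exact congrArg KLattice.phi h1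

end Principal

lemma IsRegularOutside.isCocompact {F A K : Type*} [Field F] [Finite F] [CommRing A]
    [IsDedekindDomain A] [Field K] [Algebra A K] [IsFractionRing A K]
    [Algebra F A] [Algebra F K] [IsScalarTower F A K] {P : Place K}
    (hA : IsRegularOutside F A P) : IsCocompact A K :=
  ⟨hA.exists_finite_representatives, isCompact_adelicSpan fun _ hI => hA.finite_quotient hI⟩

end KRational

theorem theorem4p13 {F A K : Type*} [Field F] [Finite F] (p : ℕ) [Fact p.Prime] [CharP F p]
    [CommRing A] [IsDedekindDomain A] [Field K] [Algebra A K] [IsFractionRing A K]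
    [Algebra F A] [Algebra F K] [IsScalarTower F A K]
    (P : Place K) (hA : IsRegularOutside F A P)
    (π : P.KInf) (hπ : P.IsUniformizer π) :
    ∃ (e : ConvAlg A K P.CInf)
      (θ : integralIdeles A K →
        (ConvAlg A K P.CInf →ₙₐ[P.CInf] ConvAlg A K P.CInf)),
      -- the algebra is unital
      IsIdentity e ∧
      -- the formula for `θ u`
      (∀ (u : integralIdeles A K) f (Q Q' : CommPair A K), IsQuotientBy u Q.fst Q'.fst →
        IsQuotientBy u Q.snd Q'.snd → (θ u f).1 Q = f.1 Q') ∧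
      (∀ (u : integralIdeles A K) f (Q : CommPair A K),
        ¬ ((∃ M, IsQuotientBy u Q.fst M) ∧ ∃ M, IsQuotientBy u Q.snd M) →
        (θ u f).1 Q = 0) ∧
      -- it is a non-trivial action by bounded endomorphisms commuting with the time evolution
      θ 1 = NonUnitalAlgHom.id P.CInf (ConvAlg A K P.CInf) ∧
      (∀ u v, θ (u * v) = (θ u).comp (θ v)) ∧
      (∃ u, θ u ≠ NonUnitalAlgHom.id P.CInf (ConvAlg A K P.CInf)) ∧
      (∀ u f, opNorm (θ u f).1 ≤ opNorm f.1) ∧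
      (∀ u s f, θ u (timeEvolution F p P π s f) =
        timeEvolution F p P π s (θ u f)) ∧
      -- nonzero elements `a` of `A` act by inner endomorphisms
      (∀ (u : integralIdeles A K) (a : Kˣ), (a : K) ∈ Set.range (algebraMap A K) →
        (u : (FiniteAdeleRing A K)ˣ) =
          FiniteAdeleRing.unitEmbedding A K a →
        ∃ μ ν : ConvAlg A K P.CInf,
          (∀ Q, (∃ M, IsQuotientBy u Q.fst M ∧ Q.snd = a • M) → μ.1 Q = 1) ∧
          (∀ Q, (¬ ∃ M, IsQuotientBy u Q.fst M ∧ Q.snd = a • M) → μ.1 Q = 0) ∧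
          (∀ Q, (∃ M, IsQuotientBy u Q.snd M ∧ Q.fst = a • M) → ν.1 Q = 1) ∧
          (∀ Q, (¬ ∃ M, IsQuotientBy u Q.snd M ∧ Q.fst = a • M) → ν.1 Q = 0) ∧
          ν * μ = e ∧
          (∀ f, θ u f = μ * f * ν) ∧
          ∃ l : P.KInf, P.IsPositive π l ∧
            ∀ s, timeEvolution F p P π s μ = P.posPow F p π l s • μ) ∧
      -- the induced action on KMS states
      ∀ x : P.CInfˣ,
        (∀ u φ, IsKMS F p P π x φ → φ (θ u e) ≠ 0) ∧
        ∃! Ψ : ((FiniteAdeleRing A K)ˣ ⧸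
            (FiniteAdeleRing.unitEmbedding A K).range) →*
            Equiv.Perm {φ : ConvAlg A K P.CInf →ₗ[P.CInf] P.CInf //
              IsKMS F p P π x φ},
          ∀ (u : integralIdeles A K) φ f,
            (Ψ (QuotientGroup.mk (u : (FiniteAdeleRing A K)ˣ)) φ).1 f =
              (φ.1 (θ u e))⁻¹ * φ.1 (θ u f) := by

  classical
  have hc : IsCocompact A K := hA.isCocompact
  have : CharP K p := charP_of_injective_algebraMap (algebraMap F K).injective p
  refine ⟨ConvAlg.shift hc 1, ConvAlg.divEndo P.CInf hc, ConvAlg.isIdentity_shift_one hc,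
    fun u f Q Q' => ConvAlg.divEndo_apply_of_isQuotientBy hc u f,
    fun u f Q => ConvAlg.divEndo_apply_eq_zero hc u f, ConvAlg.divEndo_one hc,
    ConvAlg.divEndo_mul hc, ?_, ConvAlg.opNorm_divEndo_le hc,
    fun u s f => ConvAlg.divEndo_twist hc u _ f, fun u a ha hu => ?_,
    fun x => ⟨fun u φ hφ => ?_, existsUnique_action F p P π x hc⟩⟩
  · obtain ⟨a, ha, ha'⟩ := hA.exists_inv_notMem
    exact ⟨⟨_, unitEmbedding_mem_integralIdeles ha⟩, ConvAlg.divEndo_ne_id hc _ ha' rfl⟩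
  · have hJ : ideleIdeal (u : (FiniteAdeleRing A K)ˣ) = toPrincipalIdeal A K a := by
      rw [hu, ideleIdeal_unitEmbedding]
    have hJ1 : (toPrincipalIdeal A K a : FractionalIdeal A⁰ K) ≤ 1 := hJ ▸ ideleIdeal_le_one u
    have hν : ∀ Q : CommPair A K, Q.snd.lat = (toPrincipalIdeal A K a)⁻¹ * Q.fst.lat ↔
        Q.fst.lat = toPrincipalIdeal A K a * Q.snd.lat := fun Q => by
      rw [eq_inv_mul_iff_mul_eq, eq_comm]
    refine ⟨ConvAlg.shift hc (toPrincipalIdeal A K a), ConvAlg.shift hc (toPrincipalIdeal A K a)⁻¹,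
      fun Q hQ => ?_, fun Q hQ => ?_, fun Q hQ => ?_, fun Q hQ => ?_,
      ConvAlg.shift_inv_mul_shift hc hJ1, fun f => ?_, ?_⟩
    · rw [hu, exists_isQuotientBy_and_eq_smul_iff a Q.comm] at hQ
      rw [ConvAlg.shift_apply, if_pos hQ]
    · rw [hu, exists_isQuotientBy_and_eq_smul_iff a Q.comm] at hQ
      rw [ConvAlg.shift_apply, if_neg hQ]
    · rw [hu, exists_isQuotientBy_and_eq_smul_iff a Q.comm.symm, ← hν] at hQ
      rw [ConvAlg.shift_apply, if_pos hQ]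
    · rw [hu, exists_isQuotientBy_and_eq_smul_iff a Q.comm.symm, ← hν] at hQ
      rw [ConvAlg.shift_apply, if_neg hQ]
    · rw [ConvAlg.divEndo_apply, hJ, hu, ConvAlg.translate_unitEmbedding]
    -- The eigenvalue of `shift J` is `(J⁻¹) ^ s`, so the positive element is the one attached to
    -- `a⁻¹`.
    · obtain ⟨l, hl, hl'⟩ := hA.exists_isPositive_posPow_eq (A := A) hπ p a⁻¹
      refine ⟨l, hl, fun s => ?_⟩
      rw [timeEvolution, ConvAlg.twist_shift, ← map_inv, hl']
  · rw [hφ.apply_divEndo_one hc]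
    exact idealPow_ne_zero F p P π x _
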